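/- **Model.** Fix dimensions $p,q$. For $k=1,2,\dots$ consider a distributed low-rank spatial model with $J_k$ machines, $n_{k,j}$ observations on machine $j$ and $N_k=\sum_j n_{k,j}$ observations in total, $$z(\mathbf s_{ji})=x_{ji}^\top\gamma^*+b_k(\mathbf s_{ji};\theta^*)^\top\eta+\varepsilon(\mathbf s_{ji}),\qquad 1\le j\le J_k,\ 1\le i\le n_{k,j},$$ with known locations $\mathbf s_{ji}$, a known $\mathbb R^{m_k}$-valued function $b_k(\cdot;\theta)$, a latent vector $\eta\sim\mathcal N(0,K_k(\theta^*))$, where $K_k(\theta)$ is a known positive definite $m_k\times m_k$ matrix for $\theta\in\Theta$, and i.i.d. errors $\varepsilon(\mathbf s_{ji})\sim\mathcal N(0,1/\delta^*)$; the covariates, $\eta$ and the errors are independent. In stacked form $z=X\gamma^*+B_k(\theta^*)\eta+\varepsilon$, where the rows of $B_k(\theta)$ are the vectors $b_k(\mathbf s_{ji};\theta)^\top$. Put $C_k(\delta,\theta)=\delta^{-1}I+B_k(\theta)K_k(\theta)B_k(\theta)^\top$ and let $$\mathcal L_k(\gamma,\delta,\theta)=\tfrac{N_k}{2}\log 2\pi+\tfrac12\log\det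 C_k(\delta,\theta)+\tfrac12(z-X\gamma)^\top C_k(\delta,\theta)^{-1}(z-X\gamma)$$ be the negative log-likelihood. The true values satisfy $\gamma^*\in\Gamma\subset\mathbb R^p$, $\delta^*\in\mathbb S\subset\mathbb R$, $\theta^*\in\Theta\subset\mathbb R^q$; $\Gamma,\mathbb S,\Theta$ and the true values do not depend on $k$. Let $(\hat\gamma_k,\hat\delta_k,\hat\theta_k)$ be maximum-likelihood estimators, i.e. almost surely a minimizer of $\mathcal L_k$ over $\Gamma\times\mathbb S\times\Theta$. **Assumptions.** 1. $\Gamma,\Theta,\mathbb S$ are compact, and $\mathbb S\subset[a,\infty)$ for some $a>0$. 2. For each $\theta\in\Theta$, $\|K_k(\theta)^{-1}\|_{\mathrm{op}}=O(1)$ as $k\to\infty$. $B_k$ and $K_k$ are three times differentiable on a neighbourhood of the convex hull of $\Theta$, and, as $k\to\infty$, they and all their partial derivatives of orders one, two and three are $O(1)$ in operator norm, uniformly for $\theta$ in the convex hull of $\Theta$ (which is $\Theta$ itself when $\Theta$ is convex). 3. The rows of $X$ are i.i.d. sub-Gaussian vectors whose law does not depend on $k$. 4. There is a constant $\lambda^*>0$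 such that, for all large $k$, $\lambda_{\min}(\mathcal J_k)>\lambda^*$, where $\mathcal J_k$ is the scaled expected Hessian of $\mathcal L_k$ at $(\gamma^*,\delta^*,\theta^*)$: $$\mathcal J_k=\begin{pmatrix}\frac1{N_k}\mathbb E\,\partial^2_{\gamma\gamma}\mathcal L_k&0&0\\0&\frac1{N_k}\mathbb E\,\partial^2_{\delta\delta}\mathcal L_k&\frac1{m_k}\mathbb E\,\partial^2_{\delta\theta}\mathcal L_k\\0&\frac1{m_k}\mathbb E\,\partial^2_{\theta\delta}\mathcal L_k&\frac1{m_k}\mathbb E\,\partial^2_{\theta\theta}\mathcal L_k\end{pmatrix}.$$ 5. For every $\xi>0$ there is $c>0$ such that, for all large $k$, $$\inf_{\theta\in\Theta:\ \|\theta-\theta^*\|>\xi}\ \frac1{m_k}\big\|B_k(\theta)K_k(\theta)B_k(\theta)^\top-B_k(\theta^*)K_k(\theta^*)B_k(\theta^*)^\top\big\|_F^2>c .$$ **Theorem (Consistency).** Under Assumptions 1–5, if $N_k\to\infty$, $m_k\to\infty$ and $m_k=o(N_k)$, then $\hat\gamma_k\to\gamma^*$, $\hat\delta_k\to\delta^*$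 and $\hat\theta_k\to\theta^*$ in probability. -/

import Mathlib

open MeasureTheory ProbabilityTheory Filter Topology
open scoped NNReal Matrix

noncomputable section

/-- Operator norm (largest singular value) of a real matrix, i.e. the norm of the induced map
between Euclidean spaces. -/
def opNorm {ι κ : Type*} [Fintype ι] [Fintype κ] [DecidableEq κ] (A : Matrix ι κ ℝ) : ℝ :=
  ‖LinearMap.toContinuousLinearMap (Matrix.toEuclideanLin A)‖

/-- Squared Frobenius norm. -/
def frobSq {ι κ : Type*} [Fintype ι] [Fintype κ] (A : Matrix ι κ ℝ) : ℝ :=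
  ∑ i, ∑ j, A i j ^ 2

/-- Partial derivative of a real function with respect to the coordinate `a`. -/
def partialDeriv {ι : Type*} [Fintype ι] [DecidableEq ι] (a : ι)
    (f : EuclideanSpace ℝ ι → ℝ) : EuclideanSpace ℝ ι → ℝ :=
  fun v => fderiv ℝ f v (EuclideanSpace.single a 1)

/-- Entrywise partial derivative of a matrix-valued function. -/
def matPartial {q : ℕ} {ι κ : Type*} (a : Fin q)
    (A : EuclideanSpace ℝ (Fin q) → Matrix ι κ ℝ) :
    EuclideanSpace ℝ (Fin q) → Matrix ι κ ℝ :=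
  fun θ => Matrix.of fun i j => partialDeriv a (fun t => A t i j) θ

/-- Every entry of `A` is three times differentiable at the points of `U` (used for open `U`). -/
def ThriceDifferentiableOn {q : ℕ} {ι κ : Type*}
    (A : EuclideanSpace ℝ (Fin q) → Matrix ι κ ℝ) (U : Set (EuclideanSpace ℝ (Fin q))) : Prop :=
  ∀ i j,
    DifferentiableOn ℝ (fun t => A t i j) U ∧
    (∀ a, DifferentiableOn ℝ (partialDeriv a fun t => A t i j) U) ∧
    ∀ a b, DifferentiableOn ℝ (partialDeriv a (partialDeriv b fun t => A t i j)) U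

/-- The known (nonrandom) ingredients of a low-rank spatial model: machines, local sample sizes,
locations, the rank, the vector of basis functions and the covariance matrix of its
coefficients. -/
structure LowRankDesign (q : ℕ) (Loc : Type*) where
  /-- number of machines -/
  J : ℕ
  /-- local sample sizes -/
  n : Fin J → ℕ
  /-- locations of the observations -/
  loc : (Σ j : Fin J, Fin (n j)) → Loc
  /-- rank (number of basis functions) -/
  m : ℕ
  /-- basis functions -/
  b : Loc → EuclideanSpace ℝ (Fin q) → Fin m → ℝ
  /-- covariance matrix of the basis coefficients -/
  K : EuclideanSpace ℝ (Fin q) → Matrix (Fin m) (Fin m) ℝ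

namespace LowRankDesign

variable {q : ℕ} {Loc : Type*} (D : LowRankDesign q Loc)

/-- Indices of the observations: pairs (machine, position in the machine). -/
abbrev Obs : Type := Σ j : Fin D.J, Fin (D.n j)

/-- Total sample size. -/
def N : ℕ := ∑ j, D.n j

/-- The stacked basis matrix `B(θ)`, whose rows are the vectors `b(s_{ji}; θ)ᵀ`. -/
def B (θ : EuclideanSpace ℝ (Fin q)) : Matrix D.Obs (Fin D.m) ℝ :=
  Matrix.of fun r => D.b (D.loc r) θ

/-- The low-rank covariance `B(θ) K(θ) B(θ)ᵀ`. -/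
def BKB (θ : EuclideanSpace ℝ (Fin q)) : Matrix D.Obs D.Obs ℝ :=
  D.B θ * D.K θ * (D.B θ)ᵀ

/-- The covariance matrix `δ⁻¹ I + B(θ) K(θ) B(θ)ᵀ` of the observations. -/
def C (δ : ℝ) (θ : EuclideanSpace ℝ (Fin q)) : Matrix D.Obs D.Obs ℝ :=
  δ⁻¹ • (1 : Matrix D.Obs D.Obs ℝ) + D.BKB θ

/-- The observations `z = X γ + B(θ) η + ε`. -/
def obs {p : ℕ} (γ : EuclideanSpace ℝ (Fin p)) (θ : EuclideanSpace ℝ (Fin q))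
    (X : Matrix D.Obs (Fin p) ℝ) (η : Fin D.m → ℝ) (ε : D.Obs → ℝ) : D.Obs → ℝ :=
  X *ᵥ (fun a => γ a) + D.B θ *ᵥ η + ε

/-- The negative log-likelihood, with `δ` the inverse nugget variance. -/
def negLogLik {p : ℕ} (X : Matrix D.Obs (Fin p) ℝ) (z : D.Obs → ℝ)
    (γ : EuclideanSpace ℝ (Fin p)) (δ : ℝ) (θ : EuclideanSpace ℝ (Fin q)) : ℝ :=
  (D.N : ℝ) / 2 * Real.log (2 * Real.pi) + 1 / 2 * Real.log (D.C δ θ).det +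
    1 / 2 * ((z - X *ᵥ (fun a => γ a)) ⬝ᵥ ((D.C δ θ)⁻¹ *ᵥ (z - X *ᵥ (fun a => γ a))))

/-- `(γ, δ, θ)` is a maximum-likelihood estimate over `Γ × S × Θ` for the data `(X, z)`. -/
def IsMLE {p : ℕ} (Γ : Set (EuclideanSpace ℝ (Fin p))) (S : Set ℝ)
    (Θ : Set (EuclideanSpace ℝ (Fin q))) (X : Matrix D.Obs (Fin p) ℝ) (z : D.Obs → ℝ)
    (γ : EuclideanSpace ℝ (Fin p)) (δ : ℝ) (θ : EuclideanSpace ℝ (Fin q)) : Prop :=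
  γ ∈ Γ ∧ δ ∈ S ∧ θ ∈ Θ ∧ ∀ γ' ∈ Γ, ∀ δ' ∈ S, ∀ θ' ∈ Θ,
    D.negLogLik X z γ δ θ ≤ D.negLogLik X z γ' δ' θ'

/-- Coordinates of the joint parameter `(γ, δ, θ)`. -/
abbrev ParamIdx (p q : ℕ) : Type := Fin p ⊕ (Unit ⊕ Fin q)

/-- The joint parameter vector `(γ, δ, θ)`. -/
def param {p : ℕ} (γ : EuclideanSpace ℝ (Fin p)) (δ : ℝ) (θ : EuclideanSpace ℝ (Fin q)) :
    EuclideanSpace ℝ (ParamIdx p q) :=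
  WithLp.toLp 2 (Sum.elim (fun a => γ a) (Sum.elim (fun _ => δ) (fun a => θ a)))

/-- The negative log-likelihood as a function of the joint parameter vector. -/
def negLogLikVec {p : ℕ} (X : Matrix D.Obs (Fin p) ℝ) (z : D.Obs → ℝ)
    (v : EuclideanSpace ℝ (ParamIdx p q)) : ℝ :=
  D.negLogLik X z (WithLp.toLp 2 fun a => v (Sum.inl a)) (v (Sum.inr (Sum.inl ())))
    (WithLp.toLp 2 fun a => v (Sum.inr (Sum.inr a)))

/-- Expected second partial derivative of the negative log-likelihood at `(γ, δ, θ)`. -/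
def expHess {p : ℕ} {Ω : Type*} [MeasurableSpace Ω] (P : Measure Ω)
    (X : Ω → Matrix D.Obs (Fin p) ℝ) (z : Ω → D.Obs → ℝ)
    (γ : EuclideanSpace ℝ (Fin p)) (δ : ℝ) (θ : EuclideanSpace ℝ (Fin q))
    (a b : ParamIdx p q) : ℝ :=
  ∫ ω, partialDeriv a (partialDeriv b (D.negLogLikVec (X ω) (z ω))) (param γ δ θ) ∂P

/-- The scaled expected Hessian: the `γγ` and `δδ` blocks are divided by `N`, the `δθ`, `θδ` and
`θθ` blocks by `m`, and the `γδ`, `γθ`, `δγ`, `θγ` blocks are zero. -/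
def scaledHess {p : ℕ} {Ω : Type*} [MeasurableSpace Ω] (P : Measure Ω)
    (X : Ω → Matrix D.Obs (Fin p) ℝ) (z : Ω → D.Obs → ℝ)
    (γ : EuclideanSpace ℝ (Fin p)) (δ : ℝ) (θ : EuclideanSpace ℝ (Fin q)) :
    Matrix (ParamIdx p q) (ParamIdx p q) ℝ :=
  let H := D.expHess P X z γ δ θ
  Matrix.fromBlocks
    (Matrix.of fun a b => 1 / (D.N : ℝ) * H (Sum.inl a) (Sum.inl b)) 0 0
    (Matrix.fromBlocks
      (Matrix.of fun _ _ => 1 / (D.N : ℝ) * H (Sum.inr (Sum.inl ())) (Sum.inr (Sum.inl ())))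
      (Matrix.of fun _ b => 1 / (D.m : ℝ) * H (Sum.inr (Sum.inl ())) (Sum.inr (Sum.inr b)))
      (Matrix.of fun a _ => 1 / (D.m : ℝ) * H (Sum.inr (Sum.inr a)) (Sum.inr (Sum.inl ())))
      (Matrix.of fun a b => 1 / (D.m : ℝ) * H (Sum.inr (Sum.inr a)) (Sum.inr (Sum.inr b))))

/-- The random ingredients of the model: the rows `x r` of the covariate matrix are i.i.d. with law
`ν`, `η ~ N(0, K(θ))`, the entries of `ε` are i.i.d. `N(0, δ⁻¹)`, and the covariates, `η` and `ε`
are independent. -/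
structure IsModel {p : ℕ} {Ω : Type*} [MeasurableSpace Ω] (P : Measure Ω)
    (ν : Measure (EuclideanSpace ℝ (Fin p))) (δ : ℝ) (θ : EuclideanSpace ℝ (Fin q))
    (x : D.Obs → Ω → EuclideanSpace ℝ (Fin p)) (η : Ω → EuclideanSpace ℝ (Fin D.m))
    (ε : D.Obs → Ω → ℝ) : Prop where
  law_x : ∀ r, HasLaw (x r) ν P
  indep_x : iIndepFun x P
  law_η : HasLaw η (multivariateGaussian 0 (D.K θ)) P
  law_ε : ∀ r, HasLaw (ε r) (gaussianReal 0 (Real.toNNReal δ⁻¹)) P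
  indep_ε : iIndepFun ε P
  indep_η_ε : IndepFun η (fun ω r => ε r ω) P
  indep_x_ηε : IndepFun (fun ω r => x r ω) (fun ω => (η ω, fun r => ε r ω)) P

end LowRankDesign

/-- A probability law on `ℝᵖ` is sub-Gaussian: all one-dimensional projections, centred, are
sub-Gaussian with variance proxy at most a constant times the squared length of the direction. -/
def IsSubGaussianLaw {p : ℕ} (ν : Measure (EuclideanSpace ℝ (Fin p))) : Prop :=
  ∃ σ : ℝ≥0, ∀ v : EuclideanSpace ℝ (Fin p),
    HasSubgaussianMGF (fun y => inner ℝ v (y - ∫ y', y' ∂ν)) (σ ^ 2 * ‖v‖₊ ^ 2) ν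

/-- A sequence of matrix functions is `O(1)` in operator norm, uniformly on `T`. -/
def UniformlyOpBounded {q : ℕ} {ι κ : ℕ → Type*} [∀ k, Fintype (ι k)] [∀ k, Fintype (κ k)]
    [∀ k, DecidableEq (κ k)] (T : Set (EuclideanSpace ℝ (Fin q)))
    (A : ∀ k, EuclideanSpace ℝ (Fin q) → Matrix (ι k) (κ k) ℝ) : Prop :=
  ∃ M : ℝ, ∀ᶠ k in atTop, ∀ θ ∈ T, opNorm (A k θ) ≤ M

/-- Each matrix function in the sequence is three times differentiable on a neighbourhood of the
set `T`, and the functions and all their partial derivatives up to order three are `O(1)` in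
operator norm, uniformly on `T`. -/
def SmoothBounded {q : ℕ} {ι κ : ℕ → Type*} [∀ k, Fintype (ι k)] [∀ k, Fintype (κ k)]
    [∀ k, DecidableEq (κ k)] (T : Set (EuclideanSpace ℝ (Fin q)))
    (A : ∀ k, EuclideanSpace ℝ (Fin q) → Matrix (ι k) (κ k) ℝ) : Prop :=
  (∀ k, ∃ U, IsOpen U ∧ T ⊆ U ∧ ThriceDifferentiableOn (A k) U) ∧
  UniformlyOpBounded T A ∧
  (∀ a, UniformlyOpBounded T fun k => matPartial a (A k)) ∧
  (∀ a b, UniformlyOpBounded T fun k => matPartial a (matPartial b (A k))) ∧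
  ∀ a b c, UniformlyOpBounded T fun k => matPartial a (matPartial b (matPartial c (A k)))

end

/-! Write C(δ,θ) = δ⁻¹I + BKBᵀ, e = B(θ₀)η + ε ~ N(0, C(δ₀,θ₀)) and u = γ̂ - γ₀, so that the
residual at γ̂ is r = e - Xu. A Woodbury identity (`lowRankCov_inv`) gives C⁻¹ = δI - BFBᵀ, where
the m×m matrix F is bounded and Lipschitz in (δ,θ) with constants free of the dimensions. Hence the
data enter the likelihood through |r|², a quantity of order N, and through the m-vectors B(θ)ᵀr,
whose contribution is of order m. These two scales are separated by comparing the minimizer with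
three competitors, each of which restores one true coordinate and keeps the others at their
estimates.

Restoring γ₀: the log-determinants cancel, and the quadratic forms bound |Xu|² by the score XᵀC⁻¹e
paired with u. The score is o(√(mN)) uniformly in (δ,θ), and the Gram matrix XᵀX is at least a
multiple of N, because the γγ block of the expected Hessian bounds the second moments of the
covariates from below (`LowRankDesign.secondMoment_ge`). So |u| = o(√(m/N)) and |Xu| = o(√m): the
fitted mean disturbs even the quantities of order m negligibly.

Restoring δ₀: log det C = -N log δ + O(m), the quadratic form is δ|r|² + O(m), and |r|² = N/δ₀ +
o(N). Optimality forces τ - 1 - log τ = o(1) for τ = δ̂/δ₀, hence τ → 1.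

Restoring θ₀: with the same δ̂ on both sides the terms δ̂|r|² cancel and only quantities of order m
remain. A uniform law of large numbers (`eventually_whp_quadForm`) replaces the quadratic forms in
B(θ)ᵀe by traces up to o(m). The comparison then says that the Kullback–Leibler divergence between
the centred Gaussian laws with covariances C(δ̂,θ₀) and C(δ̂,θ̂) is o(m). This divergence dominates
the squared Frobenius distance (`frobSq_sub_le_kl`), in which the nuggets cancel, so identifiability
gives θ̂ → θ₀.

The delicate point is uniformity in θ. The crude bound ‖B(s) - B(t)‖·|e| is of order √N, too large
on the scale √m. But B(s)ᵀe - B(t)ᵀe is Gaussian in m dimensions with covariance of norm O(|s-t|²),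
so all its moments have the scale |s-t|√m, and chaining (`exists_chaining`) gives a modulus of
continuity at that scale. Chebyshev at each point of a finite net and this modulus yield the uniform
laws (`eventually_whp_forall_le`). Statements of high probability are phrased with the filter `whp`,
defined by outer measure, so no measurability of the estimators is needed. -/

noncomputable section

set_option linter.unusedSectionVars false


/-! ### Operator and Frobenius norms, and the Gaussian divergence bound -/

section MatrixBounds

open scoped Matrix.Norms.L2Operator

variable {ι κ τ : Type*} [Fintype ι] [Fintype κ] [Fintype τ]
  [DecidableEq ι] [DecidableEq κ] [DecidableEq τ]

/-- Euclidean norm of a plain vector. -/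
def vnorm {ι : Type*} [Fintype ι] (v : ι → ℝ) : ℝ := ‖(WithLp.toLp 2 v : EuclideanSpace ℝ ι)‖

lemma opNorm_eq (A : Matrix ι κ ℝ) : opNorm A = ‖A‖ := (Matrix.l2_opNorm_def A).symm

lemma vnorm_nonneg (v : ι → ℝ) : 0 ≤ vnorm v := norm_nonneg _

lemma vnorm_sq (v : ι → ℝ) : vnorm v ^ 2 = v ⬝ᵥ v := by
  rw [vnorm, EuclideanSpace.real_norm_sq_eq]
  simp [dotProduct, sq]

lemma vnorm_add_le (u v : ι → ℝ) : vnorm (u + v) ≤ vnorm u + vnorm v := norm_add_le _ _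

lemma vnorm_sub_le (u v : ι → ℝ) : vnorm (u - v) ≤ vnorm u + vnorm v := norm_sub_le _ _

lemma abs_dotProduct_le (u v : ι → ℝ) : |u ⬝ᵥ v| ≤ vnorm u * vnorm v := by
  have h := abs_real_inner_le_norm (WithLp.toLp 2 v : EuclideanSpace ℝ ι) (WithLp.toLp 2 u)
  rw [EuclideanSpace.inner_toLp_toLp] at h
  simpa [vnorm, mul_comm] using h

lemma vnorm_mulVec_le (A : Matrix ι κ ℝ) (v : κ → ℝ) : vnorm (A *ᵥ v) ≤ ‖A‖ * vnorm v :=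
  Matrix.l2_opNorm_mulVec A (WithLp.toLp 2 v)

lemma abs_dotProduct_mulVec_le (A : Matrix ι κ ℝ) (u : ι → ℝ) (v : κ → ℝ) :
    |u ⬝ᵥ A *ᵥ v| ≤ ‖A‖ * vnorm u * vnorm v :=
  (abs_dotProduct_le _ _).trans (by
    have := mul_le_mul_of_nonneg_left (vnorm_mulVec_le A v) (vnorm_nonneg u)
    linarith)

lemma norm_transpose (A : Matrix ι κ ℝ) : ‖Aᵀ‖ = ‖A‖ := by
  rw [← Matrix.conjTranspose_eq_transpose_of_trivial]; exact Matrix.l2_opNorm_conjTranspose A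

lemma vnorm_single (i : ι) : vnorm (Pi.single i (1 : ℝ)) = 1 := by
  have := vnorm_sq (Pi.single i (1 : ℝ))
  simp at this
  rcases this with h | h
  · exact h
  · linarith [vnorm_nonneg (Pi.single i (1 : ℝ) : ι → ℝ)]

lemma abs_entry_le (A : Matrix ι κ ℝ) (i : ι) (j : κ) : |A i j| ≤ ‖A‖ := by
  have := abs_dotProduct_mulVec_le A (Pi.single i 1) (Pi.single j 1)
  simpa [vnorm_single] using this

/-- Traces of N×N products are first cycled into traces of m×m matrices; this bound then costs a
factor m instead of N. -/
lemma abs_trace_le (A : Matrix ι ι ℝ) : |A.trace| ≤ Fintype.card ι * ‖A‖ := by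
  calc |A.trace| ≤ ∑ i, |A i i| := Finset.abs_sum_le_sum_abs _ _
    _ ≤ ∑ _i : ι, ‖A‖ := Finset.sum_le_sum fun i _ => abs_entry_le A i i
    _ = _ := by simp

/-- If every bilinear form value is controlled, so is the operator norm. -/
lemma norm_le_of_bilin (A : Matrix ι κ ℝ) {M : ℝ} (hM : 0 ≤ M)
    (h : ∀ u v, |u ⬝ᵥ A *ᵥ v| ≤ M * vnorm u * vnorm v) : ‖A‖ ≤ M := by
  rw [Matrix.l2_opNorm_def]
  refine ContinuousLinearMap.opNorm_le_bound _ hM fun v => ?_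
  change vnorm (A *ᵥ v.ofLp) ≤ M * vnorm v.ofLp
  -- Testing the form at `u = A v` turns its value into the squared length of `A v`.
  set w := A *ᵥ v.ofLp
  have h1 := h w v.ofLp
  change |w ⬝ᵥ w| ≤ _ at h1
  rw [← vnorm_sq, abs_of_nonneg (sq_nonneg _)] at h1
  by_cases hw : vnorm w = 0
  · rw [hw]; exact mul_nonneg hM (vnorm_nonneg _)
  · have : 0 < vnorm w := lt_of_le_of_ne (vnorm_nonneg _) (Ne.symm hw)
    nlinarith

lemma dotProduct_mulVec_self_nonneg {A : Matrix ι ι ℝ} (hA : A.PosSemidef) (v : ι → ℝ) :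
    0 ≤ v ⬝ᵥ A *ᵥ v := by simpa using hA.dotProduct_mulVec_nonneg v

lemma norm_mul3_le (A : Matrix ι κ ℝ) (B : Matrix κ τ ℝ) {σ : Type*} [Fintype σ] [DecidableEq σ]
    (C : Matrix τ σ ℝ) : ‖A * B * C‖ ≤ ‖A‖ * ‖B‖ * ‖C‖ :=
  (Matrix.l2_opNorm_mul _ _).trans
    (mul_le_mul_of_nonneg_right (Matrix.l2_opNorm_mul _ _) (norm_nonneg _))

/-! ### Frobenius norm -/

lemma frobSq_eq_trace (A : Matrix ι κ ℝ) : frobSq A = (Aᵀ * A).trace := by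
  simp only [frobSq, Matrix.trace, Matrix.diag, Matrix.mul_apply, Matrix.transpose_apply]
  rw [Finset.sum_comm]
  simp [sq]

lemma frobSq_transpose (A : Matrix ι κ ℝ) : frobSq Aᵀ = frobSq A := by
  simp only [frobSq, Matrix.transpose_apply]
  rw [Finset.sum_comm]

/-- The squared Frobenius norm is the sum of the squared lengths of the columns, and left
multiplication acts column by column. -/
lemma frobSq_mul_le (A : Matrix ι κ ℝ) (B : Matrix κ τ ℝ) :
    frobSq (A * B) ≤ ‖A‖ ^ 2 * frobSq B := by
  have key (C : Matrix ι τ ℝ) : frobSq C = ∑ j, vnorm (fun i => C i j) ^ 2 := by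
    simp only [vnorm_sq, dotProduct, frobSq]
    rw [Finset.sum_comm]; simp [sq]
  have key' (C : Matrix κ τ ℝ) : frobSq C = ∑ j, vnorm (fun i => C i j) ^ 2 := by
    simp only [vnorm_sq, dotProduct, frobSq]
    rw [Finset.sum_comm]; simp [sq]
  rw [key, key', Finset.mul_sum]
  refine Finset.sum_le_sum fun j _ => ?_
  rw [← mul_pow]
  exact pow_le_pow_left₀ (vnorm_nonneg _) (vnorm_mulVec_le A fun i => B i j) 2

lemma frobSq_mul_le' (A : Matrix ι κ ℝ) (B : Matrix κ τ ℝ) :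
    frobSq (A * B) ≤ frobSq A * ‖B‖ ^ 2 := by
  rw [← frobSq_transpose, Matrix.transpose_mul]
  refine (frobSq_mul_le _ _).trans ?_
  rw [frobSq_transpose, norm_transpose, mul_comm]

/-! ### Spectral inequalities -/

lemma eigenvalues_le_norm {A : Matrix ι ι ℝ} (hA : A.IsHermitian) (i : ι) :
    |hA.eigenvalues i| ≤ ‖A‖ := by
  rw [hA.eigenvalues_eq]
  have h1 : vnorm (hA.eigenvectorBasis i).ofLp = 1 := hA.eigenvectorBasis.orthonormal.1 i
  have := abs_dotProduct_mulVec_le A (hA.eigenvectorBasis i).ofLp (hA.eigenvectorBasis i).ofLp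
  simpa [h1] using this

/-- Diagonalizing, A - 1 = U diag(λᵢ - 1) U*, and the trace of its square does not see the
orthogonal matrix U. -/
lemma frobSq_sub_one {A : Matrix ι ι ℝ} (hA : A.IsHermitian) :
    frobSq (A - 1) = ∑ i, (hA.eigenvalues i - 1) ^ 2 := by
  set U : Matrix ι ι ℝ := (hA.eigenvectorUnitary : Matrix ι ι ℝ) with hU
  have h1 : star U * U = 1 := by simp [hU]
  have h1' : U * star U = 1 := by simp [hU]
  have h2 : A = U * Matrix.diagonal hA.eigenvalues * star U := by
    conv_lhs => rw [hA.spectral_theorem, Unitary.conjStarAlgAut_apply]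
    rfl
  have h3 : A - 1 = U * Matrix.diagonal (fun i => hA.eigenvalues i - 1) * star U := by
    have : Matrix.diagonal (fun i => hA.eigenvalues i - 1) =
      Matrix.diagonal hA.eigenvalues - 1 := by
      rw [← Matrix.diagonal_one, Matrix.diagonal_sub]
    rw [this, mul_sub, sub_mul, ← h2, mul_one, h1']
  have h4 : (A - 1)ᵀ = A - 1 := by
    have : (A - 1).IsHermitian := hA.sub Matrix.isHermitian_one
    simpa [Matrix.IsHermitian, Matrix.conjTranspose_eq_transpose_of_trivial] using this
  rw [frobSq_eq_trace, h4, h3]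
  have : U * Matrix.diagonal (fun i => hA.eigenvalues i - 1) * star U *
      (U * Matrix.diagonal (fun i => hA.eigenvalues i - 1) * star U) =
      U * (Matrix.diagonal (fun i => hA.eigenvalues i - 1) *
        Matrix.diagonal (fun i => hA.eigenvalues i - 1)) * star U := by
    calc _ = U * Matrix.diagonal (fun i => hA.eigenvalues i - 1) * (star U * U) *
        Matrix.diagonal (fun i => hA.eigenvalues i - 1) * star U := by simp only [mul_assoc]
      _ = _ := by rw [h1]; simp only [mul_one, mul_assoc]
  rw [this, Matrix.trace_mul_comm, ← mul_assoc, h1, one_mul, Matrix.diagonal_mul_diagonal,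
    Matrix.trace_diagonal]
  simp [sq]

lemma trace_eq_sum_eig {A : Matrix ι ι ℝ} (hA : A.IsHermitian) :
    A.trace = ∑ i, hA.eigenvalues i := by simpa using hA.trace_eq_sum_eigenvalues

lemma log_det_eq {A : Matrix ι ι ℝ} (hA : A.PosDef) :
    Real.log A.det = ∑ i, Real.log (hA.1.eigenvalues i) := by
  rw [hA.1.det_eq_prod_eigenvalues]
  simp only [RCLike.ofReal_real_eq_id, id]
  exact Real.log_prod fun i _ => (hA.eigenvalues_pos i).ne'

/-- The inequality log x ≤ x - 1, summed over the eigenvalues. -/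
lemma log_det_le_trace {A : Matrix ι ι ℝ} (hA : A.PosDef) :
    Real.log A.det ≤ A.trace - Fintype.card ι := by
  rw [log_det_eq hA, trace_eq_sum_eig hA.1]
  calc _ ≤ ∑ i, (hA.1.eigenvalues i - 1) :=
        Finset.sum_le_sum fun i _ => Real.log_le_sub_one_of_pos (hA.eigenvalues_pos i)
    _ = _ := by simp [Finset.sum_sub_distrib]

/-- Factor x - 1 = (√x - 1)(√x + 1). From log √x ≤ √x - 1 one gets (√x - 1)² ≤ x - 1 - log x, and
the other factor is at most 1 + √L. It is used for eigenvalues and again for the ratio of nugget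
parameters. -/
lemma sq_sub_one_le {x L : ℝ} (hx : 0 < x) (hL : x ≤ L) :
    (x - 1) ^ 2 ≤ (1 + √L) ^ 2 * (x - 1 - Real.log x) := by
  have hs : 0 < √x := Real.sqrt_pos.2 hx
  have h1 : Real.log x = 2 * Real.log √x := by rw [Real.log_sqrt hx.le]; ring
  have h2 := Real.log_le_sub_one_of_pos hs
  have h3 : √x ^ 2 = x := Real.sq_sqrt hx.le
  have h4 : (√x - 1) ^ 2 ≤ x - 1 - Real.log x := by nlinarith
  have h5 : √x ≤ √L := Real.sqrt_le_sqrt hL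
  calc (x - 1) ^ 2 = (1 + √x) ^ 2 * (√x - 1) ^ 2 := by
        rw [← mul_pow, ← h3, Real.sqrt_sq hs.le]; ring
    _ ≤ (1 + √L) ^ 2 * (x - 1 - Real.log x) := by gcongr

/-- The bracket on the right is twice the Kullback–Leibler divergence of N(0, A) from the standard
Gaussian, a sum of λ - 1 - log λ over the eigenvalues, so the scalar inequality applies term by
term. -/
lemma frobSq_sub_one_le {A : Matrix ι ι ℝ} (hA : A.PosDef) {L : ℝ} (hL : ‖A‖ ≤ L) :
    frobSq (A - 1) ≤ (1 + √L) ^ 2 * (A.trace - Fintype.card ι - Real.log A.det) := by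
  rw [frobSq_sub_one hA.1, log_det_eq hA, trace_eq_sum_eig hA.1]
  have : ∑ i, hA.1.eigenvalues i - Fintype.card ι - ∑ i, Real.log (hA.1.eigenvalues i) =
      ∑ i, (hA.1.eigenvalues i - 1 - Real.log (hA.1.eigenvalues i)) := by
    simp [Finset.sum_sub_distrib]
  rw [this, Finset.mul_sum]
  exact Finset.sum_le_sum fun i _ => sq_sub_one_le (hA.eigenvalues_pos i)
    ((le_abs_self _).trans ((eigenvalues_le_norm hA.1 i).trans hL))

/-- A positive semidefinite matrix has a symmetric square root. -/
lemma exists_sqrt {A : Matrix ι ι ℝ} (hA : A.PosSemidef) :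
    ∃ R : Matrix ι ι ℝ, Rᵀ = R ∧ R * R = A ∧ ‖R‖ ^ 2 = ‖A‖ := by
  open scoped MatrixOrder in
  have h1 : CFC.sqrt A * CFC.sqrt A = A := CFC.sqrt_mul_sqrt_self _ hA.nonneg
  have h2 : (CFC.sqrt A)ᵀ = CFC.sqrt A := by
    have : IsSelfAdjoint (CFC.sqrt A) := (CFC.sqrt_nonneg A).isSelfAdjoint
    rw [IsSelfAdjoint, Matrix.star_eq_conjTranspose,
      Matrix.conjTranspose_eq_transpose_of_trivial] at this
    exact this
  refine ⟨CFC.sqrt A, h2, h1, ?_⟩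
  have := Matrix.l2_opNorm_conjTranspose_mul_self (CFC.sqrt A)
  rw [Matrix.conjTranspose_eq_transpose_of_trivial, h2, h1] at this
  rw [this, sq]

lemma isUnit_of_mul_self_eq {A R : Matrix ι ι ℝ} (hA : A.PosDef) (h : R * R = A) : IsUnit R := by
  have := hA.isUnit
  rw [← h] at this
  exact isUnit_of_mul_isUnit_left this

/-- The last bracket is twice the divergence of N(0, A') from N(0, A). Whitening by R = A^{1/2}
reduces to the case A = 1 for P = R⁻¹A'R⁻¹, whose norm is at most bL. Returning through A' - A = R(P
- 1)R costs ‖R‖⁴ = ‖A‖² ≤ L². -/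
lemma frobSq_sub_le_kl {A A' : Matrix ι ι ℝ} (hA : A.PosDef) (hA' : A'.PosDef) {L b : ℝ}
    (hb : ‖A⁻¹‖ ≤ b) (hL : ‖A‖ ≤ L) (hL' : ‖A'‖ ≤ L) :
    frobSq (A' - A) ≤ L ^ 2 * (1 + √(b * L)) ^ 2 *
      (Real.log A.det - Real.log A'.det + (A⁻¹ * A').trace - Fintype.card ι) := by
  obtain ⟨R, hRt, hRR, hRn⟩ := exists_sqrt hA.posSemidef
  have hRu := isUnit_of_mul_self_eq hA hRR
  have hRd : IsUnit R.det := (Matrix.isUnit_iff_isUnit_det R).1 hRu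
  have hit : (R⁻¹)ᵀ = R⁻¹ := by rw [Matrix.transpose_nonsing_inv, hRt]
  have hiu : IsUnit R⁻¹ := (Matrix.isUnit_nonsing_inv_iff).2 hRu
  have hinv : A⁻¹ = R⁻¹ * R⁻¹ := by rw [← hRR, Matrix.mul_inv_rev]
  set P := R⁻¹ * A' * R⁻¹ with hPdef
  have hP : P.PosDef := by
    have := (Matrix.IsUnit.posDef_star_left_conjugate_iff (x := A') hiu).2 hA'
    rwa [Matrix.star_eq_conjTranspose, Matrix.conjTranspose_eq_transpose_of_trivial, hit] at this
  have hin : ‖R⁻¹‖ ^ 2 = ‖A⁻¹‖ := by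
    have := Matrix.l2_opNorm_conjTranspose_mul_self R⁻¹
    rw [Matrix.conjTranspose_eq_transpose_of_trivial, hit, ← hinv] at this
    rw [this, sq]
  have hPn : ‖P‖ ≤ b * L := by
    refine (norm_mul3_le _ _ _).trans ?_
    have : ‖R⁻¹‖ * ‖A'‖ * ‖R⁻¹‖ = ‖A⁻¹‖ * ‖A'‖ := by rw [← hin]; ring
    rw [this]
    exact mul_le_mul hb hL' (norm_nonneg _) ((norm_nonneg _).trans hb)
  have h1 := frobSq_sub_one_le hP hPn
  have htr : P.trace = (A⁻¹ * A').trace := by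
    rw [hPdef, Matrix.trace_mul_comm, ← mul_assoc, hinv]
  have hdet : Real.log P.det = Real.log A'.det - Real.log A.det := by
    have hd : A.det = R.det * R.det := by rw [← hRR, Matrix.det_mul]
    rw [hPdef, Matrix.det_mul, Matrix.det_mul, Matrix.det_nonsing_inv,
      ← Real.log_div hA'.det_pos.ne' hA.det_pos.ne', hd]
    congr 1
    have := hRd.ne_zero
    rw [Ring.inverse_eq_inv']
    field_simp
  have hdiff : A' - A = R * (P - 1) * R := by
    rw [mul_sub, sub_mul, mul_one, hRR, hPdef]
    congr 1
    calc A' = (R * R⁻¹) * A' * (R⁻¹ * R) := by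
          rw [Matrix.mul_nonsing_inv _ hRd, Matrix.nonsing_inv_mul _ hRd]; simp
      _ = _ := by simp only [mul_assoc]
  rw [hdiff]
  have hnn : 0 ≤ frobSq (P - 1) := by unfold frobSq; positivity
  calc frobSq (R * (P - 1) * R) ≤ frobSq (R * (P - 1)) * ‖R‖ ^ 2 := frobSq_mul_le' _ _
    _ ≤ ‖R‖ ^ 2 * frobSq (P - 1) * ‖R‖ ^ 2 := by
        gcongr; exact frobSq_mul_le _ _
    _ = ‖A‖ ^ 2 * frobSq (P - 1) := by rw [hRn]; ring
    _ ≤ L ^ 2 * ((1 + √(b * L)) ^ 2 * (P.trace - Fintype.card ι - Real.log P.det)) := by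
        gcongr
    _ = _ := by rw [htr, hdet]; ring

/-- Lower bound for the quadratic form of an inverse. -/
lemma vnorm_sq_le_inv {A : Matrix ι ι ℝ} (hA : A.PosDef) (v : ι → ℝ) :
    vnorm v ^ 2 ≤ ‖A‖ * (v ⬝ᵥ A⁻¹ *ᵥ v) := by
  obtain ⟨R, hRt, hRR, hRn⟩ := exists_sqrt hA.posSemidef
  have hRu := isUnit_of_mul_self_eq hA hRR
  have hRd : IsUnit R.det := (Matrix.isUnit_iff_isUnit_det R).1 hRu
  have hit : (R⁻¹)ᵀ = R⁻¹ := by rw [Matrix.transpose_nonsing_inv, hRt]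
  have hinv : A⁻¹ = R⁻¹ * R⁻¹ := by rw [← hRR, Matrix.mul_inv_rev]
  have h1 : v ⬝ᵥ A⁻¹ *ᵥ v = vnorm (R⁻¹ *ᵥ v) ^ 2 := by
    rw [vnorm_sq, hinv, ← Matrix.mulVec_mulVec, Matrix.dotProduct_mulVec, ← Matrix.mulVec_transpose,
      hit]
  have h2 : v = R *ᵥ (R⁻¹ *ᵥ v) := by
    rw [Matrix.mulVec_mulVec, Matrix.mul_nonsing_inv _ hRd, Matrix.one_mulVec]
  rw [h1, ← hRn, ← mul_pow]
  conv_lhs => rw [h2]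
  exact pow_le_pow_left₀ (vnorm_nonneg _) (vnorm_mulVec_le _ _) 2

end MatrixBounds

/-! ### The covariance δ⁻¹I + BKBᵀ: its inverse, dimension-free bounds, its determinant -/

section LowRank

open scoped Matrix.Norms.L2Operator

variable {ι κ τ : Type*} [Fintype ι] [Fintype κ] [Fintype τ]
  [DecidableEq ι] [DecidableEq κ] [DecidableEq τ]

/-- The covariance matrix `δ⁻¹ I + B K Bᵀ`. -/
def lowRankCov (B : Matrix ι κ ℝ) (K : Matrix κ κ ℝ) (δ : ℝ) : Matrix ι ι ℝ :=
  δ⁻¹ • (1 : Matrix ι ι ℝ) + B * K * Bᵀ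

/-- The matrix `F` with `(δ⁻¹ I + B K Bᵀ)⁻¹ = δ I - B F Bᵀ`. -/
def lowRankCore (B : Matrix ι κ ℝ) (K : Matrix κ κ ℝ) (δ : ℝ) : Matrix κ κ ℝ :=
  δ ^ 2 • (K - K * Bᵀ * (lowRankCov B K δ)⁻¹ * (B * K))

/-- A bound for the operator norm of `lowRankCore`. -/
def coreBound (b M : ℝ) : ℝ := b ^ 2 * (M + M ^ 2 * b * M ^ 2)

/-- A Lipschitz constant for the inverse of `lowRankCov`. -/
def invLip (a b M : ℝ) : ℝ := b * (a⁻¹ ^ 2 + 3 * M ^ 2) * b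

/-- A Lipschitz constant for `lowRankCore`. -/
def coreLip (a b M : ℝ) : ℝ :=
  2 * b * (M + M ^ 2 * b * M ^ 2) +
    b ^ 2 * (1 + ((2 * M * b + M ^ 2 * invLip a b M) * M ^ 2 + M ^ 2 * b * (2 * M)))

variable {B B' : Matrix ι κ ℝ} {K K' : Matrix κ κ ℝ} {δ δ' a b M d : ℝ}

lemma mul_mul_transpose_posSemidef (B : Matrix ι κ ℝ) (hK : K.PosSemidef) :
    (B * K * Bᵀ).PosSemidef := by
  simpa [Matrix.conjTranspose_eq_transpose_of_trivial] using hK.mul_mul_conjTranspose_same B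

lemma lowRankCov_posDef (B : Matrix ι κ ℝ) (hK : K.PosSemidef) (hδ : 0 < δ) :
    (lowRankCov B K δ).PosDef :=
  Matrix.PosDef.add_posSemidef (Matrix.PosDef.one.smul (inv_pos.2 hδ))
    (mul_mul_transpose_posSemidef B hK)

lemma transpose_eq_of_posSemidef (hK : K.PosSemidef) : Kᵀ = K := by
  have := hK.1
  rwa [Matrix.IsHermitian, Matrix.conjTranspose_eq_transpose_of_trivial] at this

lemma lowRankCov_inv_transpose (B : Matrix ι κ ℝ) (hK : K.PosSemidef) (hδ : 0 < δ) :
    ((lowRankCov B K δ)⁻¹)ᵀ = (lowRankCov B K δ)⁻¹ :=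
  transpose_eq_of_posSemidef (lowRankCov_posDef B hK hδ).inv.posSemidef

lemma lowRankCov_isUnit_det (B : Matrix ι κ ℝ) (hK : K.PosSemidef) (hδ : 0 < δ) :
    IsUnit (lowRankCov B K δ).det :=
  (Matrix.isUnit_iff_isUnit_det _).1 (lowRankCov_posDef B hK hδ).isUnit

/-- The covariance dominates δ⁻¹I: for w = C⁻¹v one has δ⁻¹|w|² ≤ w·Cw = w·v ≤ |w||v|. -/
lemma norm_lowRankCov_inv_le (B : Matrix ι κ ℝ) (hK : K.PosSemidef) (hδ : 0 < δ) :
    ‖(lowRankCov B K δ)⁻¹‖ ≤ δ := by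
  refine norm_le_of_bilin _ hδ.le fun u v => ?_
  set C := lowRankCov B K δ with hC
  set w := C⁻¹ *ᵥ v with hw
  have hv : v = C *ᵥ w := by
    rw [hw, Matrix.mulVec_mulVec, Matrix.mul_nonsing_inv _ (lowRankCov_isUnit_det B hK hδ),
      Matrix.one_mulVec]
  have h1 : δ⁻¹ * vnorm w ^ 2 ≤ w ⬝ᵥ v := by
    rw [vnorm_sq, hv, hC, lowRankCov, Matrix.add_mulVec, dotProduct_add, Matrix.smul_mulVec,
      Matrix.one_mulVec, dotProduct_smul, smul_eq_mul]
    linarith [dotProduct_mulVec_self_nonneg (mul_mul_transpose_posSemidef B hK) w]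
  have h2 : vnorm w ≤ δ * vnorm v := by
    have h3 := (le_abs_self _).trans (abs_dotProduct_le w v)
    by_cases h0 : vnorm w = 0
    · rw [h0]; exact mul_nonneg hδ.le (vnorm_nonneg _)
    · have hp : 0 < vnorm w := lt_of_le_of_ne (vnorm_nonneg _) (Ne.symm h0)
      have h4 : δ⁻¹ * vnorm w ≤ vnorm v := by
        have : (δ⁻¹ * vnorm w) * vnorm w ≤ vnorm v * vnorm w := by nlinarith
        exact le_of_mul_le_mul_right this hp
      rwa [inv_mul_le_iff₀ hδ] at h4
  calc |u ⬝ᵥ w| ≤ vnorm u * vnorm w := abs_dotProduct_le _ _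
    _ ≤ vnorm u * (δ * vnorm v) := by gcongr; exact vnorm_nonneg _
    _ = _ := by ring

lemma l2norm_mul_le_of_le {X : Matrix ι κ ℝ} {Y : Matrix κ τ ℝ} {x y : ℝ} (hX : ‖X‖ ≤ x)
    (hY : ‖Y‖ ≤ y) : ‖X * Y‖ ≤ x * y :=
  (Matrix.l2_opNorm_mul _ _).trans
    (mul_le_mul hX hY (norm_nonneg _) ((norm_nonneg _).trans hX))

/-- A product rule for differences: `dx` and `dy` act as Lipschitz constants and `d` as the distance
of the parameters, so that Lipschitz bounds pass through long matrix products. -/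
lemma norm_mul_sub_mul_le {X X' : Matrix ι κ ℝ} {Y Y' : Matrix κ τ ℝ} {x y dx dy : ℝ}
    (hX : ‖X‖ ≤ x) (hY : ‖Y'‖ ≤ y) (hdX : ‖X - X'‖ ≤ dx * d) (hdY : ‖Y - Y'‖ ≤ dy * d) :
    ‖X * Y - X' * Y'‖ ≤ (dx * y + x * dy) * d := by
  have : X * Y - X' * Y' = X * (Y - Y') + (X - X') * Y' := by
    rw [Matrix.mul_sub, Matrix.sub_mul]; abel
  rw [this]
  calc _ ≤ ‖X * (Y - Y')‖ + ‖(X - X') * Y'‖ := norm_add_le _ _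
    _ ≤ x * (dy * d) + (dx * d) * y :=
      add_le_add (l2norm_mul_le_of_le hX hdY) (l2norm_mul_le_of_le hdX hY)
    _ = _ := by ring

lemma norm_lowRank_le (hB : ‖B‖ ≤ M) (hK : ‖K‖ ≤ M) : ‖B * K * Bᵀ‖ ≤ M * M * M :=
  l2norm_mul_le_of_le (l2norm_mul_le_of_le hB hK) ((norm_transpose B).trans_le hB)

lemma norm_one_le : ‖(1 : Matrix ι ι ℝ)‖ ≤ 1 :=
  norm_le_of_bilin _ zero_le_one fun u v => by
    rw [Matrix.one_mulVec, one_mul]; exact abs_dotProduct_le _ _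

lemma norm_smul_one_le (c : ℝ) : ‖c • (1 : Matrix ι ι ℝ)‖ ≤ |c| := by
  rw [norm_smul, Real.norm_eq_abs]
  exact mul_le_of_le_one_right (abs_nonneg _) norm_one_le

lemma norm_lowRankCov_le (hB : ‖B‖ ≤ M) (hK : ‖K‖ ≤ M) (ha : 0 < a) (hδ : a ≤ δ) :
    ‖lowRankCov B K δ‖ ≤ a⁻¹ + M * M * M := by
  refine (norm_add_le _ _).trans (add_le_add ((norm_smul_one_le _).trans ?_)
    (norm_lowRank_le hB hK))
  rw [abs_of_pos (inv_pos.2 (ha.trans_le hδ))]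
  exact inv_anti₀ ha hδ

/-- With H = BKBᵀ = C - δ⁻¹I one computes H - HC⁻¹H = δ⁻¹I - δ⁻²C⁻¹ and multiplies by δ². In this
form of the Woodbury identity K is not inverted, and the core is bounded by means of ‖C⁻¹‖ ≤ δ. -/
lemma lowRankCov_inv (B : Matrix ι κ ℝ) (hK : K.PosSemidef) (hδ : 0 < δ) :
    (lowRankCov B K δ)⁻¹ = δ • (1 : Matrix ι ι ℝ) - B * lowRankCore B K δ * Bᵀ := by
  set C := lowRankCov B K δ with hC
  have hu := lowRankCov_isUnit_det B hK hδ
  rw [← hC] at hu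
  have hH : B * K * Bᵀ = C - δ⁻¹ • (1 : Matrix ι ι ℝ) := by
    rw [hC, lowRankCov]; abel
  have h1 : B * lowRankCore B K δ * Bᵀ =
      δ ^ 2 • (B * K * Bᵀ - (B * K * Bᵀ) * C⁻¹ * (B * K * Bᵀ)) := by
    rw [lowRankCore, ← hC, Matrix.mul_smul, Matrix.smul_mul, Matrix.mul_sub, Matrix.sub_mul]
    simp only [Matrix.mul_assoc]
  have h2 : (C - δ⁻¹ • (1 : Matrix ι ι ℝ)) * C⁻¹ * (C - δ⁻¹ • (1 : Matrix ι ι ℝ)) =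
      C - (2 * δ⁻¹) • (1 : Matrix ι ι ℝ) + δ⁻¹ ^ 2 • C⁻¹ := by
    rw [sub_mul, Matrix.mul_nonsing_inv _ hu, mul_sub, sub_mul, sub_mul]
    simp only [smul_mul_assoc, one_mul, mul_smul_comm, mul_one, Matrix.nonsing_inv_mul _ hu,
      smul_smul]
    rw [two_mul, add_smul, sq]
    abel
  rw [h1, hH, h2]
  have : C - δ⁻¹ • (1 : Matrix ι ι ℝ) - (C - (2 * δ⁻¹) • (1 : Matrix ι ι ℝ) + δ⁻¹ ^ 2 • C⁻¹) =
      δ⁻¹ • (1 : Matrix ι ι ℝ) - δ⁻¹ ^ 2 • C⁻¹ := by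
    rw [two_mul, add_smul]; abel
  rw [this, smul_sub, smul_smul, smul_smul]
  have e1 : δ ^ 2 * δ⁻¹ = δ := by field_simp
  have e2 : δ ^ 2 * δ⁻¹ ^ 2 = 1 := by field_simp
  rw [e1, e2, one_smul]; abel

lemma lowRankCore_transpose (B : Matrix ι κ ℝ) (hK : K.PosSemidef) (hδ : 0 < δ) :
    (lowRankCore B K δ)ᵀ = lowRankCore B K δ := by
  simp only [lowRankCore, Matrix.transpose_smul, Matrix.transpose_sub, Matrix.transpose_mul,
    Matrix.transpose_transpose, lowRankCov_inv_transpose B hK hδ, transpose_eq_of_posSemidef hK,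
    Matrix.mul_assoc]

lemma norm_lowRankCore_le (hK' : K.PosSemidef) (hB : ‖B‖ ≤ M) (hK : ‖K‖ ≤ M) (hδ : 0 < δ)
    (hb : δ ≤ b) : ‖lowRankCore B K δ‖ ≤ coreBound b M := by
  have hM : 0 ≤ M := (norm_nonneg _).trans hB
  rw [lowRankCore, norm_smul, Real.norm_eq_abs, abs_of_nonneg (sq_nonneg δ), coreBound]
  have h1 : ‖K * Bᵀ‖ ≤ M * M := l2norm_mul_le_of_le hK ((norm_transpose B).trans_le hB)
  have h2 : ‖K * Bᵀ * (lowRankCov B K δ)⁻¹ * (B * K)‖ ≤ M * M * b * (M * M) :=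
    l2norm_mul_le_of_le (l2norm_mul_le_of_le h1 ((norm_lowRankCov_inv_le B hK' hδ).trans hb))
      (l2norm_mul_le_of_le hB hK)
  have h3 : ‖K - K * Bᵀ * (lowRankCov B K δ)⁻¹ * (B * K)‖ ≤ M + M ^ 2 * b * M ^ 2 :=
    (norm_sub_le _ _).trans (by rw [sq]; exact add_le_add hK h2)
  exact mul_le_mul (pow_le_pow_left₀ hδ.le hb 2) h3 (norm_nonneg _) (sq_nonneg _)

/-- The resolvent identity C⁻¹ - C'⁻¹ = C⁻¹(C' - C)C'⁻¹. The constant 3M² comes from changing the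
three factors of BKBᵀ one at a time, and a⁻² from the Lipschitz bound for δ ↦ δ⁻¹ on [a, ∞). -/
lemma norm_lowRankCov_inv_sub_le (hKp : K.PosSemidef) (hKp' : K'.PosSemidef) (ha : 0 < a)
    (hδ : a ≤ δ) (hδb : δ ≤ b) (hδ' : a ≤ δ') (hδb' : δ' ≤ b)
    (hB : ‖B‖ ≤ M) (hK : ‖K‖ ≤ M) (hB' : ‖B'‖ ≤ M) (hK' : ‖K'‖ ≤ M)
    (hdB : ‖B - B'‖ ≤ d) (hdK : ‖K - K'‖ ≤ d) (hdδ : |δ - δ'| ≤ d) :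
    ‖(lowRankCov B K δ)⁻¹ - (lowRankCov B' K' δ')⁻¹‖ ≤ invLip a b M * d := by
  have hp := ha.trans_le hδ
  have hp' := ha.trans_le hδ'
  have hu := lowRankCov_isUnit_det B hKp hp
  have hu' := lowRankCov_isUnit_det B' hKp' hp'
  have h1 : (lowRankCov B K δ)⁻¹ - (lowRankCov B' K' δ')⁻¹ =
      (lowRankCov B K δ)⁻¹ * (lowRankCov B' K' δ' - lowRankCov B K δ) *
        (lowRankCov B' K' δ')⁻¹ := by
    rw [mul_sub, sub_mul, Matrix.nonsing_inv_mul _ hu, mul_assoc, Matrix.mul_nonsing_inv _ hu']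
    simp
  have h2 : ‖B * K - B' * K'‖ ≤ (1 * M + M * 1) * d :=
    norm_mul_sub_mul_le hB hK' (by simpa using hdB) (by simpa using hdK)
  have h3 : ‖B * K * Bᵀ - B' * K' * B'ᵀ‖ ≤ ((1 * M + M * 1) * M + M * M * 1) * d :=
    norm_mul_sub_mul_le (l2norm_mul_le_of_le hB hK) ((norm_transpose B').trans_le hB') h2
      (by rw [← Matrix.transpose_sub, norm_transpose]; simpa using hdB)
  have h4 : |δ⁻¹ - δ'⁻¹| ≤ a⁻¹ ^ 2 * d := by
    have : δ⁻¹ - δ'⁻¹ = -(δ⁻¹ * δ'⁻¹ * (δ - δ')) := by field_simp; ring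
    rw [this, abs_neg, abs_mul, abs_of_pos (by positivity)]
    have h5 := inv_anti₀ ha hδ
    have h6 := inv_anti₀ ha hδ'
    have : δ⁻¹ * δ'⁻¹ ≤ a⁻¹ ^ 2 := by
      rw [sq]; exact mul_le_mul h5 h6 (by positivity) (by positivity)
    exact mul_le_mul this hdδ (abs_nonneg _) (by positivity)
  have h5 : ‖lowRankCov B' K' δ' - lowRankCov B K δ‖ ≤ (a⁻¹ ^ 2 + 3 * M ^ 2) * d := by
    rw [norm_sub_rev]
    have : lowRankCov B K δ - lowRankCov B' K' δ' =
        (δ⁻¹ - δ'⁻¹) • (1 : Matrix ι ι ℝ) + (B * K * Bᵀ - B' * K' * B'ᵀ) := by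
      rw [lowRankCov, lowRankCov, sub_smul]; abel
    rw [this]
    refine (norm_add_le _ _).trans ?_
    have := (norm_smul_one_le (ι := ι) (δ⁻¹ - δ'⁻¹)).trans h4
    calc _ ≤ a⁻¹ ^ 2 * d + ((1 * M + M * 1) * M + M * M * 1) * d := add_le_add this h3
      _ = _ := by ring
  rw [h1]
  calc _ ≤ b * ((a⁻¹ ^ 2 + 3 * M ^ 2) * d) * b :=
        l2norm_mul_le_of_le (l2norm_mul_le_of_le ((norm_lowRankCov_inv_le B hKp hp).trans hδb) h5)
          ((norm_lowRankCov_inv_le B' hKp' hp').trans hδb')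
    _ = _ := by rw [invLip]; ring

/-- The factors of the core are changed one at a time. The resulting constant involves only a, b and
M, which makes the limit theorems below uniform along the sequence of models. -/
lemma norm_lowRankCore_sub_le (hKp : K.PosSemidef) (hKp' : K'.PosSemidef) (ha : 0 < a)
    (hδ : a ≤ δ) (hδb : δ ≤ b) (hδ' : a ≤ δ') (hδb' : δ' ≤ b)
    (hB : ‖B‖ ≤ M) (hK : ‖K‖ ≤ M) (hB' : ‖B'‖ ≤ M) (hK' : ‖K'‖ ≤ M)
    (hdB : ‖B - B'‖ ≤ d) (hdK : ‖K - K'‖ ≤ d) (hdδ : |δ - δ'| ≤ d) :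
    ‖lowRankCore B K δ - lowRankCore B' K' δ'‖ ≤ coreLip a b M * d := by
  have hp := ha.trans_le hδ
  have hp' := ha.trans_le hδ'
  have hM : 0 ≤ M := (norm_nonneg _).trans hB
  have hb : 0 < b := hp.trans_le hδb
  have hd : 0 ≤ d := (norm_nonneg _).trans hdB
  set C := (lowRankCov B K δ)⁻¹ with hC
  set C' := (lowRankCov B' K' δ')⁻¹ with hC'
  have hCC : ‖C - C'‖ ≤ invLip a b M * d :=
    norm_lowRankCov_inv_sub_le hKp hKp' ha hδ hδb hδ' hδb' hB hK hB' hK' hdB hdK hdδ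
  have hCn : ‖C‖ ≤ b := (norm_lowRankCov_inv_le B hKp hp).trans hδb
  have hCn' : ‖C'‖ ≤ b := (norm_lowRankCov_inv_le B' hKp' hp').trans hδb'
  have h1 : ‖K * Bᵀ - K' * B'ᵀ‖ ≤ (1 * M + M * 1) * d :=
    norm_mul_sub_mul_le hK ((norm_transpose B').trans_le hB') (by simpa using hdK)
      (by rw [← Matrix.transpose_sub, norm_transpose]; simpa using hdB)
  have h2 : ‖B * K - B' * K'‖ ≤ (1 * M + M * 1) * d :=
    norm_mul_sub_mul_le hB hK' (by simpa using hdB) (by simpa using hdK)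
  have n1 : ‖K * Bᵀ‖ ≤ M * M := l2norm_mul_le_of_le hK ((norm_transpose B).trans_le hB)
  have n1' : ‖K' * B'ᵀ‖ ≤ M * M := l2norm_mul_le_of_le hK' ((norm_transpose B').trans_le hB')
  have h3 : ‖K * Bᵀ * C - K' * B'ᵀ * C'‖ ≤ ((1 * M + M * 1) * b + M * M * invLip a b M) * d :=
    norm_mul_sub_mul_le n1 hCn' h1 hCC
  have h4 : ‖K * Bᵀ * C * (B * K) - K' * B'ᵀ * C' * (B' * K')‖ ≤
      (((1 * M + M * 1) * b + M * M * invLip a b M) * (M * M) +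
        M * M * b * (1 * M + M * 1)) * d :=
    norm_mul_sub_mul_le (l2norm_mul_le_of_le n1 hCn) (l2norm_mul_le_of_le hB' hK') h3 h2
  set G := K - K * Bᵀ * C * (B * K) with hG
  set G' := K' - K' * B'ᵀ * C' * (B' * K') with hG'
  have hGn : ‖G‖ ≤ M + M ^ 2 * b * M ^ 2 := by
    refine (norm_sub_le _ _).trans (add_le_add hK ?_)
    rw [sq]
    exact l2norm_mul_le_of_le (l2norm_mul_le_of_le n1 hCn) (l2norm_mul_le_of_le hB hK)
  have hGG : ‖G - G'‖ ≤ (1 + ((2 * M * b + M ^ 2 * invLip a b M) * M ^ 2 +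
      M ^ 2 * b * (2 * M))) * d := by
    have : G - G' = (K - K') - (K * Bᵀ * C * (B * K) - K' * B'ᵀ * C' * (B' * K')) := by
      rw [hG, hG']; abel
    rw [this]
    refine (norm_sub_le _ _).trans ?_
    calc _ ≤ d + (((1 * M + M * 1) * b + M * M * invLip a b M) * (M * M) +
        M * M * b * (1 * M + M * 1)) * d := add_le_add hdK h4
      _ = _ := by ring
  have hsq : |δ ^ 2 - δ' ^ 2| ≤ 2 * b * d := by
    have : δ ^ 2 - δ' ^ 2 = (δ + δ') * (δ - δ') := by ring
    rw [this, abs_mul, abs_of_pos (by positivity)]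
    exact mul_le_mul (by linarith) hdδ (abs_nonneg _) (by positivity)
  have hfin : lowRankCore B K δ - lowRankCore B' K' δ' =
      (δ ^ 2 - δ' ^ 2) • G + δ' ^ 2 • (G - G') := by
    change δ ^ 2 • G - δ' ^ 2 • G' = _
    rw [sub_smul, smul_sub _ G G']; abel
  rw [hfin]
  calc _ ≤ |δ ^ 2 - δ' ^ 2| * ‖G‖ + δ' ^ 2 * ‖G - G'‖ := by
        refine (norm_add_le _ _).trans (le_of_eq ?_)
        rw [norm_smul, norm_smul, Real.norm_eq_abs, Real.norm_eq_abs, abs_of_nonneg (sq_nonneg δ')]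
    _ ≤ (2 * b * d) * (M + M ^ 2 * b * M ^ 2) + b ^ 2 * ((1 + ((2 * M * b +
          M ^ 2 * invLip a b M) * M ^ 2 + M ^ 2 * b * (2 * M))) * d) := by
        gcongr
    _ = _ := by rw [coreLip]; ring

/-- Up to a term of the order of the rank, the log-determinant is that of the nugget. -/
lemma abs_log_det_add_le (hKp : K.PosSemidef) (hB : ‖B‖ ≤ M) (hK : ‖K‖ ≤ M) (ha : 0 < a)
    (hδ : a ≤ δ) (hδb : δ ≤ b) :
    |Real.log (lowRankCov B K δ).det + Fintype.card ι * Real.log δ| ≤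
      Fintype.card κ * (b * M ^ 3 + a⁻¹ * (coreBound b M * M ^ 2)) := by
  have hp := ha.trans_le hδ
  have hM : 0 ≤ M := (norm_nonneg _).trans hB
  have hb : 0 < b := hp.trans_le hδb
  have hC := lowRankCov_posDef B hKp hp
  have hm : (0 : ℝ) ≤ Fintype.card κ := Nat.cast_nonneg _
  have hcb : 0 ≤ coreBound b M := (norm_nonneg _).trans (norm_lowRankCore_le hKp hB hK hp hδb)
  -- Rescaling to P = I + δBKBᵀ removes the nugget. Since log det ≤ trace - dimension for both P and
  -- P⁻¹, the identity cancels on each side and leaves the trace of an m×m matrix.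
  set P := δ • lowRankCov B K δ with hPdef
  have hP : P.PosDef := hC.smul hp
  have hlog : Real.log P.det =
      Real.log (lowRankCov B K δ).det + Fintype.card ι * Real.log δ := by
    rw [hPdef, Matrix.det_smul, Real.log_mul (pow_pos hp _).ne' hC.det_pos.ne', Real.log_pow]
    ring
  rw [← hlog]
  have hup : Real.log P.det ≤ Fintype.card κ * (b * M ^ 3) := by
    refine (log_det_le_trace hP).trans ?_
    have : P.trace = Fintype.card ι + δ * (K * (Bᵀ * B)).trace := by
      rw [hPdef, lowRankCov, smul_add, smul_smul, mul_inv_cancel₀ hp.ne', one_smul,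
        Matrix.trace_add, Matrix.trace_one, Matrix.trace_smul, smul_eq_mul, Matrix.mul_assoc,
        Matrix.trace_mul_comm, Matrix.mul_assoc]
    rw [this, add_sub_cancel_left]
    have h1 : ‖K * (Bᵀ * B)‖ ≤ M * (M * M) :=
      l2norm_mul_le_of_le hK (l2norm_mul_le_of_le ((norm_transpose B).trans_le hB) hB)
    have h2 := (le_abs_self _).trans (abs_trace_le (K * (Bᵀ * B)))
    calc δ * (K * (Bᵀ * B)).trace ≤ δ * (Fintype.card κ * (M * (M * M))) := by
          have := mul_le_mul_of_nonneg_left h1 hm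
          exact mul_le_mul_of_nonneg_left (h2.trans this) hp.le
      _ ≤ b * (Fintype.card κ * (M * (M * M))) := by gcongr
      _ = _ := by ring
  have hlow : -Real.log P.det ≤ Fintype.card κ * (a⁻¹ * (coreBound b M * M ^ 2)) := by
    have hPi := hP.inv
    have h0 : -Real.log P.det = Real.log P⁻¹.det := by
      rw [Matrix.det_nonsing_inv, Ring.inverse_eq_inv', Real.log_inv]
    rw [h0]
    refine (log_det_le_trace hPi).trans ?_
    have hPinv : P⁻¹ = δ⁻¹ • (lowRankCov B K δ)⁻¹ := by
      have := (Units.mk0 δ hp.ne')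
      rw [hPdef]
      refine Matrix.inv_eq_left_inv ?_
      rw [smul_mul_smul_comm, inv_mul_cancel₀ hp.ne', one_smul]
      exact Matrix.nonsing_inv_mul _ (lowRankCov_isUnit_det B hKp hp)
    have : P⁻¹.trace = Fintype.card ι - δ⁻¹ * (lowRankCore B K δ * (Bᵀ * B)).trace := by
      rw [hPinv, lowRankCov_inv B hKp hp, smul_sub, smul_smul, inv_mul_cancel₀ hp.ne', one_smul,
        Matrix.trace_sub, Matrix.trace_one, Matrix.trace_smul, smul_eq_mul, Matrix.mul_assoc B,
        Matrix.trace_mul_comm B, Matrix.mul_assoc]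
    rw [this]
    have h1 : ‖lowRankCore B K δ * (Bᵀ * B)‖ ≤ coreBound b M * (M * M) :=
      l2norm_mul_le_of_le (norm_lowRankCore_le hKp hB hK hp hδb)
        (l2norm_mul_le_of_le ((norm_transpose B).trans_le hB) hB)
    have h2 := (neg_le_abs _).trans (abs_trace_le (lowRankCore B K δ * (Bᵀ * B)))
    have h3 := h2.trans (mul_le_mul_of_nonneg_left h1 hm)
    calc _ = δ⁻¹ * -(lowRankCore B K δ * (Bᵀ * B)).trace := by ring
      _ ≤ δ⁻¹ * (Fintype.card κ * (coreBound b M * (M * M))) := by gcongr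
      _ ≤ a⁻¹ * (Fintype.card κ * (coreBound b M * (M * M))) := by gcongr
      _ = _ := by ring
  have p1 : 0 ≤ (Fintype.card κ : ℝ) * (b * M ^ 3) := by positivity
  have p2 : 0 ≤ (Fintype.card κ : ℝ) * (a⁻¹ * (coreBound b M * M ^ 2)) := by positivity
  rw [abs_le]
  constructor <;> linarith

end LowRank

/-! ### Events of probability tending to one, and passage from pointwise to uniform bounds -/

section Whp

open scoped ENNReal

variable {Ω : Type*} [MeasurableSpace Ω]

/-- The filter on `ℕ × Ω` of the sequences of events whose probability tends to one. -/
def whp (P : Measure Ω) : Filter (ℕ × Ω) where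
  sets := {E | Tendsto (fun k => P {ω | (k, ω) ∉ E}) atTop (𝓝 0)}
  univ_sets := by simp
  sets_of_superset := by
    intro E F hE hEF
    refine tendsto_of_tendsto_of_tendsto_of_le_of_le tendsto_const_nhds hE (fun _ => zero_le) ?_
    exact fun k => measure_mono fun ω hω h => hω (hEF h)
  inter_sets := by
    intro E F hE hF
    have h := Tendsto.add hE hF
    rw [add_zero] at h
    refine tendsto_of_tendsto_of_tendsto_of_le_of_le tendsto_const_nhds h (fun _ => zero_le) ?_
    intro k
    refine le_trans (measure_mono fun ω hω => ?_) (measure_union_le _ _)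
    simp only [Set.mem_ofPred_eq, Set.mem_inter_iff, not_and_or] at hω
    exact hω

lemma eventually_whp {P : Measure Ω} {p : ℕ × Ω → Prop} :
    (∀ᶠ x in whp P, p x) ↔ Tendsto (fun k => P {ω | ¬ p (k, ω)}) atTop (𝓝 0) := Iff.rfl

lemma eventually_whp_of_ae {P : Measure Ω} {p : ℕ → Ω → Prop}
    (h : ∀ᶠ k in atTop, ∀ᵐ ω ∂P, p k ω) : ∀ᶠ x in whp P, p x.1 x.2 := by
  rw [eventually_whp]
  refine tendsto_const_nhds.congr' ?_
  filter_upwards [h] with k hk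
  exact (ae_iff.1 hk).symm

lemma eventually_whp_of_eventually {P : Measure Ω} {p : ℕ → Prop}
    (h : ∀ᶠ k in atTop, p k) : ∀ᶠ x in whp P, p x.1 :=
  eventually_whp_of_ae (p := fun k _ => p k) (h.mono fun _ hk => ae_of_all _ fun _ => hk)

/-- Needed because tightness constants depend on the tolerated failure probability ε: for each ε one
works on an event `G` chosen for that ε, and lets ε tend to zero only for the final conclusion. -/
lemma eventually_whp_of_approx {P : Measure Ω} {p : ℕ → Ω → Prop}
    (h : ∀ ε : ℝ≥0∞, 0 < ε → ∃ G : ℕ → Ω → Prop, (∀ᶠ k in atTop, P {ω | ¬ G k ω} ≤ ε) ∧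
      ∀ᶠ x in whp P, G x.1 x.2 → p x.1 x.2) : ∀ᶠ x in whp P, p x.1 x.2 := by
  rw [eventually_whp, ENNReal.tendsto_nhds_zero]
  intro ε hε
  have hε2 : 0 < ε / 2 := ENNReal.half_pos hε.ne'
  obtain ⟨G, hG, hGp⟩ := h (ε / 2) hε2
  rw [eventually_whp, ENNReal.tendsto_nhds_zero] at hGp
  filter_upwards [hG, hGp _ hε2] with k h1 h2
  calc P {ω | ¬ p k ω} ≤ P ({ω | ¬ G k ω} ∪ {ω | ¬ (G k ω → p k ω)}) := by
        refine measure_mono fun ω hω => ?_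
        by_cases hg : G k ω
        · exact Or.inr fun h => hω (h hg)
        · exact Or.inl hg
    _ ≤ ε / 2 + ε / 2 := (measure_union_le _ _).trans (add_le_add h1 h2)
    _ = ε := ENNReal.add_halves ε

/-- Pointwise smallness and equicontinuity on events of large probability give uniform
smallness on a compact index set. -/
lemma eventually_whp_forall_le {P : Measure Ω} {α : Type*} [PseudoMetricSpace α] {T : Set α}
    (hT : IsCompact T) (Q : ℕ → α → Ω → ℝ)
    (hpt : ∀ t ∈ T, ∀ ρ > 0, ∀ᶠ x in whp P, |Q x.1 t x.2| ≤ ρ)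
    (heq : ∀ ε : ℝ≥0∞, 0 < ε → ∃ G : ℕ → Ω → Prop, (∀ᶠ k in atTop, P {ω | ¬ G k ω} ≤ ε) ∧
      ∀ ρ > 0, ∃ h > 0, ∀ᶠ x in whp P, G x.1 x.2 → ∀ s ∈ T, ∀ t ∈ T, dist s t < h →
        |Q x.1 s x.2 - Q x.1 t x.2| ≤ ρ)
    {ρ : ℝ} (hρ : 0 < ρ) : ∀ᶠ x in whp P, ∀ t ∈ T, |Q x.1 t x.2| ≤ ρ := by
  refine eventually_whp_of_approx (p := fun k ω => ∀ t ∈ T, |Q k t ω| ≤ ρ) fun ε hε => ?_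
  obtain ⟨G, hG, hGe⟩ := heq ε hε
  refine ⟨G, hG, ?_⟩
  obtain ⟨h, hh, hGh⟩ := hGe (ρ / 2) (half_pos hρ)
  -- The mesh comes from the equicontinuity at level ρ/2 and does not depend on the model index, so
  -- one finite net serves the whole sequence and pointwise control on it holds simultaneously.
  obtain ⟨s, hsT, hsf, hs⟩ := hT.finite_cover_balls hh
  have hall : ∀ᶠ x in whp P, ∀ t ∈ s, |Q x.1 t x.2| ≤ ρ / 2 :=
    (Set.Finite.eventually_all hsf).2 fun t ht => hpt t (hsT ht) _ (half_pos hρ)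
  filter_upwards [hGh, hall] with x h1 h2 hg t ht
  obtain ⟨u, hu, hut⟩ := Set.mem_iUnion₂.1 (hs ht)
  have h3 := h1 hg t ht u (hsT hu) hut
  have h4 := h2 u hu
  have : Q x.1 t x.2 = (Q x.1 t x.2 - Q x.1 u x.2) + Q x.1 u x.2 := by ring
  rw [this]
  exact (abs_add_le _ _).trans (by linarith)

/-- Chebyshev's inequality along a sequence of models. -/
lemma eventually_whp_of_lintegral_sq {P : Measure Ω} {Z : ℕ → Ω → ℝ}
    {c : ℕ → ℝ} (hc : Tendsto c atTop (𝓝 0))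
    (hm : ∀ᶠ k in atTop, AEMeasurable (Z k) P)
    (h : ∀ᶠ k in atTop, ∫⁻ ω, ENNReal.ofReal (Z k ω ^ 2) ∂P ≤ ENNReal.ofReal (c k)) {ρ : ℝ}
    (hρ : 0 < ρ) : ∀ᶠ x in whp P, |Z x.1 x.2| ≤ ρ := by
  rw [eventually_whp]
  have hlim : Tendsto (fun k => ENNReal.ofReal (c k) / ENNReal.ofReal (ρ ^ 2)) atTop (𝓝 0) := by
    have h1 := ENNReal.tendsto_ofReal hc
    rw [ENNReal.ofReal_zero] at h1
    have := ENNReal.Tendsto.div_const h1 (b := ENNReal.ofReal (ρ ^ 2))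
      (Or.inr (by simp; positivity))
    simpa using this
  refine tendsto_of_tendsto_of_tendsto_of_le_of_le' tendsto_const_nhds hlim
    (Eventually.of_forall fun _ => zero_le) ?_
  filter_upwards [hm, h] with k hmk hk
  have h0 : ENNReal.ofReal (ρ ^ 2) ≠ 0 := by simp; positivity
  have hmarkov := meas_ge_le_lintegral_div (μ := P)
    (f := fun ω => ENNReal.ofReal (Z k ω ^ 2)) (by fun_prop) h0 ENNReal.ofReal_ne_top
  refine (measure_mono fun ω hω => ?_).trans (hmarkov.trans (ENNReal.div_le_div_right hk _))
  simp only [Set.mem_ofPred_eq, not_le] at hω ⊢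
  refine ENNReal.ofReal_le_ofReal ?_
  rw [← sq_abs (Z k ω)]
  exact pow_le_pow_left₀ hρ.le hω.le 2

end Whp

/-! ### Nets in finite dimension and the chaining bound -/

section Chaining

open scoped ENNReal

/-- In a finite-dimensional space, balls can be covered by a bounded number of balls of a quarter
of the radius. -/
lemma exists_cover_ball (E : Type*) [NormedAddCommGroup E] [NormedSpace ℝ E]
    [FiniteDimensional ℝ E] :
    ∃ D : ℕ, ∀ (x : E) (ρ : ℝ), 0 < ρ → ∃ s : Finset E, s.card ≤ D ∧
      ∀ y ∈ Metric.closedBall x ρ, ∃ c ∈ s, dist y c ≤ ρ / 4 := by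
  classical
  have : ProperSpace E := FiniteDimensional.proper ℝ E
  obtain ⟨t, -, htf, ht⟩ :=
    (isCompact_closedBall (0 : E) 1).finite_cover_balls (e := 1 / 4) (by norm_num)
  refine ⟨htf.toFinset.card, fun x ρ hρ => ⟨htf.toFinset.image fun c => x + ρ • c,
    Finset.card_image_le, fun y hy => ?_⟩⟩
  have h1 : ρ⁻¹ • (y - x) ∈ Metric.closedBall (0 : E) 1 := by
    rw [mem_closedBall_zero_iff, norm_smul, Real.norm_eq_abs, abs_of_pos (inv_pos.2 hρ),
      inv_mul_le_iff₀ hρ, mul_one, ← dist_eq_norm]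
    exact hy
  obtain ⟨c, hc, hyc⟩ := Set.mem_iUnion₂.1 (ht h1)
  refine ⟨x + ρ • c, Finset.mem_image_of_mem _ (by simpa using hc), ?_⟩
  have h2 : y - (x + ρ • c) = ρ • (ρ⁻¹ • (y - x) - c) := by
    rw [smul_sub, smul_smul, mul_inv_cancel₀ hρ.ne', one_smul]; abel
  rw [dist_eq_norm, h2, norm_smul, Real.norm_eq_abs, abs_of_pos hρ, ← dist_eq_norm]
  have h3 : dist (ρ⁻¹ • (y - x)) c < 1 / 4 := hyc
  nlinarith

/-- Each of the D^l balls at level l is covered afresh by D balls of a quarter of the radius. -/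
lemma exists_cover_ball_pow (E : Type*) [NormedAddCommGroup E] [NormedSpace ℝ E]
    [FiniteDimensional ℝ E] :
    ∃ D : ℕ, ∀ (x : E) (ρ : ℝ), 0 < ρ → ∀ l : ℕ, ∃ s : Finset E, s.card ≤ D ^ l ∧
      ∀ y ∈ Metric.closedBall x ρ, ∃ c ∈ s, dist y c ≤ ρ / 4 ^ l := by
  classical
  obtain ⟨D, hD⟩ := exists_cover_ball E
  refine ⟨D, fun x ρ hρ l => ?_⟩
  induction l with
  | zero => exact ⟨{x}, by simp, fun y hy => ⟨x, by simp, by simpa using hy⟩⟩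
  | succ l ih =>
    obtain ⟨s, hs, hcov⟩ := ih
    choose f hf hfc using fun c : E => hD c (ρ / 4 ^ l) (by positivity)
    refine ⟨s.biUnion f, ?_, fun y hy => ?_⟩
    · rw [pow_succ]
      exact Finset.card_biUnion_le_card_mul _ _ _ (fun c _ => hf c) |>.trans
        (Nat.mul_le_mul_right _ hs)
    · obtain ⟨c, hc, hyc⟩ := hcov y hy
      obtain ⟨c', hc', hyc'⟩ := hfc c y hyc
      exact ⟨c', Finset.mem_biUnion.2 ⟨c, hc, hc'⟩, by rw [pow_succ, ← div_div]; exact hyc'⟩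

/-- A bounded set in a finite-dimensional space has geometric nets of exponential cardinality. -/
lemma exists_nets {E : Type*} [NormedAddCommGroup E] [NormedSpace ℝ E]
    [FiniteDimensional ℝ E] {T : Set E} (hT : Bornology.IsBounded T) :
    ∃ (D : ℕ) (R : ℝ), 0 < R ∧ (∀ s ∈ T, ∀ t ∈ T, dist s t ≤ R) ∧
      ∀ l : ℕ, ∃ s : Finset E, (s : Set E) ⊆ T ∧ s.card ≤ D ^ l ∧
        ∀ y ∈ T, ∃ c ∈ s, dist y c ≤ R / 4 ^ l := by
  classical
  obtain ⟨D, hD⟩ := exists_cover_ball_pow E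
  obtain ⟨ρ, hρ, hTρ⟩ := hT.subset_closedBall_lt 0 0
  refine ⟨D, 2 * ρ, by positivity, fun s hs t ht => ?_, fun l => ?_⟩
  · have h1 := hTρ hs
    have h2 := hTρ ht
    rw [Metric.mem_closedBall] at h1 h2
    linarith [dist_triangle_right s t 0]
  · obtain ⟨s, hs, hcov⟩ := hD 0 ρ hρ l
    -- The centres of the covering balls need not lie in T. Each useful one is replaced by a nearby
    -- point of T, which doubles the radius; hence R = 2ρ.
    let s' := s.filter fun c => ∃ y ∈ T, dist y c ≤ ρ / 4 ^ l
    have hch : ∀ c : E, ∃ y : E, c ∈ s' → y ∈ T ∧ dist y c ≤ ρ / 4 ^ l := fun c => by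
      by_cases hc : c ∈ s'
      · obtain ⟨y, hy⟩ := (Finset.mem_filter.1 hc).2
        exact ⟨y, fun _ => hy⟩
      · exact ⟨0, fun h => absurd h hc⟩
    choose f hf using hch
    refine ⟨s'.image f, ?_, ?_, fun y hy => ?_⟩
    · intro z hz
      obtain ⟨c, hc, rfl⟩ := Finset.mem_image.1 (Finset.mem_coe.1 hz)
      exact (hf c hc).1
    · exact Finset.card_image_le.trans ((Finset.card_filter_le _ _).trans hs)
    · obtain ⟨c, hc, hyc⟩ := hcov y (hTρ hy)
      have hc' : c ∈ s' := Finset.mem_filter.2 ⟨hc, y, hy, hyc⟩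
      refine ⟨f c, Finset.mem_image_of_mem _ hc', ?_⟩
      have h1 := dist_triangle_right y (f c) c
      have h2 := (hf c hc').2
      have : 2 * ρ / 4 ^ l = ρ / 4 ^ l + ρ / 4 ^ l := by ring
      linarith

/-- Deterministic part of chaining: increments controlled on the nets are controlled everywhere. -/
lemma norm_sub_le_of_nets {E V : Type*} [PseudoMetricSpace E] [NormedAddCommGroup V] {T : Set E}
    {R A : ℝ} (N : ℕ → Finset E) (hNT : ∀ l, (N l : Set E) ⊆ T)
    (hN : ∀ l, ∀ y ∈ T, ∃ c ∈ N l, dist y c ≤ R / 4 ^ l) (hR : 0 ≤ R)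
    (Y : E → V) (hY : ContinuousOn Y T)
    (hinc : ∀ l, ∀ s ∈ N l, ∀ t, t ∈ N l ∨ t ∈ N (l + 1) → dist s t ≤ 4 * R / 4 ^ l →
      ‖Y s - Y t‖ ≤ A / 2 ^ l) (l : ℕ) {s t : E} (hs : s ∈ T) (ht : t ∈ T)
    (hst : dist s t ≤ R / 4 ^ l) : ‖Y s - Y t‖ ≤ 5 * A / 2 ^ l := by
  choose! π hπ hπd using hN
  have hstep : ∀ y ∈ T, ∀ j, ‖Y (π j y) - Y (π (j + 1) y)‖ ≤ A / 2 ^ j := fun y hy j => by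
    refine hinc j _ (hπ j y hy) _ (Or.inr (hπ _ y hy)) ?_
    have h1 := hπd j y hy
    have h2 := hπd (j + 1) y hy
    have h3 := dist_triangle_left (π j y) (π (j + 1) y) y
    have h4 : R / 4 ^ (j + 1) = R / 4 ^ j / 4 := by rw [pow_succ, div_div]
    have h5 : 0 ≤ R / 4 ^ j := by positivity
    have h6 : 4 * R / 4 ^ j = 4 * (R / 4 ^ j) := by ring
    linarith
  -- The right-hand side is the geometric sum of A/2^j over l ≤ j < l + i, kept exact so that the
  -- induction closes.
  have hpart : ∀ y ∈ T, ∀ i, ‖Y (π l y) - Y (π (l + i) y)‖ ≤ 2 * A / 2 ^ l - 2 * A / 2 ^ (l + i) := by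
    intro y hy i
    induction i with
    | zero => simp
    | succ i ih =>
      have h1 := hstep y hy (l + i)
      have h2 : Y (π l y) - Y (π (l + (i + 1)) y) =
        (Y (π l y) - Y (π (l + i) y)) + (Y (π (l + i) y) - Y (π (l + i + 1) y)) := by
          rw [← add_assoc]; abel
      rw [h2]
      refine (norm_add_le _ _).trans ?_
      have h3 : 2 * A / 2 ^ (l + (i + 1)) = A / 2 ^ (l + i) := by
        rw [← add_assoc, pow_succ]; field_simp
      have h4 : 2 * A / 2 ^ (l + i) = 2 * (A / 2 ^ (l + i)) := by ring
      linarith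
  have hA : 0 ≤ A := by
    have := (norm_nonneg _).trans (hstep s hs 0)
    simpa using this
  have hlim : ∀ y ∈ T, ‖Y (π l y) - Y y‖ ≤ 2 * A / 2 ^ l := by
    intro y hy
    have h1 : Tendsto (fun i => π (l + i) y) atTop (𝓝[T] y) := by
      refine tendsto_nhdsWithin_iff.2 ⟨?_, Eventually.of_forall fun i => hNT _ (hπ _ y hy)⟩
      rw [tendsto_iff_dist_tendsto_zero]
      have h2 : Tendsto (fun i : ℕ => R / 4 ^ (l + i)) atTop (𝓝 0) := by
        have := (tendsto_pow_atTop_nhds_zero_of_lt_one (r := (1 / 4 : ℝ)) (by norm_num)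
          (by norm_num)).const_mul (R / 4 ^ l)
        rw [mul_zero] at this
        refine this.congr fun i => ?_
        rw [pow_add, one_div, inv_pow]; field_simp
      refine squeeze_zero (fun _ => dist_nonneg) (fun i => ?_) h2
      rw [dist_comm]
      exact hπd _ y hy
    have h3 : Tendsto (fun i => Y (π (l + i) y)) atTop (𝓝 (Y y)) := (hY y hy).tendsto.comp h1
    refine le_of_tendsto ((tendsto_const_nhds.sub h3).norm) (Eventually.of_forall fun i => ?_)
    refine (hpart y hy i).trans ?_
    have : 0 ≤ 2 * A / 2 ^ (l + i) := by positivity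
    linarith
  have hmid : ‖Y (π l s) - Y (π l t)‖ ≤ A / 2 ^ l := by
    refine hinc l _ (hπ l s hs) _ (Or.inl (hπ l t ht)) ?_
    have h1 := hπd l s hs
    have h2 := hπd l t ht
    have h3 := dist_triangle4 (π l s) s t (π l t)
    rw [dist_comm (π l s) s] at h3
    have h5 : 0 ≤ R / 4 ^ l := by positivity
    have h6 : 4 * R / 4 ^ l = 4 * (R / 4 ^ l) := by ring
    linarith
  -- The 5 is 2 + 1 + 2: from s to its projection on the net of level l, across that net, and back
  -- to t.
  have h1 := hlim s hs
  have h2 := hlim t ht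
  have h3 : Y s - Y t = -(Y (π l s) - Y s) + ((Y (π l s) - Y (π l t)) + (Y (π l t) - Y t)) := by abel
  rw [h3]
  refine (norm_add_le _ _).trans ?_
  rw [norm_neg]
  have h4 := norm_add_le (Y (π l s) - Y (π l t)) (Y (π l t) - Y t)
  have h5 : 5 * A / 2 ^ l = 2 * A / 2 ^ l + (A / 2 ^ l + 2 * A / 2 ^ l) := by ring
  linarith

/-- **Chaining**: a continuous process on a bounded subset of a finite-dimensional space whose
increments have sufficiently high polynomial moments has a uniform modulus of continuity, with
constants that only depend on the index set and the moment bound. -/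
lemma exists_chaining {E : Type*} [NormedAddCommGroup E] [NormedSpace ℝ E]
    [FiniteDimensional ℝ E] {T : Set E} (hT : Bornology.IsBounded T)
    {Ω : Type*} [MeasurableSpace Ω] (P : Measure Ω) :
    ∃ (R : ℝ) (r : ℕ) (C : ℝ), 0 < R ∧ 0 < r ∧ (∀ s ∈ T, ∀ t ∈ T, dist s t ≤ R) ∧
      ∀ (V : Type) [NormedAddCommGroup V] (Y : E → Ω → V) (c : ℝ), 0 ≤ c →
        (∀ ω, ContinuousOn (fun t => Y t ω) T) →
        (∀ s ∈ T, ∀ t ∈ T, ∀ b > 0, P {ω | b < ‖Y s ω - Y t ω‖} ≤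
          ENNReal.ofReal (c * (dist s t / b) ^ (2 * r))) →
        ∀ A > 0, P {ω | ¬ ∀ l : ℕ, ∀ s ∈ T, ∀ t ∈ T, dist s t ≤ R / 4 ^ l →
          ‖Y s ω - Y t ω‖ ≤ 5 * A / 2 ^ l} ≤ ENNReal.ofReal (C * c / A ^ (2 * r)) := by
  classical
  obtain ⟨D, R, hR, hTR, hnets⟩ := exists_nets hT
  choose N hNT hNc hN using hnets
  -- Level l has at most (1 + D)D^(2l) pairs, and a pair fails with probability at most
  -- c(4R/(A·2^l))^(2r). For r = D + 1 the decay is 4^(-l)·4^(-Dl), and D² ≤ 4^D absorbs the number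
  -- of pairs, leaving the ratio 1/4. The leading 2 is room for the geometric sum 4/3.
  refine ⟨R, D + 1, 2 * ((1 + D) * (4 * R) ^ (2 * (D + 1))), hR, D.succ_pos, hTR, ?_⟩
  intro V _ Y c hc hY hmom A hA
  set r := D + 1 with hr
  set I : ℕ → Finset (E × E) := fun l =>
    (N l ×ˢ (N l ∪ N (l + 1))).filter fun x => dist x.1 x.2 ≤ 4 * R / 4 ^ l with hI
  have hIc : ∀ l, ((I l).card : ℝ) ≤ (1 + D) * (D ^ 2) ^ l := fun l => by
    have h1 : (I l).card ≤ D ^ l * (D ^ l + D ^ (l + 1)) := by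
      refine (Finset.card_filter_le _ _).trans ?_
      rw [Finset.card_product]
      exact Nat.mul_le_mul (hNc l) ((Finset.card_union_le _ _).trans
        (Nat.add_le_add (hNc l) (hNc (l + 1))))
    calc ((I l).card : ℝ) ≤ ((D ^ l * (D ^ l + D ^ (l + 1)) : ℕ) : ℝ) := by exact_mod_cast h1
      _ = _ := by push_cast; ring
  have hsub : {ω | ¬ ∀ l : ℕ, ∀ s ∈ T, ∀ t ∈ T, dist s t ≤ R / 4 ^ l →
      ‖Y s ω - Y t ω‖ ≤ 5 * A / 2 ^ l} ⊆
      ⋃ l : ℕ, ⋃ x ∈ I l, {ω | A / 2 ^ l < ‖Y x.1 ω - Y x.2 ω‖} := by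
    intro ω hω
    by_contra hcon
    refine hω fun l s hs t ht hst =>
      norm_sub_le_of_nets N hNT hN hR.le (fun t => Y t ω) (hY ω) ?_ l hs ht hst
    intro j s' hs' t' ht' hst'
    by_contra hlt
    refine hcon (Set.mem_iUnion.2 ⟨j, Set.mem_iUnion₂.2 ⟨(s', t'), ?_, not_le.1 hlt⟩⟩)
    exact Finset.mem_filter.2 ⟨Finset.mem_product.2 ⟨hs', Finset.mem_union.2 ht'⟩, hst'⟩
  have hITl : ∀ l, ∀ x ∈ I l, x.1 ∈ T ∧ x.2 ∈ T ∧ dist x.1 x.2 ≤ 4 * R / 4 ^ l := fun l x hx => by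
    obtain ⟨h1, h2⟩ := Finset.mem_filter.1 hx
    obtain ⟨h3, h4⟩ := Finset.mem_product.1 h1
    refine ⟨hNT _ h3, ?_, h2⟩
    rcases Finset.mem_union.1 h4 with h | h
    · exact hNT _ h
    · exact hNT _ h
  set q : ℝ := (1 + D) * (4 * R) ^ (2 * r) * c / A ^ (2 * r) with hq
  have hq0 : 0 ≤ q := by positivity
  have hlev : ∀ l, P (⋃ x ∈ I l, {ω | A / 2 ^ l < ‖Y x.1 ω - Y x.2 ω‖}) ≤
      ENNReal.ofReal (q * (1 / 4) ^ l) := fun l => by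
    refine (measure_biUnion_finset_le _ _).trans ?_
    have h1 : ∀ x ∈ I l, P {ω | A / 2 ^ l < ‖Y x.1 ω - Y x.2 ω‖} ≤
        ENNReal.ofReal (c * (4 * R / A / 2 ^ l) ^ (2 * r)) := fun x hx => by
      obtain ⟨hx1, hx2, hx3⟩ := hITl l x hx
      refine (hmom _ hx1 _ hx2 _ (by positivity)).trans (ENNReal.ofReal_le_ofReal ?_)
      have h2 : dist x.1 x.2 / (A / 2 ^ l) ≤ 4 * R / A / 2 ^ l := by
        rw [div_le_iff₀ (by positivity)]
        refine hx3.trans (le_of_eq ?_)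
        -- The distances shrink like 4^(-l) while the thresholds shrink only like 2^(-l), so their
        -- ratio still decays like 2^(-l).
        have : (4 : ℝ) ^ l = 2 ^ l * 2 ^ l := by rw [← mul_pow]; norm_num
        rw [this]; field_simp
      gcongr
    refine (Finset.sum_le_card_nsmul _ _ _ h1).trans ?_
    rw [nsmul_eq_mul, ← ENNReal.ofReal_natCast, ← ENNReal.ofReal_mul (Nat.cast_nonneg _)]
    refine ENNReal.ofReal_le_ofReal ?_
    have hD : ((D : ℝ) ^ 2) ≤ 4 ^ D := by
      have : (D : ℝ) ≤ 2 ^ D := by exact_mod_cast D.lt_two_pow_self.le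
      calc (D : ℝ) ^ 2 ≤ (2 ^ D) ^ 2 := by gcongr
        _ = 4 ^ D := by rw [← pow_mul, mul_comm, pow_mul]; norm_num
    have h4 : ((D : ℝ) ^ 2) ^ l ≤ (4 ^ D) ^ l := by gcongr
    have h5 : (4 * R / A / 2 ^ l) ^ (2 * r) =
        (4 * R) ^ (2 * r) / A ^ (2 * r) * ((1 / 4) ^ l * ((4 ^ D) ^ l)⁻¹) := by
      rw [div_pow, div_pow, div_eq_mul_inv]
      congr 1
      rw [← pow_mul, mul_comm l, pow_mul, pow_mul, hr, pow_succ, mul_pow]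
      norm_num [mul_comm]
      rw [one_div, inv_pow]
    rw [h5]
    have h6 : ((I l).card : ℝ) * ((4 ^ D) ^ l)⁻¹ ≤ 1 + D := by
      rw [mul_inv_le_iff₀ (by positivity)]
      refine (hIc l).trans ?_
      gcongr
    calc _ = (((I l).card : ℝ) * ((4 ^ D) ^ l)⁻¹) *
          (c * (4 * R) ^ (2 * r) / A ^ (2 * r) * (1 / 4) ^ l) := by ring
      _ ≤ (1 + D) * (c * (4 * R) ^ (2 * r) / A ^ (2 * r) * (1 / 4) ^ l) := by gcongr
      _ = _ := by rw [hq]; ring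
  refine (measure_mono hsub).trans ((measure_iUnion_le _).trans ?_)
  refine (ENNReal.tsum_le_tsum hlev).trans ?_
  have hsum : Summable fun l : ℕ => q * (1 / 4) ^ l :=
    (summable_geometric_of_lt_one (by norm_num) (by norm_num)).mul_left q
  rw [← ENNReal.ofReal_tsum_of_nonneg (fun l => by positivity) hsum]
  refine ENNReal.ofReal_le_ofReal ?_
  rw [tsum_mul_left, tsum_geometric_of_lt_one (by norm_num) (by norm_num)]
  have : 2 * ((1 + (D : ℝ)) * (4 * R) ^ (2 * r)) * c / A ^ (2 * r) = 2 * q := by rw [hq]; ring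
  rw [this]
  norm_num
  linarith

end Chaining

/-! ### Gaussian vectors: law of the errors, quadratic forms, even moments -/

section GaussianVectors

open scoped Matrix.Norms.L2Operator ENNReal

variable {ι κ τ : Type*} [Fintype ι] [Fintype κ] [Fintype τ]
  [DecidableEq ι] [DecidableEq κ] [DecidableEq τ]
variable {Ω : Type*} [MeasurableSpace Ω] {P : Measure Ω}

lemma charFun_multivariateGaussian_zero {S : Matrix ι ι ℝ} (hS : S.PosSemidef)
    (t : EuclideanSpace ℝ ι) : charFun (multivariateGaussian 0 S) t =
      Complex.exp (-((t.ofLp ⬝ᵥ S *ᵥ t.ofLp : ℝ) : ℂ) / 2) := by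
  rw [charFun_multivariateGaussian hS]
  simp [neg_div]

/-- Linear images of centred Gaussian vectors are Gaussian. -/
lemma hasLaw_mulVec_multivariateGaussian {S : Matrix ι ι ℝ} (hS : S.PosSemidef)
    (A : Matrix κ ι ℝ) {X : Ω → EuclideanSpace ℝ ι}
    (hX : HasLaw X (multivariateGaussian 0 S) P) :
    HasLaw (fun ω => (WithLp.toLp 2 (A *ᵥ (X ω).ofLp) : EuclideanSpace ℝ κ))
      (multivariateGaussian 0 (A * S * Aᵀ)) P := by
  have hm : Measurable fun x : EuclideanSpace ℝ ι =>
      (WithLp.toLp 2 (A *ᵥ x.ofLp) : EuclideanSpace ℝ κ) :=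
    (LinearMap.continuous_of_finiteDimensional (Matrix.toEuclideanLin A)).measurable
  refine HasLaw.fun_comp (μ := multivariateGaussian 0 S)
    (Y := fun x : EuclideanSpace ℝ ι => (WithLp.toLp 2 (A *ᵥ x.ofLp) : EuclideanSpace ℝ κ))
    ⟨hm.aemeasurable, ?_⟩ hX
  have : IsProbabilityMeasure ((multivariateGaussian 0 S).map fun x : EuclideanSpace ℝ ι =>
      (WithLp.toLp 2 (A *ᵥ x.ofLp) : EuclideanSpace ℝ κ)) :=
    Measure.isProbabilityMeasure_map hm.aemeasurable
  refine Measure.ext_of_charFun (funext fun t => ?_)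
  rw [charFun_multivariateGaussian_zero (mul_mul_transpose_posSemidef A hS), charFun_apply,
    integral_map hm.aemeasurable (by fun_prop)]
  have h1 : ∀ x : EuclideanSpace ℝ ι, inner ℝ (WithLp.toLp 2 (A *ᵥ x.ofLp) : EuclideanSpace ℝ κ) t
      = inner ℝ x (WithLp.toLp 2 (Aᵀ *ᵥ t.ofLp) : EuclideanSpace ℝ ι) := fun x => by
    rw [← WithLp.toLp_ofLp 2 t, ← WithLp.toLp_ofLp 2 x, EuclideanSpace.inner_toLp_toLp,
      EuclideanSpace.inner_toLp_toLp]
    simp only [star_trivial]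
    rw [Matrix.dotProduct_mulVec, ← Matrix.mulVec_transpose]
  simp_rw [h1]
  rw [← charFun_apply, charFun_multivariateGaussian_zero hS]
  congr 4
  simp only [Matrix.mulVec_mulVec, Matrix.dotProduct_mulVec, ← Matrix.mulVec_transpose,
    Matrix.transpose_transpose, Matrix.transpose_mul, Matrix.mul_assoc]

/-- The error vector of a low-rank model is Gaussian with the model covariance. -/
lemma hasLaw_error [IsProbabilityMeasure P] {B : Matrix ι κ ℝ} {K : Matrix κ κ ℝ} {δ : ℝ}
    (hδ : 0 < δ) (hK : K.PosSemidef) {η : Ω → EuclideanSpace ℝ κ} {ε : ι → Ω → ℝ}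
    (hη : HasLaw η (multivariateGaussian 0 K) P)
    (hε : ∀ r, HasLaw (ε r) (gaussianReal 0 (Real.toNNReal δ⁻¹)) P) (hind : iIndepFun ε P)
    (hηε : IndepFun η (fun ω r => ε r ω) P) :
    HasLaw (fun ω => (WithLp.toLp 2 (B *ᵥ (η ω).ofLp + fun r => ε r ω) : EuclideanSpace ℝ ι))
      (multivariateGaussian 0 (lowRankCov B K δ)) P := by
  have hBη := hasLaw_mulVec_multivariateGaussian hK B hη
  have hε' : HasLaw (fun ω r => ε r ω)
      (Measure.pi fun _ : ι => gaussianReal 0 (Real.toNNReal δ⁻¹)) P := hind.hasLaw_pi hε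
  have hmε : AEMeasurable (fun ω => (WithLp.toLp 2 fun r => ε r ω : EuclideanSpace ℝ ι)) P :=
    (WithLp.measurable_toLp 2 _).comp_aemeasurable hε'.aemeasurable
  have hm : Measurable fun x : EuclideanSpace ℝ κ =>
      (WithLp.toLp 2 (B *ᵥ x.ofLp) : EuclideanSpace ℝ ι) :=
    (LinearMap.continuous_of_finiteDimensional (Matrix.toEuclideanLin B)).measurable
  have hindep : IndepFun (fun ω => (WithLp.toLp 2 (B *ᵥ (η ω).ofLp) : EuclideanSpace ℝ ι))
      (fun ω => (WithLp.toLp 2 fun r => ε r ω : EuclideanSpace ℝ ι)) P :=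
    hηε.comp hm (WithLp.measurable_toLp 2 (ι → ℝ))
  have hsum : (fun ω => (WithLp.toLp 2 (B *ᵥ (η ω).ofLp + fun r => ε r ω) : EuclideanSpace ℝ ι)) =
      (fun ω => (WithLp.toLp 2 (B *ᵥ (η ω).ofLp) : EuclideanSpace ℝ ι)) +
      (fun ω => (WithLp.toLp 2 fun r => ε r ω : EuclideanSpace ℝ ι)) := rfl
  refine ⟨hsum ▸ hBη.aemeasurable.add hmε, ?_⟩
  rw [hsum]
  have : IsProbabilityMeasure (P.map ((fun ω =>
      (WithLp.toLp 2 (B *ᵥ (η ω).ofLp) : EuclideanSpace ℝ ι)) +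
      (fun ω => (WithLp.toLp 2 fun r => ε r ω : EuclideanSpace ℝ ι)))) :=
    Measure.isProbabilityMeasure_map (hBη.aemeasurable.add hmε)
  refine Measure.ext_of_charFun (funext fun t => ?_)
  have hmap : P.map (fun ω => (WithLp.toLp 2 fun r => ε r ω : EuclideanSpace ℝ ι)) =
      (Measure.pi fun _ : ι => gaussianReal 0 (Real.toNNReal δ⁻¹)).map (WithLp.toLp 2) := by
    rw [← hε'.map_eq, AEMeasurable.map_map_of_aemeasurable (by fun_prop) hε'.aemeasurable]
    rfl
  -- By independence the characteristic functions multiply, so the two quadratic exponents add up to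
  -- that of δ⁻¹I + BKBᵀ.
  rw [hindep.charFun_map_add_eq_mul hBη.aemeasurable hmε, Pi.mul_apply, hBη.map_eq, hmap,
    charFun_multivariateGaussian_zero (mul_mul_transpose_posSemidef B hK),
    charFun_multivariateGaussian_zero (lowRankCov_posDef B hK hδ).posSemidef, charFun_pi]
  simp_rw [charFun_gaussianReal]
  rw [← Complex.exp_sum, ← Complex.exp_add]
  congr 1
  have h1 : t.ofLp ⬝ᵥ lowRankCov B K δ *ᵥ t.ofLp =
      δ⁻¹ * ∑ i, t.ofLp i ^ 2 + t.ofLp ⬝ᵥ (B * K * Bᵀ) *ᵥ t.ofLp := by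
    rw [lowRankCov, Matrix.add_mulVec, dotProduct_add, Matrix.smul_mulVec, Matrix.one_mulVec,
      dotProduct_smul, smul_eq_mul]
    simp [dotProduct, sq]
  have h2 : ((Real.toNNReal δ⁻¹ : ℝ≥0) : ℂ) = ((δ⁻¹ : ℝ) : ℂ) := by
    have : ((Real.toNNReal δ⁻¹ : ℝ≥0) : ℝ) = δ⁻¹ := Real.coe_toNNReal _ (inv_pos.2 hδ).le
    exact_mod_cast this
  rw [h1]
  push_cast
  rw [h2]
  simp only [mul_zero, zero_mul, zero_sub, Finset.sum_neg_distrib, ← Finset.sum_div,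
    ← Finset.mul_sum]
  push_cast
  ring

/-- The variance of the square of a standard normal variable. -/
def chiSqVar : ℝ := Var[fun y : ℝ => y ^ 2; gaussianReal 0 1]

lemma chiSqVar_nonneg : 0 ≤ chiSqVar := variance_nonneg _ _

lemma integral_sq_gaussianReal : ∫ y : ℝ, y ^ 2 ∂gaussianReal 0 1 = 1 := by
  have h := variance_of_integral_eq_zero (X := id) (μ := gaussianReal 0 1)
    (by fun_prop) (by simp)
  rw [variance_id_gaussianReal] at h
  simpa using h.symm

lemma memLp_mul_of_four {f g : Ω → ℝ} (hf : MemLp f 4 P) (hg : MemLp g 4 P) :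
    MemLp (fun ω => f ω * g ω) 2 P := by
  have : ENNReal.HolderTriple 4 4 2 := ⟨by
    rw [← ENNReal.toReal_eq_toReal_iff' (by simp) (by simp), ENNReal.toReal_add (by simp) (by simp)]
    norm_num⟩
  exact hg.mul hf

lemma memLp_sq_gaussianReal : MemLp (fun y : ℝ => y ^ 2) 2 (gaussianReal 0 1) := by
  have h := memLp_id_gaussianReal' (μ := 0) (v := 1) 4 (by norm_num)
  simpa [sq] using memLp_mul_of_four h h

/-- Second moment bound for a centred quadratic form in a standard Gaussian vector. -/
lemma lintegral_quadForm_stdGaussian {A : Matrix ι ι ℝ} (hA : A.IsHermitian) :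
    ∫⁻ x, ENNReal.ofReal ((x.ofLp ⬝ᵥ A *ᵥ x.ofLp - A.trace) ^ 2)
      ∂stdGaussian (EuclideanSpace ℝ ι) ≤
      ENNReal.ofReal (Fintype.card ι * ‖A‖ ^ 2 * chiSqVar) := by
  set b := hA.eigenvectorBasis with hb
  set ev := hA.eigenvalues with hev
  have hmeas : Measurable fun x : ι → ℝ => ∑ i, x i • b i := by fun_prop
  -- By rotation invariance the coordinates in an eigenbasis of A are independent standard normals,
  -- so the form becomes a weighted sum of independent squares, weighted by the eigenvalues.
  rw [stdGaussian_eq_map_pi_orthonormalBasis b, lintegral_map (by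
    refine ENNReal.measurable_ofReal.comp (Continuous.measurable ?_)
    fun_prop) hmeas]
  have hq : ∀ x : ι → ℝ, (∑ i, x i • b i).ofLp ⬝ᵥ A *ᵥ (∑ i, x i • b i).ofLp =
      ∑ i, ev i * x i ^ 2 := fun x => by
    have h1 : A *ᵥ (∑ i, x i • b i).ofLp = (∑ i, (ev i * x i) • b i).ofLp := by
      simp only [WithLp.ofLp_sum, WithLp.ofLp_smul, Matrix.mulVec_sum, Matrix.mulVec_smul]
      refine Finset.sum_congr rfl fun i _ => ?_
      rw [hA.mulVec_eigenvectorBasis i, smul_smul, mul_comm]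
    have h2 : (∑ i, x i • b i).ofLp ⬝ᵥ (∑ i, (ev i * x i) • b i).ofLp =
        inner ℝ (∑ i, (ev i * x i) • b i) (∑ i, x i • b i) := by
      rw [EuclideanSpace.inner_eq_star_dotProduct]; simp
    rw [h1, h2, b.orthonormal.inner_sum]
    refine Finset.sum_congr rfl fun i _ => ?_
    simp; ring
  simp_rw [hq]
  set μ := Measure.pi fun _ : ι => gaussianReal 0 1 with hμ
  set Z : (ι → ℝ) → ℝ := ∑ i, fun x : ι → ℝ => (fun y : ℝ => ev i * y ^ 2) (x i) with hZ
  have hmem : ∀ i, MemLp (fun y : ℝ => ev i * y ^ 2) 2 (gaussianReal 0 1) :=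
    fun i => memLp_sq_gaussianReal.const_mul _
  have hmem' : ∀ i, MemLp (fun x : ι → ℝ => (fun y : ℝ => ev i * y ^ 2) (x i)) 2 μ :=
    fun i => (hmem i).comp_measurePreserving (measurePreserving_eval _ i)
  have hZm : MemLp Z 2 μ := memLp_finsetSum' _ fun i _ => hmem' i
  have hint : ∫ x, Z x ∂μ = A.trace := by
    rw [trace_eq_sum_eig hA, hZ]
    simp only [Finset.sum_apply]
    rw [integral_finsetSum _ fun i _ => (hmem' i).integrable (by norm_num)]
    refine Finset.sum_congr rfl fun i _ => ?_
    rw [integral_const_mul]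
    have := integral_comp_eval (μ := fun _ : ι => gaussianReal 0 1) (i := i)
      (f := fun y : ℝ => y ^ 2) (by fun_prop)
    rw [this, integral_sq_gaussianReal, mul_one]
  have hvar : Var[Z; μ] = ∑ i, ev i ^ 2 * chiSqVar := by
    rw [hZ, variance_sum_pi hmem]
    exact Finset.sum_congr rfl fun i _ => variance_const_mul _ _ _
  have heq : ∫⁻ x, ENNReal.ofReal ((∑ i, ev i * x i ^ 2 - A.trace) ^ 2) ∂μ = evariance Z μ := by
    rw [evariance]
    refine lintegral_congr fun x => ?_
    rw [hint, hZ, ← enorm_pow, Real.enorm_eq_ofReal (sq_nonneg _)]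
    simp
  rw [heq, ← ofReal_variance hZm, hvar]
  refine ENNReal.ofReal_le_ofReal ?_
  calc ∑ i, ev i ^ 2 * chiSqVar ≤ ∑ _i : ι, ‖A‖ ^ 2 * chiSqVar := by
        refine Finset.sum_le_sum fun i _ => ?_
        have := eigenvalues_le_norm hA i
        have h2 : ev i ^ 2 ≤ ‖A‖ ^ 2 := by
          rw [← sq_abs]; exact pow_le_pow_left₀ (abs_nonneg _) this 2
        exact mul_le_mul_of_nonneg_right h2 chiSqVar_nonneg
    _ = _ := by simp; ring

/-- Second moment bound for a centred quadratic form in a Gaussian vector. -/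
lemma lintegral_quadForm {S F : Matrix ι ι ℝ} (hS : S.PosSemidef) (hF : Fᵀ = F)
    {X : Ω → EuclideanSpace ℝ ι} (hX : HasLaw X (multivariateGaussian 0 S) P) :
    ∫⁻ ω, ENNReal.ofReal (((X ω).ofLp ⬝ᵥ F *ᵥ (X ω).ofLp - (F * S).trace) ^ 2) ∂P ≤
      ENNReal.ofReal (Fintype.card ι * (‖F‖ * ‖S‖) ^ 2 * chiSqVar) := by
  -- With R = S^{1/2}, X has the law of Rg for a standard Gaussian g, and the form F in X becomes
  -- the form RFR in g.
  obtain ⟨R, hRt, hRR, hRn⟩ := exists_sqrt hS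
  have hg : HasLaw (fun x : EuclideanSpace ℝ ι => x) (multivariateGaussian 0 (1 : Matrix ι ι ℝ))
      (stdGaussian (EuclideanSpace ℝ ι)) := by
    rw [multivariateGaussian_zero_one]; exact HasLaw.id
  have hRg := hasLaw_mulVec_multivariateGaussian Matrix.PosSemidef.one R hg
  rw [mul_one, hRt, hRR] at hRg
  have hm : Measurable fun x : EuclideanSpace ℝ ι =>
      ENNReal.ofReal ((x.ofLp ⬝ᵥ F *ᵥ x.ofLp - (F * S).trace) ^ 2) :=
    ENNReal.measurable_ofReal.comp (Continuous.measurable (by fun_prop))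
  rw [hX.lintegral_comp (f := fun x : EuclideanSpace ℝ ι =>
      ENNReal.ofReal ((x.ofLp ⬝ᵥ F *ᵥ x.ofLp - (F * S).trace) ^ 2)) hm.aemeasurable,
    ← hRg.lintegral_comp (f := fun x : EuclideanSpace ℝ ι =>
      ENNReal.ofReal ((x.ofLp ⬝ᵥ F *ᵥ x.ofLp - (F * S).trace) ^ 2)) hm.aemeasurable]
  have hA : (R * F * R).IsHermitian := by
    rw [Matrix.IsHermitian, Matrix.conjTranspose_eq_transpose_of_trivial, Matrix.transpose_mul,
      Matrix.transpose_mul, hRt, hF, Matrix.mul_assoc]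
  have h := lintegral_quadForm_stdGaussian hA
  have htr : (R * F * R).trace = (F * S).trace := by
    rw [Matrix.mul_assoc, Matrix.trace_mul_comm, Matrix.mul_assoc, hRR]
  have hqf : ∀ x : ι → ℝ, (R *ᵥ x) ⬝ᵥ F *ᵥ (R *ᵥ x) = x ⬝ᵥ (R * F * R) *ᵥ x := fun x => by
    rw [← Matrix.mulVec_mulVec, ← Matrix.mulVec_mulVec, Matrix.dotProduct_mulVec x R,
      ← Matrix.mulVec_transpose, hRt]
  rw [htr] at h
  simp_rw [hqf]
  refine h.trans (ENNReal.ofReal_le_ofReal ?_)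
  have h3 : ‖R * F * R‖ ≤ ‖F‖ * ‖S‖ := by
    refine (norm_mul3_le _ _ _).trans (le_of_eq ?_)
    rw [← hRn]; ring
  have := chiSqVar_nonneg
  gcongr

/-- Even moments of a centred normal variable scale with the variance. -/
lemma lintegral_pow_gaussianReal (v : ℝ≥0) (r : ℕ) :
    ∫⁻ y : ℝ, ENNReal.ofReal ((y ^ 2) ^ r) ∂gaussianReal 0 v =
      ENNReal.ofReal (v ^ r) * ∫⁻ y : ℝ, ENNReal.ofReal ((y ^ 2) ^ r) ∂gaussianReal 0 1 := by
  have h := gaussianReal_map_const_mul (μ := 0) (v := 1) (NNReal.sqrt v : ℝ)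
  have hv : NNReal.mk (((NNReal.sqrt v : ℝ≥0) : ℝ) ^ 2) (sq_nonneg _) * 1 = v := by
    rw [mul_one]; ext; push_cast; exact Real.sq_sqrt v.2
  rw [mul_zero] at h
  change _ = gaussianReal 0 (NNReal.mk (((NNReal.sqrt v : ℝ≥0) : ℝ) ^ 2) (sq_nonneg _) * 1) at h
  rw [hv] at h
  rw [← h, lintegral_map (by fun_prop) (by fun_prop), ← lintegral_const_mul _ (by fun_prop)]
  refine lintegral_congr fun y => ?_
  rw [← ENNReal.ofReal_mul (by positivity), mul_pow, mul_pow]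
  congr 3
  exact_mod_cast NNReal.sq_sqrt v

/-- The even moments of a standard normal variable. -/
def gaussMoment (r : ℕ) : ℝ := ∫ y : ℝ, (y ^ 2) ^ r ∂gaussianReal 0 1

lemma lintegral_pow_gaussianReal_one (r : ℕ) :
    ∫⁻ y : ℝ, ENNReal.ofReal ((y ^ 2) ^ r) ∂gaussianReal 0 1 = ENNReal.ofReal (gaussMoment r) := by
  rw [gaussMoment, ofReal_integral_eq_lintegral_ofReal]
  · have h := (memLp_id_gaussianReal' (μ := 0) (v := 1) ((2 * r : ℕ) : ℝ≥0∞)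
      (ENNReal.natCast_ne_top _)).integrable_norm_pow'
    refine h.congr (ae_of_all _ fun y => ?_)
    simp [pow_mul]
  · exact ae_of_all _ fun y => by positivity

lemma gaussMoment_nonneg (r : ℕ) : 0 ≤ gaussMoment r := integral_nonneg fun y => by positivity

/-- The power-mean inequality (Σxᵢ²)^r ≤ n^(r-1) Σxᵢ^(2r) reduces to the coordinates, which are N(0,
Sᵢᵢ) with Sᵢᵢ ≤ ‖S‖. No independence of coordinates is needed, and the bound has the natural length
scale √(n‖S‖). -/
lemma lintegral_vnorm_pow_le {S : Matrix ι ι ℝ} (hS : S.PosSemidef)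
    {X : Ω → EuclideanSpace ℝ ι} (hX : HasLaw X (multivariateGaussian 0 S) P) {v : ℝ}
    (hv : ‖S‖ ≤ v) {r : ℕ} (hr : 0 < r) :
    ∫⁻ ω, ENNReal.ofReal (‖X ω‖ ^ (2 * r)) ∂P ≤
      ENNReal.ofReal ((Fintype.card ι * v) ^ r * gaussMoment r) := by
  obtain ⟨r, rfl⟩ : ∃ s, r = s + 1 := ⟨r - 1, by omega⟩
  have hv0 : 0 ≤ v := (norm_nonneg _).trans hv
  have hcoord : ∀ i, ∫⁻ ω, ENNReal.ofReal (((X ω).ofLp i ^ 2) ^ (r + 1)) ∂P ≤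
      ENNReal.ofReal (v ^ (r + 1) * gaussMoment (r + 1)) := fun i => by
    have h1 := (measurePreserving_eval_multivariateGaussian (μ := 0) hS (i := i)).comp_hasLaw hX
    have h2 := h1.lintegral_comp (f := fun y : ℝ => ENNReal.ofReal ((y ^ 2) ^ (r + 1)))
      (by fun_prop)
    refine (le_of_eq h2).trans ?_
    simp only [WithLp.ofLp_zero, Pi.zero_apply]
    rw [lintegral_pow_gaussianReal, lintegral_pow_gaussianReal_one,
      ← ENNReal.ofReal_mul (by positivity)]
    refine ENNReal.ofReal_le_ofReal ?_
    have h3 : ((S i i).toNNReal : ℝ) ≤ v := by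
      rw [Real.coe_toNNReal', max_le_iff]
      exact ⟨(le_abs_self _).trans ((abs_entry_le S i i).trans hv), hv0⟩
    have := gaussMoment_nonneg (r + 1)
    gcongr
  calc ∫⁻ ω, ENNReal.ofReal (‖X ω‖ ^ (2 * (r + 1))) ∂P
      ≤ ∫⁻ ω, ENNReal.ofReal ((Fintype.card ι : ℝ) ^ r) *
          ∑ i, ENNReal.ofReal (((X ω).ofLp i ^ 2) ^ (r + 1)) ∂P := by
        refine lintegral_mono fun ω => ?_
        rw [← ENNReal.ofReal_sum_of_nonneg (fun i _ => by positivity),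
          ← ENNReal.ofReal_mul (by positivity)]
        refine ENNReal.ofReal_le_ofReal ?_
        rw [pow_mul, EuclideanSpace.real_norm_sq_eq]
        exact pow_sum_le_card_mul_sum_pow (s := Finset.univ)
          (f := fun i => (X ω).ofLp i ^ 2) (fun i _ => sq_nonneg _) r
    _ = ENNReal.ofReal ((Fintype.card ι : ℝ) ^ r) *
          ∑ i, ∫⁻ ω, ENNReal.ofReal (((X ω).ofLp i ^ 2) ^ (r + 1)) ∂P := by
        rw [lintegral_const_mul'' _ (by
          have := hX.aemeasurable; fun_prop), lintegral_finsetSum' _ fun i _ => by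
          have := hX.aemeasurable; fun_prop]
    _ ≤ ENNReal.ofReal ((Fintype.card ι : ℝ) ^ r) *
          ∑ _i : ι, ENNReal.ofReal (v ^ (r + 1) * gaussMoment (r + 1)) := by
        gcongr with i; exact hcoord i
    _ = _ := by
        rw [Finset.sum_const, Finset.card_univ, nsmul_eq_mul, ← ENNReal.ofReal_natCast,
          ← ENNReal.ofReal_mul (by positivity), ← ENNReal.ofReal_mul (by positivity)]
        congr 1; ring

/-- Markov's inequality for a moment of order 2r. The free choice of r is what chaining requires,
since its exponent is dictated by the covering number of the parameter set. -/
lemma measure_lt_norm_le {S : Matrix ι ι ℝ} (hS : S.PosSemidef)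
    {X : Ω → EuclideanSpace ℝ ι} (hX : HasLaw X (multivariateGaussian 0 S) P) {v : ℝ}
    (hv : ‖S‖ ≤ v) {r : ℕ} (hr : 0 < r) {b : ℝ} (hb : 0 < b) :
    P {ω | b < ‖X ω‖} ≤
      ENNReal.ofReal ((Fintype.card ι * v) ^ r * gaussMoment r / b ^ (2 * r)) := by
  have hmX := hX.aemeasurable
  have h0 : ENNReal.ofReal (b ^ (2 * r)) ≠ 0 := by simp; positivity
  have h := meas_ge_le_lintegral_div (μ := P)
    (f := fun ω => ENNReal.ofReal (‖X ω‖ ^ (2 * r))) (by fun_prop) h0 ENNReal.ofReal_ne_top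
  refine (measure_mono fun ω hω => ?_).trans (h.trans ?_)
  · exact ENNReal.ofReal_le_ofReal (pow_le_pow_left₀ hb.le (le_of_lt hω) _)
  · rw [ENNReal.ofReal_div_of_pos (by positivity)]
    exact ENNReal.div_le_div_right (lintegral_vnorm_pow_le hS hX hv hr) _

end GaussianVectors

/-! ### From bounded partial derivatives to Lipschitz designs -/

section Regularity

open scoped Matrix.Norms.L2Operator

variable {q : ℕ} {ι κ : Type*} [Fintype ι] [Fintype κ] [DecidableEq ι] [DecidableEq κ]

lemma dotProduct_mulVec_eq_sum (A : Matrix ι κ ℝ) (u : ι → ℝ) (v : κ → ℝ) :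
    u ⬝ᵥ A *ᵥ v = ∑ i, ∑ j, u i * v j * A i j := by
  simp only [dotProduct, Matrix.mulVec, Finset.mul_sum]
  exact Finset.sum_congr rfl fun i _ => Finset.sum_congr rfl fun j _ => by ring

lemma fderiv_eq_sum_partialDeriv {ι' : Type*} [Fintype ι'] [DecidableEq ι']
    (f : EuclideanSpace ℝ ι' → ℝ) (x h : EuclideanSpace ℝ ι') :
    fderiv ℝ f x h = ∑ a, h a * partialDeriv a f x := by
  have : h = ∑ a, h a • EuclideanSpace.single a (1 : ℝ) := by
    ext a; simp [Finset.sum_apply, Pi.single_apply]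
  conv_lhs => rw [this]
  simp [map_sum, partialDeriv]

/-- A matrix function whose first partial derivatives are bounded in operator norm is Lipschitz. -/
lemma norm_sub_le_of_matPartial {A : EuclideanSpace ℝ (Fin q) → Matrix ι κ ℝ}
    {U Θ : Set (EuclideanSpace ℝ (Fin q))} (hU : IsOpen U) (hΘ : Convex ℝ Θ) (hΘU : Θ ⊆ U)
    (hA : ∀ i j, DifferentiableOn ℝ (fun t => A t i j) U) {M : ℝ} (hM : 0 ≤ M)
    (hb : ∀ a, ∀ θ ∈ Θ, ‖matPartial a A θ‖ ≤ M) {θ θ' : EuclideanSpace ℝ (Fin q)}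
    (hθ : θ ∈ Θ) (hθ' : θ' ∈ Θ) : ‖A θ - A θ'‖ ≤ q * M * dist θ θ' := by
  refine norm_le_of_bilin _ (by positivity) fun u v => ?_
  -- Pairing with fixed u and v reduces to a scalar function, for which the mean value inequality
  -- holds on the convex set. The factor q counts the partial derivatives; the size of the matrix
  -- does not enter.
  set f : EuclideanSpace ℝ (Fin q) → ℝ := fun t => ∑ i, ∑ j, u i * v j * A t i j with hf
  have hd : ∀ x ∈ Θ, ∀ i j, DifferentiableAt ℝ (fun t => A t i j) x := fun x hx i j =>
    (hA i j).differentiableAt (hU.mem_nhds (hΘU hx))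
  have hfd : ∀ x ∈ Θ, DifferentiableAt ℝ f x := fun x hx =>
    DifferentiableAt.fun_sum fun i _ => DifferentiableAt.fun_sum fun j _ => (hd x hx i j).const_mul _
  have hpd : ∀ x ∈ Θ, ∀ a, partialDeriv a f x = u ⬝ᵥ matPartial a A x *ᵥ v := fun x hx a => by
    rw [dotProduct_mulVec_eq_sum, partialDeriv, hf,
      fderiv_fun_sum fun i _ => DifferentiableAt.fun_sum fun j _ => (hd x hx i j).const_mul _]
    simp only [sum_apply]
    refine Finset.sum_congr rfl fun i _ => ?_
    rw [fderiv_fun_sum fun j _ => (hd x hx i j).const_mul _]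
    simp only [sum_apply]
    refine Finset.sum_congr rfl fun j _ => ?_
    rw [fderiv_const_mul (hd x hx i j)]
    rfl
  have hbound : ∀ x ∈ Θ, ‖fderiv ℝ f x‖ ≤ q * M * vnorm u * vnorm v := fun x hx => by
    have hu := vnorm_nonneg u
    have hv := vnorm_nonneg v
    refine ContinuousLinearMap.opNorm_le_bound _ (by positivity) fun h => ?_
    rw [fderiv_eq_sum_partialDeriv, Real.norm_eq_abs]
    calc |∑ a, h a * partialDeriv a f x| ≤ ∑ a, |h a * partialDeriv a f x| :=
          Finset.abs_sum_le_sum_abs _ _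
      _ ≤ ∑ _a : Fin q, ‖h‖ * (M * vnorm u * vnorm v) := by
          refine Finset.sum_le_sum fun a _ => ?_
          rw [abs_mul]
          refine mul_le_mul (PiLp.norm_apply_le h a) ?_ (abs_nonneg _) (norm_nonneg _)
          rw [hpd x hx]
          refine (abs_dotProduct_mulVec_le _ _ _).trans ?_
          have := hb a x hx
          gcongr
      _ = _ := by simp; ring
  have h1 := hΘ.norm_image_sub_le_of_norm_fderiv_le hfd hbound hθ' hθ
  have h2 : f θ - f θ' = u ⬝ᵥ (A θ - A θ') *ᵥ v := by
    rw [Matrix.sub_mulVec, dotProduct_sub, dotProduct_mulVec_eq_sum, dotProduct_mulVec_eq_sum]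
  rw [h2, Real.norm_eq_abs, ← dist_eq_norm] at h1
  calc _ ≤ _ := h1
    _ = _ := by ring

variable {Loc : Type*}

/-- The basis matrix and the coefficient covariance of a design are bounded and Lipschitz on a
parameter set. -/
structure IsRegularOn (D : LowRankDesign q Loc) (Θ : Set (EuclideanSpace ℝ (Fin q)))
    (M : ℝ) : Prop where
  normB : ∀ θ ∈ Θ, ‖D.B θ‖ ≤ M
  normK : ∀ θ ∈ Θ, ‖D.K θ‖ ≤ M
  lipB : ∀ θ ∈ Θ, ∀ θ' ∈ Θ, ‖D.B θ - D.B θ'‖ ≤ M * dist θ θ'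
  lipK : ∀ θ ∈ Θ, ∀ θ' ∈ Θ, ‖D.K θ - D.K θ'‖ ≤ M * dist θ θ'

/-- The mean value inequality runs along segments, which is why the derivative bounds are taken on
the convex hull although the conclusion concerns Θ only. -/
lemma SmoothBounded.exists_bound {ι κ : ℕ → Type*} [∀ k, Fintype (ι k)] [∀ k, Fintype (κ k)]
    [∀ k, DecidableEq (ι k)] [∀ k, DecidableEq (κ k)] {Θ : Set (EuclideanSpace ℝ (Fin q))}
    {A : ∀ k, EuclideanSpace ℝ (Fin q) → Matrix (ι k) (κ k) ℝ}
    (h : SmoothBounded (convexHull ℝ Θ) A) :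
    ∃ M : ℝ, 0 ≤ M ∧ ∀ᶠ k in atTop, (∀ θ ∈ Θ, ‖A k θ‖ ≤ M) ∧
      ∀ θ ∈ Θ, ∀ θ' ∈ Θ, ‖A k θ - A k θ'‖ ≤ M * dist θ θ' := by
  obtain ⟨hU, ⟨M₀, hM₀⟩, h1, -, -⟩ := h
  choose M₁ hM₁ using h1
  set M' := ∑ a, |M₁ a| with hM'
  have hM'0 : 0 ≤ M' := Finset.sum_nonneg fun _ _ => abs_nonneg _
  refine ⟨|M₀| + q * M', by positivity, ?_⟩
  filter_upwards [hM₀, eventually_all.2 hM₁] with k hk0 hk1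
  refine ⟨fun θ hθ => ?_, fun θ hθ θ' hθ' => ?_⟩
  · have := hk0 θ (subset_convexHull ℝ Θ hθ)
    rw [opNorm_eq] at this
    have h3 : 0 ≤ q * M' := by positivity
    linarith [le_abs_self M₀]
  · obtain ⟨U, hUo, hΘU, hdiff⟩ := hU k
    have := norm_sub_le_of_matPartial hUo (convex_convexHull ℝ Θ) hΘU (fun i j => (hdiff i j).1)
      hM'0 (fun a θ hθ => by
        have h2 := hk1 a θ hθ
        rw [opNorm_eq] at h2
        exact (h2.trans (le_abs_self _)).trans
          (Finset.single_le_sum (f := fun a => |M₁ a|) (fun _ _ => abs_nonneg _)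
            (Finset.mem_univ a)))
      (subset_convexHull ℝ Θ hθ) (subset_convexHull ℝ Θ hθ')
    refine this.trans ?_
    gcongr
    linarith [abs_nonneg M₀]

lemma exists_isRegularOn {D : ℕ → LowRankDesign q Loc} {Θ : Set (EuclideanSpace ℝ (Fin q))}
    (hB : SmoothBounded (convexHull ℝ Θ) fun k => (D k).B)
    (hK : SmoothBounded (convexHull ℝ Θ) fun k => (D k).K) :
    ∃ M : ℝ, 1 ≤ M ∧ ∀ᶠ k in atTop, IsRegularOn (D k) Θ M := by
  obtain ⟨M₁, h1, hM₁⟩ := hB.exists_bound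
  obtain ⟨M₂, h2, hM₂⟩ := hK.exists_bound
  refine ⟨1 + M₁ + M₂, by linarith, ?_⟩
  filter_upwards [hM₁, hM₂] with k hk1 hk2
  refine ⟨fun θ hθ => ?_, fun θ hθ => ?_, fun θ hθ θ' hθ' => ?_, fun θ hθ θ' hθ' => ?_⟩
  · linarith [hk1.1 θ hθ]
  · linarith [hk2.1 θ hθ]
  · refine (hk1.2 θ hθ θ' hθ').trans ?_
    gcongr; linarith
  · refine (hk2.2 θ hθ θ' hθ').trans ?_
    gcongr; linarith

end Regularity

/-! ### Projected errors B(θ)ᵀe: modulus of continuity and uniform law of large numbers -/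

section UniformLimits

open scoped Matrix.Norms.L2Operator ENNReal

lemma abs_bilin_sub_le {ι κ : Type*} [Fintype ι] [Fintype κ] [DecidableEq ι] [DecidableEq κ]
    (F F' : Matrix ι κ ℝ) (u u' : ι → ℝ) (v v' : κ → ℝ) :
    |u ⬝ᵥ F *ᵥ v - u' ⬝ᵥ F' *ᵥ v'| ≤ ‖F - F'‖ * vnorm u * vnorm v +
      ‖F'‖ * (vnorm (u - u') * vnorm v + vnorm u' * vnorm (v - v')) := by
  have h : u ⬝ᵥ F *ᵥ v - u' ⬝ᵥ F' *ᵥ v' = u ⬝ᵥ (F - F') *ᵥ v +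
      ((u - u') ⬝ᵥ F' *ᵥ v + u' ⬝ᵥ F' *ᵥ (v - v')) := by
    rw [Matrix.sub_mulVec, Matrix.mulVec_sub, dotProduct_sub, dotProduct_sub, sub_dotProduct]; ring
  rw [h]
  have h1 := abs_dotProduct_mulVec_le (F - F') u v
  have h2 := abs_dotProduct_mulVec_le F' (u - u') v
  have h3 := abs_dotProduct_mulVec_le F' u' (v - v')
  have h4 := abs_add_le (u ⬝ᵥ (F - F') *ᵥ v) ((u - u') ⬝ᵥ F' *ᵥ v + u' ⬝ᵥ F' *ᵥ (v - v'))
  have h5 := abs_add_le ((u - u') ⬝ᵥ F' *ᵥ v) (u' ⬝ᵥ F' *ᵥ (v - v'))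
  linarith

variable {q : ℕ} {Loc Ω : Type*} [MeasurableSpace Ω] {P : Measure Ω}
  {D : ℕ → LowRankDesign q Loc} {Θ : Set (EuclideanSpace ℝ (Fin q))} {M δ₀ : ℝ}
  {θ₀ : EuclideanSpace ℝ (Fin q)} {e : ∀ k, Ω → EuclideanSpace ℝ (D k).Obs}

lemma LowRankDesign.C_eq (D : LowRankDesign q Loc) (δ : ℝ) (θ : EuclideanSpace ℝ (Fin q)) :
    D.C δ θ = lowRankCov (D.B θ) (D.K θ) δ := rfl

lemma LowRankDesign.card_obs (D : LowRankDesign q Loc) : Fintype.card D.Obs = D.N := by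
  simp [LowRankDesign.N]

/-- The projected errors `B(θ)ᵀ e`. -/
def projErr (D : LowRankDesign q Loc) (θ : EuclideanSpace ℝ (Fin q))
    (e : EuclideanSpace ℝ D.Obs) : Fin D.m → ℝ := (D.B θ)ᵀ *ᵥ e.ofLp

lemma projErr_sub (D : LowRankDesign q Loc) (θ θ' : EuclideanSpace ℝ (Fin q))
    (e : EuclideanSpace ℝ D.Obs) :
    projErr D θ e - projErr D θ' e = (D.B θ - D.B θ')ᵀ *ᵥ e.ofLp := by
  rw [projErr, projErr, Matrix.transpose_sub, Matrix.sub_mulVec]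

lemma norm_sandwich_le {ι κ : Type*} [Fintype ι] [Fintype κ] [DecidableEq ι] [DecidableEq κ]
    {A : Matrix ι κ ℝ} {S : Matrix ι ι ℝ} {x y : ℝ} (hA : ‖A‖ ≤ x) (hS : ‖S‖ ≤ y) :
    ‖Aᵀ * S * A‖ ≤ x ^ 2 * y := by
  have := l2norm_mul_le_of_le (l2norm_mul_le_of_le ((norm_transpose A).trans_le hA) hS) hA
  exact this.trans (le_of_eq (by ring))

/-- On events of probability close to one, the normalized projected errors are bounded and
equicontinuous, uniformly along the sequence of models. -/
lemma exists_projErr_modulus (hΘ : IsCompact Θ) (hθ₀ : θ₀ ∈ Θ) (hδ₀ : 0 < δ₀) (hM : 0 ≤ M)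
    (hreg : ∀ᶠ k in atTop, IsRegularOn (D k) Θ M) (hK : ∀ k, ((D k).K θ₀).PosSemidef)
    (hm : ∀ᶠ k in atTop, 0 < (D k).m)
    (he : ∀ k, HasLaw (e k) (multivariateGaussian 0 ((D k).C δ₀ θ₀)) P)
    {ε : ℝ≥0∞} (hε : 0 < ε) :
    ∃ (A : ℝ) (G : ℕ → Ω → Prop), 0 < A ∧ (∀ᶠ k in atTop, P {ω | ¬ G k ω} ≤ ε) ∧
      (∀ k ω, G k ω → ∀ θ ∈ Θ, vnorm (projErr (D k) θ (e k ω)) ≤ A * √(D k).m) ∧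
      ∀ ρ > 0, ∃ h > 0, ∀ k ω, G k ω → ∀ s ∈ Θ, ∀ t ∈ Θ, dist s t < h →
        vnorm (projErr (D k) s (e k ω) - projErr (D k) t (e k ω)) ≤ ρ * √(D k).m := by
  -- A Lipschitz bound through |e| would be of order √N. Instead the increments are treated as
  -- m-dimensional Gaussian vectors with covariance of norm at most (M·dist)²Λ, so their scale is
  -- dist·√m.
  obtain ⟨R, r, C, hR, hr, hΘR, hchain⟩ := exists_chaining hΘ.isBounded P
  set Λ := δ₀⁻¹ + M * M * M with hΛ
  have hΛ0 : 0 ≤ Λ := by positivity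
  set g := (M ^ 2 * Λ) ^ r * gaussMoment r with hg
  have hlim : ∀ c : ℝ, Tendsto (fun A : ℝ => ENNReal.ofReal (c / A ^ (2 * r))) atTop (𝓝 0) :=
    fun c => by
      have h1 : Tendsto (fun A : ℝ => c / A ^ (2 * r)) atTop (𝓝 0) :=
        tendsto_const_nhds.div_atTop (tendsto_pow_atTop (by omega))
      simpa using ENNReal.tendsto_ofReal h1
  have hε2 : 0 < ε / 2 := ENNReal.half_pos hε.ne'
  obtain ⟨A, hA1, hA2, hA0⟩ := ((ENNReal.tendsto_nhds_zero.1 (hlim (C * g)) _ hε2).and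
    ((ENNReal.tendsto_nhds_zero.1 (hlim g) _ hε2).and (eventually_gt_atTop 0))).exists
  -- 6A is A at the true parameter plus 5A for an increment at level 0, whose radius R covers all of
  -- Θ. One half of ε is spent on each of the two conditions.
  refine ⟨6 * A, fun k ω => vnorm (projErr (D k) θ₀ (e k ω)) ≤ A * √(D k).m ∧
    ∀ l : ℕ, ∀ s ∈ Θ, ∀ t ∈ Θ, dist s t ≤ R / 4 ^ l →
      vnorm (projErr (D k) s (e k ω) - projErr (D k) t (e k ω)) ≤ 5 * (A * √(D k).m) / 2 ^ l,
    by positivity, ?_, ?_, ?_⟩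
  · filter_upwards [hreg, hm] with k hk hmk
    have hm0 : (0 : ℝ) < (D k).m := Nat.cast_pos.2 hmk
    have hsm : 0 < √((D k).m : ℝ) := Real.sqrt_pos.2 hm0
    have hsq : √((D k).m : ℝ) ^ (2 * r) = ((D k).m : ℝ) ^ r := by
      rw [pow_mul, Real.sq_sqrt hm0.le]
    have hCn : ‖(D k).C δ₀ θ₀‖ ≤ Λ :=
      norm_lowRankCov_le (hk.normB _ hθ₀) (hk.normK _ hθ₀) hδ₀ le_rfl
    have hCp : ((D k).C δ₀ θ₀).PosSemidef := (lowRankCov_posDef _ (hK k) hδ₀).posSemidef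
    have htail : ∀ (Bd : Matrix (D k).Obs (Fin (D k).m) ℝ) (y b : ℝ), ‖Bd‖ ≤ y → 0 < b →
        P {ω | b < ‖(WithLp.toLp 2 (Bdᵀ *ᵥ (e k ω).ofLp) : EuclideanSpace ℝ (Fin (D k).m))‖} ≤
          ENNReal.ofReal (((D k).m * (y ^ 2 * Λ)) ^ r * gaussMoment r / b ^ (2 * r)) :=
      fun Bd y b hy hb => by
        have h1 := hasLaw_mulVec_multivariateGaussian hCp Bdᵀ (he k)
        have h2 := measure_lt_norm_le (mul_mul_transpose_posSemidef Bdᵀ hCp) h1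
          (v := y ^ 2 * Λ)
          (by rw [Matrix.transpose_transpose]; exact norm_sandwich_le hy hCn) hr hb
        simpa using h2
    have hch := hchain (EuclideanSpace ℝ (Fin (D k).m))
      (fun t ω => WithLp.toLp 2 (projErr (D k) t (e k ω))) (((D k).m : ℝ) ^ r * g)
      (by have := gaussMoment_nonneg r; positivity)
      -- Chaining asks only for path continuity here, so a Lipschitz constant proportional to |e|,
      -- however large, is harmless.
      (fun ω => by
        refine LipschitzOnWith.continuousOn (K := Real.toNNReal (M * ‖e k ω‖)) ?_
        refine LipschitzOnWith.of_dist_le_mul fun s hs t ht => ?_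
        rw [Real.coe_toNNReal _ (by positivity), dist_eq_norm]
        change vnorm (projErr (D k) s (e k ω) - projErr (D k) t (e k ω)) ≤ _
        rw [projErr_sub]
        refine (vnorm_mulVec_le _ _).trans ?_
        rw [norm_transpose]
        have := hk.lipB s hs t ht
        change _ * ‖e k ω‖ ≤ _
        calc _ ≤ M * dist s t * ‖e k ω‖ := by gcongr
          _ = _ := by ring)
      (fun s hs t ht b hb => by
        have h1 := htail ((D k).B s - (D k).B t) (M * dist s t) b (hk.lipB s hs t ht) hb
        have h2 : ∀ ω, (WithLp.toLp 2 (projErr (D k) s (e k ω)) -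
            WithLp.toLp 2 (projErr (D k) t (e k ω)) : EuclideanSpace ℝ (Fin (D k).m)) =
            WithLp.toLp 2 (((D k).B s - (D k).B t)ᵀ *ᵥ (e k ω).ofLp) := fun ω => by
          rw [← projErr_sub]; rfl
        simp_rw [h2]
        refine h1.trans (le_of_eq ?_)
        congr 1
        rw [hg, div_pow, mul_pow, mul_pow, mul_pow, mul_pow, ← pow_mul, ← pow_mul, mul_pow,
          ← pow_mul]
        ring)
      (A * √(D k).m) (by positivity)
    have h0 := htail ((D k).B θ₀) M (A * √(D k).m) (hk.normB _ hθ₀) (by positivity)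
    have e1 : C * (((D k).m : ℝ) ^ r * g) / (A * √(D k).m) ^ (2 * r) = C * g / A ^ (2 * r) := by
      rw [mul_pow, hsq]
      have : ((D k).m : ℝ) ^ r ≠ 0 := by positivity
      field_simp
    have e2 : ((D k).m * (M ^ 2 * Λ)) ^ r * gaussMoment r / (A * √(D k).m) ^ (2 * r) =
        g / A ^ (2 * r) := by
      rw [mul_pow, mul_pow _ (√_), hsq, hg]
      have : ((D k).m : ℝ) ^ r ≠ 0 := by positivity
      field_simp
    rw [e1] at hch
    rw [e2] at h0
    calc _ ≤ _ := measure_mono (fun ω hω => by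
            rw [Set.mem_ofPred_eq, not_and_or] at hω
            exact hω.imp (fun h => not_le.1 h) (fun h => h))
      _ ≤ _ := measure_union_le _ _
      _ ≤ ε / 2 + ε / 2 := add_le_add (h0.trans hA2) (hch.trans hA1)
      _ = ε := ENNReal.add_halves ε
  · rintro k ω ⟨h0, h1⟩ θ hθ
    have h2 := h1 0 θ hθ θ₀ hθ₀ (by simpa using hΘR θ hθ θ₀ hθ₀)
    have h3 := vnorm_add_le (projErr (D k) θ (e k ω) - projErr (D k) θ₀ (e k ω))
      (projErr (D k) θ₀ (e k ω))
    rw [sub_add_cancel] at h3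
    rw [pow_zero, div_one] at h2
    linarith
  · intro ρ hρ
    have h1 : Tendsto (fun l : ℕ => 5 * A * (1 / 2 : ℝ) ^ l) atTop (𝓝 0) := by
      simpa using (tendsto_pow_atTop_nhds_zero_of_lt_one (r := (1 / 2 : ℝ)) (by norm_num)
        (by norm_num)).const_mul (5 * A)
    obtain ⟨l, hl⟩ := (h1.eventually (gt_mem_nhds hρ)).exists
    refine ⟨R / 4 ^ l, by positivity, fun k ω hG s hs t ht hst => ?_⟩
    refine (hG.2 l s hs t ht hst.le).trans ?_
    have : 5 * (A * √((D k).m : ℝ)) / 2 ^ l = 5 * A * (1 / 2) ^ l * √((D k).m : ℝ) := by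
      rw [one_div, inv_pow]; ring
    rw [this]
    exact mul_le_mul_of_nonneg_right hl.le (Real.sqrt_nonneg _)

/-- The deterministic half of equicontinuity. The vectors have length O(√m), so the forms vary on
the scale m; the centring traces are those of m×m Lipschitz matrices and vary on the same scale. -/
lemma abs_quadForm_sub_le {D : LowRankDesign q Loc} (hk : IsRegularOn D Θ M) (hM : 0 ≤ M)
    {s t : EuclideanSpace ℝ (Fin q)} (hs : s ∈ Θ) (ht : t ∈ Θ) {C : Matrix D.Obs D.Obs ℝ} {Λ : ℝ}
    (hC : ‖C‖ ≤ Λ) {Fs Ft : Matrix (Fin D.m) (Fin D.m) ℝ} {MF LF d A κ : ℝ} (hFs : ‖Fs‖ ≤ MF)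
    (hFt : ‖Ft‖ ≤ MF) (hF : ‖Fs - Ft‖ ≤ LF * d) (hd : dist s t ≤ d) {u v : Fin D.m → ℝ}
    (hu : vnorm u ≤ A * √D.m) (hv : vnorm v ≤ A * √D.m) (huv : vnorm (u - v) ≤ κ * √D.m) :
    |(u ⬝ᵥ Fs *ᵥ u - (Fs * ((D.B s)ᵀ * C * D.B s)).trace) -
      (v ⬝ᵥ Ft *ᵥ v - (Ft * ((D.B t)ᵀ * C * D.B t)).trace)| ≤
      ((LF * A ^ 2 + (LF * (M ^ 2 * Λ) + MF * (2 * M ^ 2 * Λ))) * d + 2 * MF * A * κ) * D.m := by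
  have hm0 : (0 : ℝ) ≤ D.m := Nat.cast_nonneg _
  have hsm : √(D.m : ℝ) * √(D.m : ℝ) = D.m := Real.mul_self_sqrt hm0
  have hq := abs_bilin_sub_le Fs Ft u v u v
  have n1 := vnorm_nonneg u
  have n2 := vnorm_nonneg v
  have n3 := vnorm_nonneg (u - v)
  have nF := norm_nonneg (Fs - Ft)
  have nF2 := norm_nonneg Ft
  have hq2 : |u ⬝ᵥ Fs *ᵥ u - v ⬝ᵥ Ft *ᵥ v| ≤ (LF * A ^ 2 * d + 2 * MF * A * κ) * D.m := by
    refine hq.trans ?_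
    calc _ ≤ (LF * d) * (A * √(D.m : ℝ)) * (A * √(D.m : ℝ)) +
          MF * ((κ * √(D.m : ℝ)) * (A * √(D.m : ℝ)) +
            (A * √(D.m : ℝ)) * (κ * √(D.m : ℝ))) := by
          have a1 := n1.trans hu
          have a2 := n2.trans hv
          have a3 := n3.trans huv
          have a4 := nF.trans hF
          have a5 := nF2.trans hFt
          gcongr
      _ = (LF * A ^ 2 * d + 2 * MF * A * κ) * (√(D.m : ℝ) * √(D.m : ℝ)) := by ring
      _ = _ := by rw [hsm]
  set Ws := (D.B s)ᵀ * C * D.B s with hWs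
  set Wt := (D.B t)ᵀ * C * D.B t with hWt
  have hBst : ‖D.B s - D.B t‖ ≤ M * d := (hk.lipB _ hs _ ht).trans (by gcongr)
  have hWst : ‖Ws - Wt‖ ≤ (M * Λ * M + M * Λ * M) * d := by
    have h1 : ‖(D.B s)ᵀ * C - (D.B t)ᵀ * C‖ ≤ (M * Λ) * d := by
      rw [← Matrix.sub_mul, ← Matrix.transpose_sub]
      exact (l2norm_mul_le_of_le ((norm_transpose _).trans_le hBst) hC).trans (le_of_eq (by ring))
    exact norm_mul_sub_mul_le (l2norm_mul_le_of_le ((norm_transpose _).trans_le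
      (hk.normB _ hs)) hC) (hk.normB _ ht) h1 hBst
  have hWt' : ‖Wt‖ ≤ M ^ 2 * Λ := norm_sandwich_le (hk.normB _ ht) hC
  have htr : |(Fs * Ws).trace - (Ft * Wt).trace| ≤
      D.m * ((LF * (M ^ 2 * Λ) + MF * (2 * M ^ 2 * Λ)) * d) := by
    rw [← Matrix.trace_sub]
    refine (abs_trace_le _).trans ?_
    rw [Fintype.card_fin]
    refine mul_le_mul_of_nonneg_left ?_ hm0
    exact (norm_mul_sub_mul_le hFs hWt' hF hWst).trans (le_of_eq (by ring))
  have hQ : (u ⬝ᵥ Fs *ᵥ u - (Fs * Ws).trace) - (v ⬝ᵥ Ft *ᵥ v - (Ft * Wt).trace) =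
      (u ⬝ᵥ Fs *ᵥ u - v ⬝ᵥ Ft *ᵥ v) - ((Fs * Ws).trace - (Ft * Wt).trace) := by ring
  rw [hQ]
  refine (abs_sub _ _).trans ((add_le_add hq2 htr).trans (le_of_eq ?_))
  ring

/-- Each of two error terms gets half of the budget ρ; the +1 in the denominators covers vanishing
coefficients. -/
lemma mul_add_mul_le_of_lt {c₁ c₂ d κ ρ : ℝ} (hc₁ : 0 ≤ c₁) (hc₂ : 0 ≤ c₂) (hρ : 0 < ρ)
    (hd : d ≤ ρ / 2 / (c₁ + 1)) (hκ : κ ≤ ρ / 2 / (c₂ + 1)) : c₁ * d + c₂ * κ ≤ ρ := by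
  have h1 : c₁ * d ≤ c₁ * (ρ / 2 / (c₁ + 1)) := by gcongr
  have h2 : c₂ * κ ≤ c₂ * (ρ / 2 / (c₂ + 1)) := by gcongr
  have h3 : ∀ c : ℝ, 0 ≤ c → c * (ρ / 2 / (c + 1)) ≤ ρ / 2 := fun c hc => by
    rw [mul_div_assoc', div_le_iff₀ (by positivity)]
    nlinarith
  linarith [h3 c₁ hc₁, h3 c₂ hc₂]

/-- Uniform law of large numbers for quadratic forms in the projected errors. -/
lemma eventually_whp_quadForm {S : Set ℝ} (hS : IsCompact S) (hΘ : IsCompact Θ) (hθ₀ : θ₀ ∈ Θ)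
    (hδ₀ : 0 < δ₀) (hM : 0 ≤ M)
    (hreg : ∀ᶠ k in atTop, IsRegularOn (D k) Θ M) (hK : ∀ k, ((D k).K θ₀).PosSemidef)
    (hm : Tendsto (fun k => (D k).m) atTop atTop)
    (he : ∀ k, HasLaw (e k) (multivariateGaussian 0 ((D k).C δ₀ θ₀)) P)
    (F : ∀ k, ℝ × EuclideanSpace ℝ (Fin q) → Matrix (Fin (D k).m) (Fin (D k).m) ℝ)
    {MF LF : ℝ} (hMF : 0 ≤ MF) (hLF : 0 ≤ LF)
    (hF : ∀ᶠ k in atTop, ∀ t ∈ S ×ˢ Θ, (F k t)ᵀ = F k t ∧ ‖F k t‖ ≤ MF ∧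
      ∀ t' ∈ S ×ˢ Θ, ‖F k t - F k t'‖ ≤ LF * dist t t')
    {ρ : ℝ} (hρ : 0 < ρ) :
    ∀ᶠ x in whp P, ∀ t ∈ S ×ˢ Θ,
      |projErr (D x.1) t.2 (e x.1 x.2) ⬝ᵥ F x.1 t *ᵥ projErr (D x.1) t.2 (e x.1 x.2) -
        (F x.1 t * (((D x.1).B t.2)ᵀ * (D x.1).C δ₀ θ₀ * (D x.1).B t.2)).trace| ≤
          ρ * (D x.1).m := by
  set Λ := δ₀⁻¹ + M * M * M with hΛ
  have hΛ0 : 0 ≤ Λ := by positivity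
  have hmR : Tendsto (fun k => ((D k).m : ℝ)) atTop atTop := tendsto_natCast_atTop_atTop.comp hm
  have hmpos : ∀ᶠ k in atTop, 0 < (D k).m := hm.eventually_gt_atTop 0
  have hCn : ∀ k, IsRegularOn (D k) Θ M → ‖(D k).C δ₀ θ₀‖ ≤ Λ := fun k hk =>
    norm_lowRankCov_le (hk.normB _ hθ₀) (hk.normK _ hθ₀) hδ₀ le_rfl
  have hCp : ∀ k, ((D k).C δ₀ θ₀).PosSemidef := fun k =>
    (lowRankCov_posDef _ (hK k) hδ₀).posSemidef
  let Q : ℕ → ℝ × EuclideanSpace ℝ (Fin q) → Ω → ℝ := fun k t ω =>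
    (projErr (D k) t.2 (e k ω) ⬝ᵥ F k t *ᵥ projErr (D k) t.2 (e k ω) -
        (F k t * (((D k).B t.2)ᵀ * (D k).C δ₀ θ₀ * (D k).B t.2)).trace) / (D k).m
  -- After division by m the variance at a fixed parameter is O(1/m), which gives pointwise
  -- convergence by Chebyshev; equicontinuity comes from the modulus of the projected errors.
  have key : ∀ᶠ x in whp P, ∀ t ∈ S ×ˢ Θ, |Q x.1 t x.2| ≤ ρ := by
    refine eventually_whp_forall_le (hS.prod hΘ) Q ?_ ?_ hρ
    · intro t ht ρ' hρ'
      refine eventually_whp_of_lintegral_sq (Z := fun k ω => Q k t ω)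
        (c := fun k => ((MF * (M ^ 2 * Λ)) ^ 2 * chiSqVar) / (D k).m)
        (tendsto_const_nhds.div_atTop hmR) ?_ ?_ hρ'
      · refine Eventually.of_forall fun k => ?_
        have hme := (he k).aemeasurable
        refine Measurable.comp_aemeasurable (g := fun x : EuclideanSpace ℝ (D k).Obs =>
          (projErr (D k) t.2 x ⬝ᵥ F k t *ᵥ projErr (D k) t.2 x -
          (F k t * (((D k).B t.2)ᵀ * (D k).C δ₀ θ₀ * (D k).B t.2)).trace) / (D k).m) ?_ hme
        exact Continuous.measurable (by unfold projErr; fun_prop)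
      · filter_upwards [hreg, hmpos, hF] with k hk hmk hFk
        have hm0 : (0 : ℝ) < (D k).m := Nat.cast_pos.2 hmk
        obtain ⟨hFs, hFn, -⟩ := hFk t ht
        have h1 := hasLaw_mulVec_multivariateGaussian (hCp k) ((D k).B t.2)ᵀ (he k)
        have h2 := lintegral_quadForm (mul_mul_transpose_posSemidef _ (hCp k)) hFs h1
        rw [Matrix.transpose_transpose] at h2
        have h3 : ∀ ω, ENNReal.ofReal (Q k t ω ^ 2) = ENNReal.ofReal (((D k).m : ℝ)⁻¹ ^ 2) *
            ENNReal.ofReal ((projErr (D k) t.2 (e k ω) ⬝ᵥ F k t *ᵥ projErr (D k) t.2 (e k ω) -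
              (F k t * (((D k).B t.2)ᵀ * (D k).C δ₀ θ₀ * (D k).B t.2)).trace) ^ 2) := fun ω => by
          rw [← ENNReal.ofReal_mul (by positivity), ← mul_pow]
          congr 2
          simp only [Q]; rw [div_eq_inv_mul]
        simp_rw [h3]
        rw [lintegral_const_mul' _ _ ENNReal.ofReal_ne_top]
        refine (mul_le_mul_right h2 _).trans ?_
        rw [← ENNReal.ofReal_mul (by positivity)]
        refine ENNReal.ofReal_le_ofReal ?_
        have h4 : ‖((D k).B t.2)ᵀ * (D k).C δ₀ θ₀ * (D k).B t.2‖ ≤ M ^ 2 * Λ :=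
          norm_sandwich_le (hk.normB _ ht.2) (hCn k hk)
        have := chiSqVar_nonneg
        calc _ ≤ ((D k).m : ℝ)⁻¹ ^ 2 * ((D k).m * (MF * (M ^ 2 * Λ)) ^ 2 * chiSqVar) := by
              rw [Fintype.card_fin]; gcongr
          _ = _ := by field_simp
    · intro ε hε
      obtain ⟨A, G, hA, hG, hGA, hGm⟩ :=
        exists_projErr_modulus hΘ hθ₀ hδ₀ hM hreg hK hmpos he hε
      refine ⟨G, hG, fun ρ' hρ' => ?_⟩
      set c₁ := LF * A ^ 2 + (LF * (M ^ 2 * Λ) + MF * (2 * M ^ 2 * Λ)) with hc₁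
      have hc₁0 : 0 ≤ c₁ := by positivity
      obtain ⟨h, hh, hmod⟩ := hGm (ρ' / 2 / (2 * MF * A + 1)) (by positivity)
      refine ⟨min h (ρ' / 2 / (c₁ + 1)), lt_min hh (by positivity), ?_⟩
      have hev := eventually_whp_of_eventually (P := P) ((hreg.and hmpos).and hF)
      filter_upwards [hev] with x hx hg s hs t ht hst
      obtain ⟨k, ω⟩ := x
      obtain ⟨⟨hk, hmk⟩, hFk⟩ := hx
      simp only at hk hmk hFk hg ⊢
      have hm0 : (0 : ℝ) < (D k).m := Nat.cast_pos.2 hmk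
      have hst1 : dist s t < h := hst.trans_le (min_le_left _ _)
      have hst2 : dist s t < ρ' / 2 / (c₁ + 1) := hst.trans_le (min_le_right _ _)
      have hd2 : dist s.2 t.2 ≤ dist s t := le_max_right _ _
      have hw := hmod k ω hg s.2 hs.2 t.2 ht.2 (hd2.trans_lt hst1)
      have hmain := abs_quadForm_sub_le hk hM hs.2 ht.2 (hCn k hk) (hFk s hs).2.1 (hFk t ht).2.1
        ((hFk s hs).2.2 t ht) hd2 (hGA k ω hg _ hs.2) (hGA k ω hg _ ht.2) hw
      have hb := mul_add_mul_le_of_lt hc₁0 (c₂ := 2 * MF * A) (by positivity) hρ' hst2.le le_rfl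
      have hQ : Q k s ω - Q k t ω = ((projErr (D k) s.2 (e k ω) ⬝ᵥ F k s *ᵥ
          projErr (D k) s.2 (e k ω) -
            (F k s * (((D k).B s.2)ᵀ * (D k).C δ₀ θ₀ * (D k).B s.2)).trace) -
          (projErr (D k) t.2 (e k ω) ⬝ᵥ F k t *ᵥ projErr (D k) t.2 (e k ω) -
            (F k t * (((D k).B t.2)ᵀ * (D k).C δ₀ θ₀ * (D k).B t.2)).trace)) / (D k).m :=
        (sub_div _ _ _).symm
      rw [hQ, abs_div, abs_of_pos hm0, div_le_iff₀ hm0]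
      exact hmain.trans (mul_le_mul_of_nonneg_right hb hm0.le)
  filter_upwards [key, eventually_whp_of_eventually (P := P) hmpos] with x hx hmx t ht
  have hm0 : (0 : ℝ) < (D x.1).m := Nat.cast_pos.2 hmx
  have := hx t ht
  simp only [Q] at this
  rwa [abs_div, abs_of_pos hm0, div_le_iff₀ hm0] at this

end UniformLimits

/-! ### The score for the regression coefficients and the squared length of the errors -/

section Score

open scoped Matrix.Norms.L2Operator ENNReal

/-- Lets a linear form be treated as a one-row matrix, so that the moment bound for Gaussian vectors
covers scalar projections. -/
lemma norm_replicateRow_le {ι : Type*} [Fintype ι] [DecidableEq ι] (a : ι → ℝ) :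
    ‖Matrix.replicateRow Unit a‖ ≤ vnorm a := by
  refine norm_le_of_bilin _ (vnorm_nonneg _) fun u v => ?_
  have h1 : u ⬝ᵥ Matrix.replicateRow Unit a *ᵥ v = u () * (a ⬝ᵥ v) := by
    simp [dotProduct, Matrix.mulVec]
  have h2 : vnorm u = |u ()| := by
    rw [← Real.sqrt_sq (vnorm_nonneg u), vnorm_sq]
    simp [dotProduct, Real.sqrt_mul_self_eq_abs]
  rw [h1, h2, abs_mul]
  have := abs_dotProduct_le a v
  nlinarith [abs_nonneg (u ())]

/-- Second moment of a bilinear form in independent vectors, one of them Gaussian. -/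
lemma lintegral_bilin_le {ι Ω : Type*} [Fintype ι] [DecidableEq ι] [MeasurableSpace Ω]
    {P : Measure Ω} [IsProbabilityMeasure P] {S V : Matrix ι ι ℝ} (hS : S.PosSemidef)
    {e : Ω → EuclideanSpace ℝ ι} (he : HasLaw e (multivariateGaussian 0 S) P) {y : Ω → ι → ℝ}
    (hy : AEMeasurable y P) (hind : IndepFun y e P) {c v s : ℝ}
    (hyc : ∀ r, ∫⁻ ω, ENNReal.ofReal (y ω r ^ 2) ∂P ≤ ENNReal.ofReal c) (hV : ‖V‖ ≤ v)
    (hs : ‖S‖ ≤ s) :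
    ∫⁻ ω, ENNReal.ofReal ((y ω ⬝ᵥ V *ᵥ (e ω).ofLp) ^ 2) ∂P ≤
      ENNReal.ofReal (v ^ 2 * s * gaussMoment 1 * (Fintype.card ι * c)) := by
  have hv0 : 0 ≤ v := (norm_nonneg _).trans hV
  have hs0 : 0 ≤ s := (norm_nonneg _).trans hs
  have hg0 := gaussMoment_nonneg 1
  -- For a frozen value a of the other vector, a·Ve is a centred normal variable of variance at most
  -- v²s|a|². Independence and Fubini then integrate over a.
  have hinner : ∀ a : ι → ℝ, ∫⁻ x, ENNReal.ofReal ((a ⬝ᵥ V *ᵥ x.ofLp) ^ 2)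
      ∂multivariateGaussian 0 S ≤ ENNReal.ofReal (v ^ 2 * s * gaussMoment 1) *
        ∑ r, ENNReal.ofReal (a r ^ 2) := fun a => by
    have h1 := hasLaw_mulVec_multivariateGaussian hS (Matrix.replicateRow Unit a * V)
      (HasLaw.id (μ := multivariateGaussian 0 S))
    have hn : ‖Matrix.replicateRow Unit a * V‖ ≤ vnorm a * v :=
      l2norm_mul_le_of_le (norm_replicateRow_le a) hV
    have hn2 : ‖Matrix.replicateRow Unit a * V * S * (Matrix.replicateRow Unit a * V)ᵀ‖ ≤
        (vnorm a * v) * s * (vnorm a * v) :=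
      l2norm_mul_le_of_le (l2norm_mul_le_of_le hn hs) ((norm_transpose _).trans_le hn)
    have h2 := lintegral_vnorm_pow_le (mul_mul_transpose_posSemidef _ hS) h1 hn2 one_pos
    rw [← ENNReal.ofReal_sum_of_nonneg (fun _ _ => sq_nonneg _), ← ENNReal.ofReal_mul (by positivity)]
    have h3 : ∑ r, a r ^ 2 = vnorm a ^ 2 := by rw [vnorm_sq]; simp [dotProduct, sq]
    rw [h3]
    calc _ = _ := lintegral_congr fun x => by
            congr 1
            rw [mul_one, EuclideanSpace.real_norm_sq_eq, ← Matrix.mulVec_mulVec]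
            simp [Matrix.mulVec, dotProduct]
      _ ≤ _ := h2
      _ = _ := by congr 1; simp; ring
  have hm : Measurable fun x : (ι → ℝ) × EuclideanSpace ℝ ι =>
      ENNReal.ofReal ((x.1 ⬝ᵥ V *ᵥ x.2.ofLp) ^ 2) :=
    ENNReal.measurable_ofReal.comp (Continuous.measurable (by fun_prop))
  have hprod := (indepFun_iff_map_prod_eq_prod_map_map hy he.aemeasurable).1 hind
  have h1 : ∫⁻ ω, ENNReal.ofReal ((y ω ⬝ᵥ V *ᵥ (e ω).ofLp) ^ 2) ∂P =
      ∫⁻ x, ENNReal.ofReal ((x.1 ⬝ᵥ V *ᵥ x.2.ofLp) ^ 2) ∂(P.map fun ω => (y ω, e ω)) :=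
    (lintegral_map' hm.aemeasurable (hy.prodMk he.aemeasurable)).symm
  have : IsProbabilityMeasure (P.map y) := Measure.isProbabilityMeasure_map hy
  rw [h1, hprod, he.map_eq, lintegral_prod _ hm.aemeasurable]
  refine (lintegral_mono hinner).trans ?_
  have hms : Measurable fun a : ι → ℝ => ∑ r, ENNReal.ofReal (a r ^ 2) :=
    Finset.measurable_sum _ fun r _ =>
      ENNReal.measurable_ofReal.comp ((measurable_pi_apply r).pow_const 2)
  have hsum : ∫⁻ ω, ∑ r, ENNReal.ofReal (y ω r ^ 2) ∂P =
      ∑ r, ∫⁻ ω, ENNReal.ofReal (y ω r ^ 2) ∂P :=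
    lintegral_finsetSum' _ fun r _ => ENNReal.measurable_ofReal.comp_aemeasurable
      (((measurable_pi_apply r).comp_aemeasurable hy).pow_const 2)
  rw [lintegral_const_mul' _ _ ENNReal.ofReal_ne_top, lintegral_map' hms.aemeasurable hy, hsum]
  refine (mul_le_mul_right (Finset.sum_le_card_nsmul _ _ _ fun r _ => hyc r) _).trans ?_
  rw [Finset.card_univ, nsmul_eq_mul, ← ENNReal.ofReal_natCast,
    ← ENNReal.ofReal_mul (Nat.cast_nonneg _), ← ENNReal.ofReal_mul (by positivity)]

variable {q : ℕ} {Loc Ω : Type*} [MeasurableSpace Ω] {P : Measure Ω} [IsProbabilityMeasure P]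
  {D : ℕ → LowRankDesign q Loc} {Θ : Set (EuclideanSpace ℝ (Fin q))} {M δ₀ : ℝ}
  {θ₀ : EuclideanSpace ℝ (Fin q)} {e : ∀ k, Ω → EuclideanSpace ℝ (D k).Obs}
  {y : ∀ k, Ω → (D k).Obs → ℝ} {c : ℝ}

/-- The second moment of the bilinear form is O(N), so dividing by √m·√N leaves O(1/m). Pointwise √N
would already be the right scale; the extra √m makes the quantity vanish and matches the uniform
bound over the parameters. -/
lemma eventually_whp_bilin (hθ₀ : θ₀ ∈ Θ) (hδ₀ : 0 < δ₀)
    (hreg : ∀ᶠ k in atTop, IsRegularOn (D k) Θ M) (hK : ∀ k, ((D k).K θ₀).PosSemidef)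
    (hm : Tendsto (fun k => (D k).m) atTop atTop) (hN : Tendsto (fun k => (D k).N) atTop atTop)
    (he : ∀ k, HasLaw (e k) (multivariateGaussian 0 ((D k).C δ₀ θ₀)) P)
    (hy : ∀ k, AEMeasurable (y k) P) (hind : ∀ k, IndepFun (y k) (e k) P)
    (hyc : ∀ k r, ∫⁻ ω, ENNReal.ofReal (y k ω r ^ 2) ∂P ≤ ENNReal.ofReal c)
    (V : ∀ k, Matrix (D k).Obs (D k).Obs ℝ) {v : ℝ} (hV : ∀ᶠ k in atTop, ‖V k‖ ≤ v)
    {ρ : ℝ} (hρ : 0 < ρ) :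
    ∀ᶠ x in whp P, |y x.1 x.2 ⬝ᵥ V x.1 *ᵥ (e x.1 x.2).ofLp / (√(D x.1).m * √(D x.1).N)| ≤ ρ := by
  have hmR : Tendsto (fun k => ((D k).m : ℝ)) atTop atTop := tendsto_natCast_atTop_atTop.comp hm
  refine eventually_whp_of_lintegral_sq
    (Z := fun k ω => y k ω ⬝ᵥ V k *ᵥ (e k ω).ofLp / (√(D k).m * √(D k).N))
    (c := fun k => (v ^ 2 * (δ₀⁻¹ + M * M * M) * gaussMoment 1 * c) / (D k).m)
    (tendsto_const_nhds.div_atTop hmR) (Eventually.of_forall fun k => ?_) ?_ hρ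
  · have h1 := hy k
    have h2 := (he k).aemeasurable
    refine Measurable.comp_aemeasurable
      (g := fun x : ((D k).Obs → ℝ) × EuclideanSpace ℝ (D k).Obs =>
        x.1 ⬝ᵥ V k *ᵥ x.2.ofLp / (√(D k).m * √(D k).N)) ?_ (h1.prodMk h2)
    exact Continuous.measurable (by fun_prop)
  · filter_upwards [hreg, hV, hm.eventually_gt_atTop 0, hN.eventually_gt_atTop 0] with k hk hVk hmk hNk
    have hm0 : (0 : ℝ) < (D k).m := Nat.cast_pos.2 hmk
    have hN0 : (0 : ℝ) < (D k).N := Nat.cast_pos.2 hNk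
    have hC : ‖(D k).C δ₀ θ₀‖ ≤ δ₀⁻¹ + M * M * M :=
      norm_lowRankCov_le (hk.normB _ hθ₀) (hk.normK _ hθ₀) hδ₀ le_rfl
    have h1 := lintegral_bilin_le (V := V k) (lowRankCov_posDef _ (hK k) hδ₀).posSemidef (he k)
      (hy k) (hind k) (hyc k) hVk hC
    have h3 : ∀ ω, ENNReal.ofReal ((y k ω ⬝ᵥ V k *ᵥ (e k ω).ofLp / (√(D k).m * √(D k).N)) ^ 2) =
        ENNReal.ofReal (((D k).m : ℝ)⁻¹ * ((D k).N : ℝ)⁻¹) *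
          ENNReal.ofReal ((y k ω ⬝ᵥ V k *ᵥ (e k ω).ofLp) ^ 2) := fun ω => by
      rw [← ENNReal.ofReal_mul (by positivity), div_pow, mul_pow, Real.sq_sqrt hm0.le,
        Real.sq_sqrt hN0.le]
      congr 1; field_simp
    simp_rw [h3]
    rw [lintegral_const_mul' _ _ ENNReal.ofReal_ne_top]
    refine (mul_le_mul_right h1 _).trans (le_of_eq ?_)
    rw [← ENNReal.ofReal_mul (by positivity), LowRankDesign.card_obs]
    congr 1; field_simp

/-- The score for the regression coefficients is of smaller order than `√(m N)`, uniformly. -/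
lemma eventually_whp_core_bilin {S : Set ℝ} (hS : IsCompact S) (hΘ : IsCompact Θ) (hθ₀ : θ₀ ∈ Θ)
    (hδ₀ : 0 < δ₀) (hM : 0 ≤ M)
    (hreg : ∀ᶠ k in atTop, IsRegularOn (D k) Θ M) (hK : ∀ k, ((D k).K θ₀).PosSemidef)
    (hm : Tendsto (fun k => (D k).m) atTop atTop) (hN : Tendsto (fun k => (D k).N) atTop atTop)
    (he : ∀ k, HasLaw (e k) (multivariateGaussian 0 ((D k).C δ₀ θ₀)) P)
    (hy : ∀ k, AEMeasurable (y k) P) (hind : ∀ k, IndepFun (y k) (e k) P)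
    (hyc : ∀ k r, ∫⁻ ω, ENNReal.ofReal (y k ω r ^ 2) ∂P ≤ ENNReal.ofReal c)
    {Y : ℝ} (hY : 0 ≤ Y) (hyY : ∀ᶠ x in whp P, vnorm (y x.1 x.2) ≤ Y * √(D x.1).N)
    (F : ∀ k, ℝ × EuclideanSpace ℝ (Fin q) → Matrix (Fin (D k).m) (Fin (D k).m) ℝ)
    {MF LF : ℝ} (hMF : 0 ≤ MF) (hLF : 0 ≤ LF)
    (hF : ∀ᶠ k in atTop, ∀ t ∈ S ×ˢ Θ, (F k t)ᵀ = F k t ∧ ‖F k t‖ ≤ MF ∧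
      ∀ t' ∈ S ×ˢ Θ, ‖F k t - F k t'‖ ≤ LF * dist t t')
    {ρ : ℝ} (hρ : 0 < ρ) :
    ∀ᶠ x in whp P, ∀ t ∈ S ×ˢ Θ,
      |(((D x.1).B t.2)ᵀ *ᵥ y x.1 x.2 ⬝ᵥ F x.1 t *ᵥ projErr (D x.1) t.2 (e x.1 x.2)) /
        (√(D x.1).m * √(D x.1).N)| ≤ ρ := by
  have hmpos : ∀ᶠ k in atTop, 0 < (D k).m := hm.eventually_gt_atTop 0
  have hNpos : ∀ᶠ k in atTop, 0 < (D k).N := hN.eventually_gt_atTop 0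
  let Q : ℕ → ℝ × EuclideanSpace ℝ (Fin q) → Ω → ℝ := fun k t ω =>
    (((D k).B t.2)ᵀ *ᵥ y k ω ⬝ᵥ F k t *ᵥ projErr (D k) t.2 (e k ω)) / (√(D k).m * √(D k).N)
  refine eventually_whp_forall_le (hS.prod hΘ) Q ?_ ?_ hρ
  · intro t ht ρ' hρ'
    have h1 := eventually_whp_bilin hθ₀ hδ₀ hreg hK hm hN he hy hind hyc
      (fun k => (D k).B t.2 * F k t * ((D k).B t.2)ᵀ) (v := M * MF * M) (by
        filter_upwards [hreg, hF] with k hk hFk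
        exact l2norm_mul_le_of_le (l2norm_mul_le_of_le (hk.normB _ ht.2) (hFk t ht).2.1)
          ((norm_transpose _).trans_le (hk.normB _ ht.2))) hρ'
    filter_upwards [h1] with x hx
    simp only [Q, projErr]
    have : ((D x.1).B t.2)ᵀ *ᵥ y x.1 x.2 ⬝ᵥ F x.1 t *ᵥ (((D x.1).B t.2)ᵀ *ᵥ (e x.1 x.2).ofLp) =
        y x.1 x.2 ⬝ᵥ ((D x.1).B t.2 * F x.1 t * ((D x.1).B t.2)ᵀ) *ᵥ (e x.1 x.2).ofLp := by
      rw [← Matrix.mulVec_mulVec, ← Matrix.mulVec_mulVec, Matrix.dotProduct_mulVec (y x.1 x.2),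
        ← Matrix.mulVec_transpose]
    rw [this]; exact hx
  · intro ε hε
    obtain ⟨A, G, hA, hG, hGA, hGm⟩ :=
      exists_projErr_modulus hΘ hθ₀ hδ₀ hM hreg hK hmpos he hε
    refine ⟨G, hG, fun ρ' hρ' => ?_⟩
    -- These collect the variation of the form: Bᵀy has length O(√N), and the projected errors have
    -- length and increments on the scale √m, so the oscillation is measured in units of √m·√N.
    set c₁ := LF * (M * Y) * A + MF * ((M * Y) * A) with hc₁
    set c₂ := MF * (M * Y) with hc₂
    have hc₁0 : 0 ≤ c₁ := by positivity
    have hc₂0 : 0 ≤ c₂ := by positivity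
    obtain ⟨h, hh, hmod⟩ := hGm (ρ' / 2 / (c₂ + 1)) (by positivity)
    refine ⟨min h (ρ' / 2 / (c₁ + 1)), lt_min hh (by positivity), ?_⟩
    have hev := eventually_whp_of_eventually (P := P) ((hreg.and (hmpos.and hNpos)).and hF)
    filter_upwards [hev, hyY] with x hx hyx hg s hs t ht hst
    obtain ⟨k, ω⟩ := x
    obtain ⟨⟨hk, hmk, hNk⟩, hFk⟩ := hx
    simp only at hk hmk hNk hFk hg hyx ⊢
    have hm0 : 0 < √((D k).m : ℝ) := Real.sqrt_pos.2 (Nat.cast_pos.2 hmk)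
    have hN0 : 0 < √((D k).N : ℝ) := Real.sqrt_pos.2 (Nat.cast_pos.2 hNk)
    have hst1 : dist s t < h := hst.trans_le (min_le_left _ _)
    have hst2 : dist s t < ρ' / 2 / (c₁ + 1) := hst.trans_le (min_le_right _ _)
    have hd2 : dist s.2 t.2 ≤ dist s t := le_max_right _ _
    have hw := hmod k ω hg s.2 hs.2 t.2 ht.2 (hd2.trans_lt hst1)
    have hb := mul_add_mul_le_of_lt hc₁0 hc₂0 hρ' hst2.le le_rfl
    set κ := ρ' / 2 / (c₂ + 1) with hκ
    have hBy : ∀ θ ∈ Θ, vnorm (((D k).B θ)ᵀ *ᵥ y k ω) ≤ M * (Y * √(D k).N) := fun θ hθ => by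
      refine (vnorm_mulVec_le _ _).trans ?_
      rw [norm_transpose]
      exact mul_le_mul (hk.normB _ hθ) hyx (vnorm_nonneg _) hM
    have hBB : vnorm (((D k).B s.2)ᵀ *ᵥ y k ω - ((D k).B t.2)ᵀ *ᵥ y k ω) ≤
        M * dist s t * (Y * √(D k).N) := by
      rw [← Matrix.sub_mulVec, ← Matrix.transpose_sub]
      refine (vnorm_mulVec_le _ _).trans ?_
      rw [norm_transpose]
      exact mul_le_mul ((hk.lipB _ hs.2 _ ht.2).trans (by gcongr)) hyx (vnorm_nonneg _)
        (by positivity)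
    have hq := abs_bilin_sub_le (F k s) (F k t) (((D k).B s.2)ᵀ *ᵥ y k ω)
      (((D k).B t.2)ᵀ *ᵥ y k ω) (projErr (D k) s.2 (e k ω)) (projErr (D k) t.2 (e k ω))
    have hQ : Q k s ω - Q k t ω = ((((D k).B s.2)ᵀ *ᵥ y k ω ⬝ᵥ F k s *ᵥ projErr (D k) s.2 (e k ω)) -
        (((D k).B t.2)ᵀ *ᵥ y k ω ⬝ᵥ F k t *ᵥ projErr (D k) t.2 (e k ω))) /
          (√(D k).m * √(D k).N) := (sub_div _ _ _).symm
    rw [hQ, abs_div, abs_of_pos (mul_pos hm0 hN0), div_le_iff₀ (mul_pos hm0 hN0)]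
    have a1 := (vnorm_nonneg _).trans hBB
    have a2 := (vnorm_nonneg _).trans (hBy s.2 hs.2)
    have a3 := (vnorm_nonneg _).trans hw
    have a4 := (norm_nonneg _).trans ((hFk s hs).2.2 t ht)
    calc _ ≤ _ := hq
      _ ≤ (LF * dist s t) * (M * (Y * √(D k).N)) * (A * √(D k).m) +
          MF * ((M * dist s t * (Y * √(D k).N)) * (A * √(D k).m) +
            (M * (Y * √(D k).N)) * (κ * √(D k).m)) := by
          have b1 := hBy s.2 hs.2
          have b2 := hBy t.2 ht.2
          have b3 := hGA k ω hg s.2 hs.2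
          have b4 := (hFk s hs).2.2 t ht
          have b5 := (hFk t ht).2.1
          have n1 := vnorm_nonneg (((D k).B s.2)ᵀ *ᵥ y k ω)
          have n2 := vnorm_nonneg (projErr (D k) s.2 (e k ω))
          have n3 := vnorm_nonneg (projErr (D k) s.2 (e k ω) - projErr (D k) t.2 (e k ω))
          have n4 := vnorm_nonneg (((D k).B t.2)ᵀ *ᵥ y k ω)
          have n5 := vnorm_nonneg (((D k).B s.2)ᵀ *ᵥ y k ω - ((D k).B t.2)ᵀ *ᵥ y k ω)
          gcongr
      _ = (c₁ * dist s t + c₂ * κ) * (√(D k).m * √(D k).N) := by rw [hc₁, hc₂]; ring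
      _ ≤ ρ' * (√(D k).m * √(D k).N) := by gcongr

/-- The product carries the sup distance, which dominates the distances of both coordinates. `1 ≤ M`
lets M·dist bound the change of δ along with those of B and K. -/
lemma LowRankDesign.isRegular_core (hΘK : ∀ k, ∀ θ ∈ Θ, ((D k).K θ).PosSemidef) {S : Set ℝ}
    {a b : ℝ} (ha : 0 < a) (hSa : ∀ δ ∈ S, a ≤ δ) (hSb : ∀ δ ∈ S, δ ≤ b) (hM : 1 ≤ M)
    (hreg : ∀ᶠ k in atTop, IsRegularOn (D k) Θ M) :
    ∀ᶠ k in atTop, ∀ t ∈ S ×ˢ Θ,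
      (lowRankCore ((D k).B t.2) ((D k).K t.2) t.1)ᵀ =
        lowRankCore ((D k).B t.2) ((D k).K t.2) t.1 ∧
      ‖lowRankCore ((D k).B t.2) ((D k).K t.2) t.1‖ ≤ coreBound b M ∧
      ∀ t' ∈ S ×ˢ Θ, ‖lowRankCore ((D k).B t.2) ((D k).K t.2) t.1 -
        lowRankCore ((D k).B t'.2) ((D k).K t'.2) t'.1‖ ≤ coreLip a b M * M * dist t t' := by
  filter_upwards [hreg] with k hk t ht
  refine ⟨lowRankCore_transpose _ (hΘK k _ ht.2) (ha.trans_le (hSa _ ht.1)),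
    norm_lowRankCore_le (hΘK k _ ht.2) (hk.normB _ ht.2) (hk.normK _ ht.2)
      (ha.trans_le (hSa _ ht.1)) (hSb _ ht.1), fun t' ht' => ?_⟩
  have hM0 : 0 ≤ M := by linarith
  have h1 : dist t.1 t'.1 ≤ dist t t' := le_max_left _ _
  have h2 : dist t.2 t'.2 ≤ dist t t' := le_max_right _ _
  rw [mul_assoc]
  refine norm_lowRankCore_sub_le (hΘK k _ ht.2) (hΘK k _ ht'.2) ha (hSa _ ht.1) (hSb _ ht.1)
    (hSa _ ht'.1) (hSb _ ht'.1) (hk.normB _ ht.2) (hk.normK _ ht.2) (hk.normB _ ht'.2)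
    (hk.normK _ ht'.2) ((hk.lipB _ ht.2 _ ht'.2).trans (by gcongr))
    ((hk.lipK _ ht.2 _ ht'.2).trans (by gcongr)) ?_
  rw [← Real.dist_eq]
  exact h1.trans (le_mul_of_one_le_left dist_nonneg hM)

/-- Law of large numbers for the squared length of the error vector. -/
lemma eventually_whp_errNorm (hθ₀ : θ₀ ∈ Θ) (hδ₀ : 0 < δ₀) (hM : 0 ≤ M)
    (hreg : ∀ᶠ k in atTop, IsRegularOn (D k) Θ M) (hK : ∀ k, ((D k).K θ₀).PosSemidef)
    (hN : Tendsto (fun k => (D k).N) atTop atTop)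
    (hmN : (fun k => ((D k).m : ℝ)) =o[atTop] (fun k => ((D k).N : ℝ)))
    (he : ∀ k, HasLaw (e k) (multivariateGaussian 0 ((D k).C δ₀ θ₀)) P)
    {ρ : ℝ} (hρ : 0 < ρ) :
    ∀ᶠ x in whp P, |vnorm (e x.1 x.2).ofLp ^ 2 - (D x.1).N * δ₀⁻¹| ≤ ρ * (D x.1).N := by
  have hNR : Tendsto (fun k => ((D k).N : ℝ)) atTop atTop := tendsto_natCast_atTop_atTop.comp hN
  have hNpos : ∀ᶠ k in atTop, 0 < (D k).N := hN.eventually_gt_atTop 0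
  set Λ := δ₀⁻¹ + M * M * M with hΛ
  have hΛ0 : 0 ≤ Λ := by positivity
  have h1 : ∀ᶠ x in whp P, |((e x.1 x.2).ofLp ⬝ᵥ (1 : Matrix (D x.1).Obs (D x.1).Obs ℝ) *ᵥ
      (e x.1 x.2).ofLp - ((1 : Matrix (D x.1).Obs (D x.1).Obs ℝ) * (D x.1).C δ₀ θ₀).trace) /
        (D x.1).N| ≤ ρ / 2 := by
    refine eventually_whp_of_lintegral_sq (Z := fun k ω => ((e k ω).ofLp ⬝ᵥ
      (1 : Matrix (D k).Obs (D k).Obs ℝ) *ᵥ (e k ω).ofLp -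
        ((1 : Matrix (D k).Obs (D k).Obs ℝ) * (D k).C δ₀ θ₀).trace) / (D k).N)
      (c := fun k => ((1 * Λ) ^ 2 * chiSqVar) / (D k).N)
      (tendsto_const_nhds.div_atTop hNR) (Eventually.of_forall fun k => ?_) ?_ (half_pos hρ)
    · refine Measurable.comp_aemeasurable (g := fun x : EuclideanSpace ℝ (D k).Obs =>
        (x.ofLp ⬝ᵥ (1 : Matrix (D k).Obs (D k).Obs ℝ) *ᵥ x.ofLp -
        ((1 : Matrix (D k).Obs (D k).Obs ℝ) * (D k).C δ₀ θ₀).trace) / (D k).N) ?_ (he k).aemeasurable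
      exact Continuous.measurable (by fun_prop)
    · filter_upwards [hreg, hNpos] with k hk hNk
      have hN0 : (0 : ℝ) < (D k).N := Nat.cast_pos.2 hNk
      have hC : ‖(D k).C δ₀ θ₀‖ ≤ Λ :=
        norm_lowRankCov_le (hk.normB _ hθ₀) (hk.normK _ hθ₀) hδ₀ le_rfl
      have h2 := lintegral_quadForm (F := 1) (lowRankCov_posDef _ (hK k) hδ₀).posSemidef
        Matrix.transpose_one (he k)
      have h3 : ∀ ω, ENNReal.ofReal ((((e k ω).ofLp ⬝ᵥ
          (1 : Matrix (D k).Obs (D k).Obs ℝ) *ᵥ (e k ω).ofLp -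
          ((1 : Matrix (D k).Obs (D k).Obs ℝ) * (D k).C δ₀ θ₀).trace) / (D k).N) ^ 2) =
          ENNReal.ofReal (((D k).N : ℝ)⁻¹ ^ 2) * ENNReal.ofReal (((e k ω).ofLp ⬝ᵥ
          (1 : Matrix (D k).Obs (D k).Obs ℝ) *ᵥ (e k ω).ofLp -
          ((1 : Matrix (D k).Obs (D k).Obs ℝ) * (D k).C δ₀ θ₀).trace) ^ 2) := fun ω => by
        rw [← ENNReal.ofReal_mul (by positivity), ← mul_pow, div_eq_inv_mul]
      simp_rw [h3]
      rw [lintegral_const_mul' _ _ ENNReal.ofReal_ne_top]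
      refine (mul_le_mul_right h2 _).trans ?_
      rw [← ENNReal.ofReal_mul (by positivity)]
      refine ENNReal.ofReal_le_ofReal ?_
      have := chiSqVar_nonneg
      have h1' : ‖(1 : Matrix (D k).Obs (D k).Obs ℝ)‖ ≤ 1 := norm_one_le
      have hC' : ‖lowRankCov ((D k).B θ₀) ((D k).K θ₀) δ₀‖ ≤ Λ := hC
      calc _ ≤ ((D k).N : ℝ)⁻¹ ^ 2 * ((D k).N * (1 * Λ) ^ 2 * chiSqVar) := by
            rw [LowRankDesign.card_obs]; gcongr
        _ = _ := by field_simp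
  -- The mean of |e|² is N/δ₀ + tr(K BᵀB). The second trace is at most M³m, hence o(N), and takes
  -- the second half of the tolerance.
  have h2 : ∀ᶠ k in atTop, M * M * M * ((D k).m : ℝ) ≤ ρ / 2 * (D k).N := by
    have := hmN.def (c := ρ / 2 / (M * M * M + 1)) (by positivity)
    filter_upwards [this] with k hk
    rw [Real.norm_of_nonneg (Nat.cast_nonneg _), Real.norm_of_nonneg (Nat.cast_nonneg _)] at hk
    have hN0 : (0 : ℝ) ≤ (D k).N := Nat.cast_nonneg _
    have hM3 : 0 ≤ M * M * M := by positivity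
    calc _ ≤ M * M * M * (ρ / 2 / (M * M * M + 1) * (D k).N) := by gcongr
      _ = (M * M * M / (M * M * M + 1)) * (ρ / 2 * (D k).N) := by ring
      _ ≤ 1 * (ρ / 2 * (D k).N) := by
          gcongr; rw [div_le_one (by positivity)]; linarith
      _ = _ := one_mul _
  filter_upwards [h1, eventually_whp_of_eventually (P := P) ((h2.and hreg).and hNpos)] with x hx hx2
  obtain ⟨⟨hmk, hk⟩, hNk⟩ := hx2
  have hN0 : (0 : ℝ) < (D x.1).N := Nat.cast_pos.2 hNk
  rw [abs_div, abs_of_pos hN0, div_le_iff₀ hN0, Matrix.one_mulVec, one_mul, ← vnorm_sq] at hx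
  have htr : ((D x.1).C δ₀ θ₀).trace = (D x.1).N * δ₀⁻¹ +
      ((D x.1).K θ₀ * (((D x.1).B θ₀)ᵀ * (D x.1).B θ₀)).trace := by
    rw [LowRankDesign.C_eq, lowRankCov, Matrix.trace_add, Matrix.trace_smul, Matrix.trace_one,
      LowRankDesign.card_obs, Matrix.mul_assoc, Matrix.trace_mul_comm ((D x.1).B θ₀),
      Matrix.mul_assoc, smul_eq_mul, mul_comm]
  have hn : ‖(D x.1).K θ₀ * (((D x.1).B θ₀)ᵀ * (D x.1).B θ₀)‖ ≤ M * (M * M) :=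
    l2norm_mul_le_of_le (hk.normK _ hθ₀) (l2norm_mul_le_of_le
      ((norm_transpose _).trans_le (hk.normB _ hθ₀)) (hk.normB _ hθ₀))
  have h4 := abs_trace_le ((D x.1).K θ₀ * (((D x.1).B θ₀)ᵀ * (D x.1).B θ₀))
  rw [Fintype.card_fin] at h4
  have h5 : ((D x.1).m : ℝ) * ‖(D x.1).K θ₀ * (((D x.1).B θ₀)ᵀ * (D x.1).B θ₀)‖ ≤
      (D x.1).m * (M * (M * M)) := by gcongr
  rw [htr] at hx
  have h6 : vnorm (e x.1 x.2).ofLp ^ 2 - (D x.1).N * δ₀⁻¹ =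
      (vnorm (e x.1 x.2).ofLp ^ 2 - ((D x.1).N * δ₀⁻¹ +
      ((D x.1).K θ₀ * (((D x.1).B θ₀)ᵀ * (D x.1).B θ₀)).trace)) +
      ((D x.1).K θ₀ * (((D x.1).B θ₀)ᵀ * (D x.1).B θ₀)).trace := by ring
  rw [h6]
  refine (abs_add_le _ _).trans ?_
  have h7 : ((D x.1).m : ℝ) * (M * (M * M)) = M * M * M * (D x.1).m := by ring
  linarith

end Score

/-! ### Second moments and Gram matrix of the covariates -/

section Covariates

open scoped ENNReal

variable {p : ℕ} {ν : Measure (EuclideanSpace ℝ (Fin p))}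

/-- In a coordinate direction the centred projection has moments of every order, and the mean is
added back as a constant. -/
lemma IsSubGaussianLaw.memLp_coord [IsFiniteMeasure ν] (hν : IsSubGaussianLaw ν) (n : ℝ≥0)
    (a : Fin p) : MemLp (fun y : EuclideanSpace ℝ (Fin p) => y a) n ν := by
  obtain ⟨σ, hσ⟩ := hν
  have h := ((hσ (EuclideanSpace.single a 1)).memLp n).add
    (memLp_const ((∫ y', y' ∂ν : EuclideanSpace ℝ (Fin p)) a))
  refine h.congr_norm (Continuous.aestronglyMeasurable (by fun_prop)) (ae_of_all _ fun y => ?_)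
  simp [EuclideanSpace.inner_single_left]

lemma IsSubGaussianLaw.memLp_mul_coord [IsFiniteMeasure ν] (hν : IsSubGaussianLaw ν)
    (a b : Fin p) : MemLp (fun y : EuclideanSpace ℝ (Fin p) => y a * y b) 2 ν :=
  memLp_mul_of_four (by simpa using hν.memLp_coord 4 a) (by simpa using hν.memLp_coord 4 b)

/-- The second moment matrix of a law on `ℝᵖ`. -/
def secondMoment (ν : Measure (EuclideanSpace ℝ (Fin p))) : Matrix (Fin p) (Fin p) ℝ :=
  Matrix.of fun a b => ∫ y, y a * y b ∂ν

/-- Weak law of large numbers along a triangular array of row-wise i.i.d. variables. -/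
lemma eventually_whp_sum_sub {E Ω : Type*} [MeasurableSpace E] [MeasurableSpace Ω] {P : Measure Ω}
    [IsProbabilityMeasure P] {ν : Measure E} {ι : ℕ → Type*} [∀ k, Fintype (ι k)]
    (hι : Tendsto (fun k => Fintype.card (ι k)) atTop atTop) {x : ∀ k, ι k → Ω → E}
    (hx : ∀ k r, HasLaw (x k r) ν P) (hind : ∀ k, iIndepFun (x k) P) {f : E → ℝ}
    (hfm : Measurable f) (hf : MemLp f 2 ν) {ρ : ℝ} (hρ : 0 < ρ) :
    ∀ᶠ y in whp P, |∑ r, f (x y.1 r y.2) - Fintype.card (ι y.1) * ∫ t, f t ∂ν| ≤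
      ρ * Fintype.card (ι y.1) := by
  have hιR : Tendsto (fun k => (Fintype.card (ι k) : ℝ)) atTop atTop :=
    tendsto_natCast_atTop_atTop.comp hι
  have hmem : ∀ k r, MemLp (fun ω => f (x k r ω)) 2 P := fun k r => by
    have h := hf
    rw [← (hx k r).map_eq] at h
    exact h.comp_of_map (hx k r).aemeasurable
  have hev : ∀ᶠ y in whp P, |(∑ r, f (x y.1 r y.2) - Fintype.card (ι y.1) * ∫ t, f t ∂ν) /
      Fintype.card (ι y.1)| ≤ ρ := by
    refine eventually_whp_of_lintegral_sq
      (Z := fun k ω => (∑ r, f (x k r ω) - Fintype.card (ι k) * ∫ t, f t ∂ν) / Fintype.card (ι k))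
      (c := fun k => Var[f; ν] / Fintype.card (ι k))
      (tendsto_const_nhds.div_atTop hιR) (Eventually.of_forall fun k => ?_) ?_ hρ
    · have : ∀ r, AEMeasurable (x k r) P := fun r => (hx k r).aemeasurable
      fun_prop
    · filter_upwards [hι.eventually_gt_atTop 0] with k hk
      have hk0 : (0 : ℝ) < Fintype.card (ι k) := Nat.cast_pos.2 hk
      have hsum : MemLp (∑ r, fun ω => f (x k r ω)) 2 P := memLp_finsetSum' _ fun r _ => hmem k r
      have hvar : Var[∑ r, fun ω => f (x k r ω); P] = Fintype.card (ι k) * Var[f; ν] := by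
        rw [IndepFun.variance_sum (fun r _ => hmem k r)]
        · have : ∀ r, Var[fun ω => f (x k r ω); P] = Var[f; ν] := fun r => by
            rw [← (hx k r).map_eq, variance_map hfm.aemeasurable (hx k r).aemeasurable]
            rfl
          simp [this]
        · intro r _ s _ hrs
          exact ((hind k).indepFun hrs).comp hfm hfm
      have hmean : ∫ ω, (∑ r, fun ω => f (x k r ω)) ω ∂P =
          Fintype.card (ι k) * ∫ t, f t ∂ν := by
        simp only [Finset.sum_apply]
        rw [integral_finsetSum _ fun r _ => (hmem k r).integrable (by norm_num)]
        have : ∀ r, ∫ ω, f (x k r ω) ∂P = ∫ t, f t ∂ν := fun r =>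
          (hx k r).integral_comp hfm.aestronglyMeasurable
        simp [this]
      rw [variance_eq_integral hsum.aemeasurable, hmean] at hvar
      simp only [Finset.sum_apply] at hvar
      rw [← ofReal_integral_eq_lintegral_ofReal]
      · refine ENNReal.ofReal_le_ofReal (le_of_eq ?_)
        simp_rw [div_pow]
        rw [integral_div, hvar]
        field_simp
      · have h1 := ((hsum.sub (memLp_const (Fintype.card (ι k) * ∫ t, f t ∂ν))).integrable_sq).div_const
          ((Fintype.card (ι k) : ℝ) ^ 2)
        refine h1.congr (ae_of_all _ fun ω => ?_)
        simp [div_pow]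
      · exact ae_of_all _ fun ω => sq_nonneg _
  filter_upwards [hev, eventually_whp_of_eventually (P := P) (hι.eventually_gt_atTop 0)] with y hy hk
  have hk0 : (0 : ℝ) < Fintype.card (ι y.1) := Nat.cast_pos.2 hk
  rwa [abs_div, abs_of_pos hk0, div_le_iff₀ hk0] at hy

lemma abs_apply_le_vnorm {ι : Type*} [Fintype ι] (u : ι → ℝ) (a : ι) : |u a| ≤ vnorm u := by
  rw [← Real.norm_eq_abs]
  exact PiLp.norm_apply_le (WithLp.toLp 2 u : EuclideanSpace ℝ ι) a

/-- A Gram matrix close to a positive definite matrix is nondegenerate. -/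
lemma vnorm_mulVec_sq_ge {ι : Type*} [Fintype ι] [DecidableEq ι] {X : Matrix ι (Fin p) ℝ}
    {G : Matrix (Fin p) (Fin p) ℝ} {c ρ N : ℝ} (hN : 0 ≤ N)
    (hG : ∀ u, c * vnorm u ^ 2 ≤ u ⬝ᵥ G *ᵥ u)
    (hX : ∀ a b, |(∑ r, X r a * X r b) - N * G a b| ≤ ρ * N) (u : Fin p → ℝ) :
    (c - p ^ 2 * ρ) * N * vnorm u ^ 2 ≤ vnorm (X *ᵥ u) ^ 2 := by
  have h1 : vnorm (X *ᵥ u) ^ 2 = ∑ a, ∑ b, u a * u b * ∑ r, X r a * X r b := by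
    rw [vnorm_sq]
    simp only [dotProduct, Matrix.mulVec]
    simp_rw [Finset.sum_mul_sum, Finset.mul_sum]
    rw [Finset.sum_comm]
    refine Finset.sum_congr rfl fun a _ => ?_
    rw [Finset.sum_comm]
    exact Finset.sum_congr rfl fun b _ => Finset.sum_congr rfl fun r _ => by ring
  have h2 : u ⬝ᵥ G *ᵥ u = ∑ a, ∑ b, u a * u b * G a b := by
    simp only [dotProduct, Matrix.mulVec, Finset.mul_sum]
    exact Finset.sum_congr rfl fun a _ => Finset.sum_congr rfl fun b _ => by ring
  have h3 : N * (u ⬝ᵥ G *ᵥ u) - vnorm (X *ᵥ u) ^ 2 ≤ p ^ 2 * (ρ * N * vnorm u ^ 2) := by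
    rw [h1, h2, Finset.mul_sum, ← Finset.sum_sub_distrib]
    have hterm : ∀ a b, N * (u a * u b * G a b) - u a * u b * ∑ r, X r a * X r b ≤
        ρ * N * vnorm u ^ 2 := fun a b => by
      have e1 : N * (u a * u b * G a b) - u a * u b * ∑ r, X r a * X r b =
          -(u a * u b) * ((∑ r, X r a * X r b) - N * G a b) := by ring
      rw [e1]
      refine (le_abs_self _).trans ?_
      rw [abs_mul, abs_neg, abs_mul]
      have ha := abs_apply_le_vnorm u a
      have hb := abs_apply_le_vnorm u b
      have hv := vnorm_nonneg u
      calc _ ≤ vnorm u * vnorm u * (ρ * N) := by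
            have := hX a b
            gcongr
        _ = _ := by ring
    calc _ ≤ ∑ a : Fin p, ∑ b : Fin p, ρ * N * vnorm u ^ 2 := by
          refine Finset.sum_le_sum fun a _ => ?_
          rw [Finset.mul_sum, ← Finset.sum_sub_distrib]
          exact Finset.sum_le_sum fun b _ => hterm a b
      _ = _ := by simp; ring
  have h4 := mul_le_mul_of_nonneg_left (hG u) hN
  nlinarith

end Covariates

/-! ### The γγ block of the expected Hessian bounds the second moments of the covariates -/

section Hessian

open scoped Matrix.Norms.L2Operator

lemma differentiableAt_det {E n : Type*} [NormedAddCommGroup E] [NormedSpace ℝ E] [Fintype n]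
    [DecidableEq n] {A : E → Matrix n n ℝ} {v : E}
    (hA : ∀ i j, DifferentiableAt ℝ (fun t => A t i j) v) :
    DifferentiableAt ℝ (fun t => (A t).det) v := by
  simp only [Matrix.det_apply]
  refine DifferentiableAt.fun_sum fun σ _ => DifferentiableAt.fun_const_smul
    (f := fun t => ∏ i, A t (σ i) i) ?_ (Equiv.Perm.sign σ)
  exact (HasFDerivAt.finsetProd fun i _ => (hA (σ i) i).hasFDerivAt).differentiableAt

/-- Cramer's rule: the entries of the adjugate are determinants in which one row has been replaced
by a constant one. -/
lemma differentiableAt_inv_apply {E n : Type*} [NormedAddCommGroup E] [NormedSpace ℝ E]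
    [Fintype n] [DecidableEq n] {A : E → Matrix n n ℝ} {v : E}
    (hA : ∀ i j, DifferentiableAt ℝ (fun t => A t i j) v) (hd : (A v).det ≠ 0) (i j : n) :
    DifferentiableAt ℝ (fun t => (A t)⁻¹ i j) v := by
  simp only [Matrix.inv_def, Ring.inverse_eq_inv', Matrix.smul_apply, smul_eq_mul,
    Matrix.adjugate_apply]
  refine ((differentiableAt_det hA).inv hd).mul (differentiableAt_det fun k l => ?_)
  by_cases hk : k = j
  · subst hk; simp
  · simpa [Matrix.updateRow_ne hk] using hA k l

/-- Differentiability in all variables is established separately; the value can then be computed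
along a line. Along a γ-direction the covariance is constant and the likelihood is a quadratic
polynomial. -/
lemma partialDeriv_eq_of_hasDerivAt {ι : Type*} [Fintype ι] [DecidableEq ι] {a : ι}
    {f : EuclideanSpace ℝ ι → ℝ} {v : EuclideanSpace ℝ ι} {d : ℝ} (hf : DifferentiableAt ℝ f v)
    (h : HasDerivAt (fun s : ℝ => f (v + s • EuclideanSpace.single a 1)) d 0) :
    partialDeriv a f v = d := by
  rw [partialDeriv, ← hf.lineDeriv_eq_fderiv]
  exact h.deriv

lemma hasDerivAt_bilin {ι : Type*} [Fintype ι] (A : Matrix ι ι ℝ) (r d : ι → ℝ) :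
    HasDerivAt (fun s : ℝ => (r - s • d) ⬝ᵥ A *ᵥ (r - s • d))
      (-(d ⬝ᵥ A *ᵥ r + r ⬝ᵥ A *ᵥ d)) 0 := by
  have h : ∀ s : ℝ, (r - s • d) ⬝ᵥ A *ᵥ (r - s • d) =
      r ⬝ᵥ A *ᵥ r - s * (d ⬝ᵥ A *ᵥ r + r ⬝ᵥ A *ᵥ d) + s ^ 2 * (d ⬝ᵥ A *ᵥ d) := fun s => by
    simp only [Matrix.mulVec_sub, Matrix.mulVec_smul, dotProduct_sub, sub_dotProduct,
      dotProduct_smul, smul_dotProduct, smul_eq_mul]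
    ring
  simp_rw [h]
  have h1 : HasDerivAt (fun s : ℝ => s * (d ⬝ᵥ A *ᵥ r + r ⬝ᵥ A *ᵥ d)) _ 0 :=
    (hasDerivAt_id (0 : ℝ)).mul_const _
  have h2 : HasDerivAt (fun s : ℝ => s ^ 2 * (d ⬝ᵥ A *ᵥ d)) _ 0 :=
    (hasDerivAt_pow 2 (0 : ℝ)).mul_const _
  refine ((h1.const_sub (r ⬝ᵥ A *ᵥ r)).add h2).congr_deriv ?_
  simp


variable {p q : ℕ} {Loc : Type*} (D : LowRankDesign q Loc)

namespace LowRankDesign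

/-- The `δ`-coordinate of a joint parameter. -/
abbrev paramδ (v : EuclideanSpace ℝ (ParamIdx p q)) : ℝ := v (Sum.inr (Sum.inl ()))

/-- The `θ`-coordinates of a joint parameter. -/
abbrev paramθ (v : EuclideanSpace ℝ (ParamIdx p q)) : EuclideanSpace ℝ (Fin q) :=
  WithLp.toLp 2 fun a => v (Sum.inr (Sum.inr a))

/-- The residual vector as a function of the joint parameter. -/
def residVec (X : Matrix D.Obs (Fin p) ℝ) (z : D.Obs → ℝ) (v : EuclideanSpace ℝ (ParamIdx p q)) :
    D.Obs → ℝ := z - X *ᵥ fun a => v (Sum.inl a)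

lemma differentiable_residVec (X : Matrix D.Obs (Fin p) ℝ) (z : D.Obs → ℝ) (r : D.Obs) :
    Differentiable ℝ fun v : EuclideanSpace ℝ (ParamIdx p q) => D.residVec X z v r := by
  simp only [residVec, Pi.sub_apply, Matrix.mulVec, dotProduct]
  fun_prop

lemma differentiable_paramθ : Differentiable ℝ (paramθ : EuclideanSpace ℝ (ParamIdx p q) → _) :=
  differentiable_euclidean.2 fun a => by simp only; fun_prop

lemma differentiableAt_C {v : EuclideanSpace ℝ (ParamIdx p q)} (hδ : paramδ v ≠ 0)
    (hB : ∀ r i, DifferentiableAt ℝ (fun t => D.B t r i) (paramθ v))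
    (hK : ∀ i j, DifferentiableAt ℝ (fun t => D.K t i j) (paramθ v)) (r s : D.Obs) :
    DifferentiableAt ℝ (fun v => D.C (paramδ v) (paramθ v) r s) v := by
  have hθ : DifferentiableAt ℝ (paramθ : EuclideanSpace ℝ (ParamIdx p q) → _) v :=
    differentiable_paramθ v
  have hB' : ∀ r i, DifferentiableAt ℝ (fun v => D.B (paramθ v) r i) v := fun r i =>
    (hB r i).comp v hθ
  have hK' : ∀ i j, DifferentiableAt ℝ (fun v => D.K (paramθ v) i j) v := fun i j =>
    (hK i j).comp v hθ
  simp only [C, BKB, Matrix.add_apply, Matrix.smul_apply, smul_eq_mul, Matrix.mul_apply,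
    Matrix.transpose_apply]
  refine DifferentiableAt.fun_add (DifferentiableAt.mul_const (DifferentiableAt.fun_inv ?_ hδ) _) ?_
  · fun_prop
  · exact DifferentiableAt.fun_sum fun j _ => DifferentiableAt.fun_mul
      (DifferentiableAt.fun_sum fun i _ => DifferentiableAt.fun_mul (hB' _ _) (hK' _ _)) (hB' _ _)

/-- The gradient of the negative log-likelihood in the regression coefficients. -/
def gradγ (X : Matrix D.Obs (Fin p) ℝ) (z : D.Obs → ℝ) (b : Fin p)
    (v : EuclideanSpace ℝ (ParamIdx p q)) : ℝ :=
  -(1 / 2) * ((fun r => X r b) ⬝ᵥ (D.C (paramδ v) (paramθ v))⁻¹ *ᵥ D.residVec X z v +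
    D.residVec X z v ⬝ᵥ (D.C (paramδ v) (paramθ v))⁻¹ *ᵥ fun r => X r b)

lemma residVec_add_smul (X : Matrix D.Obs (Fin p) ℝ) (z : D.Obs → ℝ) (b : Fin p)
    (v : EuclideanSpace ℝ (ParamIdx p q)) (s : ℝ) :
    D.residVec X z (v + s • EuclideanSpace.single (Sum.inl b) 1) =
      D.residVec X z v - s • fun r => X r b := by
  ext r
  simp [residVec, Matrix.mulVec, dotProduct, mul_add, Finset.sum_add_distrib]
  ring

lemma paramδ_add_smul (b : Fin p) (v : EuclideanSpace ℝ (ParamIdx p q)) (s : ℝ) :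
    paramδ (v + s • EuclideanSpace.single (Sum.inl b) 1) = paramδ v := by simp

lemma paramθ_add_smul (b : Fin p) (v : EuclideanSpace ℝ (ParamIdx p q)) (s : ℝ) :
    paramθ (v + s • EuclideanSpace.single (Sum.inl b) 1) = paramθ v := by ext; simp

lemma negLogLikVec_eq (X : Matrix D.Obs (Fin p) ℝ) (z : D.Obs → ℝ)
    (v : EuclideanSpace ℝ (ParamIdx p q)) :
    D.negLogLikVec X z v = (D.N : ℝ) / 2 * Real.log (2 * Real.pi) +
      1 / 2 * Real.log (D.C (paramδ v) (paramθ v)).det +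
      1 / 2 * (D.residVec X z v ⬝ᵥ (D.C (paramδ v) (paramθ v))⁻¹ *ᵥ D.residVec X z v) := rfl

variable {D} {X : Matrix D.Obs (Fin p) ℝ} {z : D.Obs → ℝ} {v : EuclideanSpace ℝ (ParamIdx p q)}

lemma differentiableAt_bilin_inv
    (hC : ∀ r s, DifferentiableAt ℝ (fun v => D.C (paramδ v) (paramθ v) r s) v)
    (hd : (D.C (paramδ v) (paramθ v)).det ≠ 0)
    {f g : EuclideanSpace ℝ (ParamIdx p q) → D.Obs → ℝ}
    (hf : ∀ r, DifferentiableAt ℝ (fun v => f v r) v)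
    (hg : ∀ r, DifferentiableAt ℝ (fun v => g v r) v) :
    DifferentiableAt ℝ (fun v => f v ⬝ᵥ (D.C (paramδ v) (paramθ v))⁻¹ *ᵥ g v) v := by
  simp only [dotProduct, Matrix.mulVec]
  exact DifferentiableAt.fun_sum fun r _ => DifferentiableAt.fun_mul (hf r)
    (DifferentiableAt.fun_sum fun s _ => DifferentiableAt.fun_mul
      (differentiableAt_inv_apply (A := fun v => D.C (paramδ v) (paramθ v)) hC hd r s) (hg s))

lemma partialDeriv_negLogLikVec
    (hC : ∀ r s, DifferentiableAt ℝ (fun v => D.C (paramδ v) (paramθ v) r s) v)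
    (hd : (D.C (paramδ v) (paramθ v)).det ≠ 0) (b : Fin p) :
    partialDeriv (Sum.inl b) (D.negLogLikVec X z) v = D.gradγ X z b v := by
  refine partialDeriv_eq_of_hasDerivAt ?_ ?_
  · have h : D.negLogLikVec X z = fun v => (D.N : ℝ) / 2 * Real.log (2 * Real.pi) +
        1 / 2 * Real.log (D.C (paramδ v) (paramθ v)).det +
        1 / 2 * (D.residVec X z v ⬝ᵥ (D.C (paramδ v) (paramθ v))⁻¹ *ᵥ D.residVec X z v) := rfl
    rw [h]
    have hr : ∀ r, DifferentiableAt ℝ (fun v => D.residVec X z v r) v := fun r =>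
      D.differentiable_residVec X z r v
    exact ((((differentiableAt_det (A := fun v => D.C (paramδ v) (paramθ v)) hC).log hd).const_mul
      _).const_add _).add ((differentiableAt_bilin_inv hC hd hr hr).const_mul _)
  · simp only [negLogLikVec_eq, residVec_add_smul, paramδ_add_smul, paramθ_add_smul]
    refine (((hasDerivAt_bilin _ _ _).const_mul _).const_add _).congr_deriv ?_
    rw [gradγ]; ring

/-- The gradient is affine in γ, and symmetry of C⁻¹ merges its two halves. The result involves
neither z nor γ, so the expected block is just the mean of XᵀC⁻¹X. -/
lemma partialDeriv_gradγ
    (hC : ∀ r s, DifferentiableAt ℝ (fun v => D.C (paramδ v) (paramθ v) r s) v)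
    (hd : (D.C (paramδ v) (paramθ v)).det ≠ 0)
    (hs : ((D.C (paramδ v) (paramθ v))⁻¹)ᵀ = (D.C (paramδ v) (paramθ v))⁻¹) (a b : Fin p) :
    partialDeriv (Sum.inl a) (D.gradγ X z b) v =
      (fun r => X r a) ⬝ᵥ (D.C (paramδ v) (paramθ v))⁻¹ *ᵥ fun r => X r b := by
  refine partialDeriv_eq_of_hasDerivAt ?_ ?_
  · have hr : ∀ r, DifferentiableAt ℝ (fun v => D.residVec X z v r) v := fun r =>
      D.differentiable_residVec X z r v
    have hc : ∀ r, DifferentiableAt ℝ (fun _ : EuclideanSpace ℝ (ParamIdx p q) => X r b) v :=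
      fun _ => differentiableAt_const _
    unfold gradγ
    exact ((differentiableAt_bilin_inv (f := fun _ r => X r b) hC hd hc hr).fun_add
      (differentiableAt_bilin_inv (g := fun _ r => X r b) hC hd hr hc)).const_mul _
  · simp only [gradγ, residVec_add_smul, paramδ_add_smul, paramθ_add_smul]
    set A := (D.C (paramδ v) (paramθ v))⁻¹
    have h : ∀ s : ℝ, -(1 / 2) * ((fun r => X r b) ⬝ᵥ A *ᵥ (D.residVec X z v - s • fun r => X r a) +
        (D.residVec X z v - s • fun r => X r a) ⬝ᵥ A *ᵥ fun r => X r b) =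
        -(1 / 2) * ((fun r => X r b) ⬝ᵥ A *ᵥ D.residVec X z v +
          D.residVec X z v ⬝ᵥ A *ᵥ fun r => X r b) +
        s * ((fun r => X r a) ⬝ᵥ A *ᵥ fun r => X r b) := fun s => by
      have hsym : (fun r => X r b) ⬝ᵥ A *ᵥ (fun r => X r a) =
          (fun r => X r a) ⬝ᵥ A *ᵥ fun r => X r b := by
        rw [Matrix.dotProduct_mulVec, ← Matrix.mulVec_transpose, hs, dotProduct_comm]
      simp only [Matrix.mulVec_sub, Matrix.mulVec_smul, dotProduct_sub, sub_dotProduct,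
        dotProduct_smul, smul_dotProduct, smul_eq_mul, hsym]
      ring
    simp_rw [h]
    refine (((hasDerivAt_id (0 : ℝ)).mul_const _).const_add _).congr_deriv ?_
    simp

/-- The `γγ` block of the Hessian of the negative log-likelihood. -/
lemma partialDeriv_partialDeriv_negLogLikVec {γ : EuclideanSpace ℝ (Fin p)} {δ : ℝ}
    {θ : EuclideanSpace ℝ (Fin q)} (hδ : 0 < δ) (hKp : (D.K θ).PosSemidef)
    {U : Set (EuclideanSpace ℝ (Fin q))} (hU : IsOpen U) (hθ : θ ∈ U)
    (hB : ∀ r i, DifferentiableOn ℝ (fun t => D.B t r i) U)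
    (hK : ∀ i j, DifferentiableOn ℝ (fun t => D.K t i j) U) (a b : Fin p) :
    partialDeriv (Sum.inl a) (partialDeriv (Sum.inl b) (D.negLogLikVec X z)) (param γ δ θ) =
      (fun r => X r a) ⬝ᵥ (D.C δ θ)⁻¹ *ᵥ fun r => X r b := by
  have hpδ : paramδ (param γ δ θ) = δ := rfl
  have hpθ : paramθ (param γ δ θ) = θ := rfl
  have hC : ∀ v : EuclideanSpace ℝ (ParamIdx p q), paramδ v ≠ 0 → paramθ v ∈ U → ∀ r s,
      DifferentiableAt ℝ (fun v => D.C (paramδ v) (paramθ v) r s) v := fun v h1 h2 =>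
    D.differentiableAt_C h1 (fun r i => (hB r i).differentiableAt (hU.mem_nhds h2))
      fun i j => (hK i j).differentiableAt (hU.mem_nhds h2)
  have hd : (D.C δ θ).det ≠ 0 := (lowRankCov_isUnit_det (D.B θ) hKp hδ).ne_zero
  have hC0 := hC (param γ δ θ) hδ.ne' hθ
  have e1 : ∀ᶠ v in 𝓝 (param γ δ θ), paramδ v ≠ 0 :=
    
    ContinuousAt.eventually_ne (g := fun v : EuclideanSpace ℝ (ParamIdx p q) => paramδ v)
      (Continuous.continuousAt (by fun_prop)) hδ.ne'
  have e2 : ∀ᶠ v in 𝓝 (param γ δ θ), paramθ v ∈ U :=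
    (differentiable_paramθ.continuous.continuousAt (x := param γ δ θ)).eventually
      (hU.mem_nhds hθ)
  have e3 : ∀ᶠ v in 𝓝 (param γ δ θ), (D.C (paramδ v) (paramθ v)).det ≠ 0 :=
    (differentiableAt_det (A := fun v => D.C (paramδ v) (paramθ v)) hC0).continuousAt.eventually_ne hd
  -- A second differentiation needs the gradient formula on a whole neighbourhood, whence the
  -- openness of U and the persistence of δ ≠ 0 and det C ≠ 0 nearby.
  have hev : partialDeriv (Sum.inl b) (D.negLogLikVec X z) =ᶠ[𝓝 (param γ δ θ)] D.gradγ X z b := by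
    filter_upwards [e1, e2, e3] with v h1 h2 h3
    exact partialDeriv_negLogLikVec (hC v h1 h2) h3 b
  have h1 : partialDeriv (Sum.inl a) (partialDeriv (Sum.inl b) (D.negLogLikVec X z)) (param γ δ θ) =
      partialDeriv (Sum.inl a) (D.gradγ X z b) (param γ δ θ) := by
    unfold partialDeriv at hev ⊢
    rw [hev.fderiv_eq]
  rw [h1]
  exact partialDeriv_gradγ hC0 hd (lowRankCov_inv_transpose _ hKp hδ) a b


/-- The assumption on the expected Hessian bounds the second moments of the covariates below. -/
lemma secondMoment_ge {Ω : Type*} [MeasurableSpace Ω] {P : Measure Ω} [IsProbabilityMeasure P]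
    {ν : Measure (EuclideanSpace ℝ (Fin p))} [IsFiniteMeasure ν] (hν : IsSubGaussianLaw ν)
    {x : D.Obs → Ω → EuclideanSpace ℝ (Fin p)} (hx : ∀ r, HasLaw (x r) ν P)
    {X : Ω → Matrix D.Obs (Fin p) ℝ} (hX : ∀ ω, X ω = Matrix.of fun r a => x r ω a)
    {z : Ω → D.Obs → ℝ} {γ : EuclideanSpace ℝ (Fin p)} {δ : ℝ}
    {θ : EuclideanSpace ℝ (Fin q)} (hδ : 0 < δ) (hKp : (D.K θ).PosSemidef)
    {U : Set (EuclideanSpace ℝ (Fin q))} (hU : IsOpen U) (hθ : θ ∈ U)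
    (hB : ∀ r i, DifferentiableOn ℝ (fun t => D.B t r i) U)
    (hK : ∀ i j, DifferentiableOn ℝ (fun t => D.K t i j) U) (hN : 0 < D.N) {lam : ℝ}
    (hH : (D.scaledHess P X z γ δ θ - lam • 1).PosDef) (u : Fin p → ℝ) :
    lam / δ * vnorm u ^ 2 ≤ u ⬝ᵥ secondMoment ν *ᵥ u := by
  have hN0 : (0 : ℝ) < D.N := Nat.cast_pos.2 hN
  have hmem : ∀ r a, MemLp (fun ω => X ω r a) 2 P := fun r a => by
    have h : MemLp (fun y : EuclideanSpace ℝ (Fin p) => y a) 2 ν := by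
      simpa using hν.memLp_coord 2 a
    rw [← (hx r).map_eq] at h
    simp only [hX, Matrix.of_apply]
    exact h.comp_of_map (hx r).aemeasurable
  have hint : ∀ r s a b, Integrable (fun ω => X ω r a * X ω s b) P := fun r s a b =>
    (hmem r a).integrable_mul (hmem s b)
  have hmom : ∀ r a b, ∫ ω, X ω r a * X ω r b ∂P = secondMoment ν a b := fun r a b => by
    have := (hx r).integral_comp (f := fun y : EuclideanSpace ℝ (Fin p) => y a * y b)
      (Continuous.aestronglyMeasurable (by fun_prop))
    simpa [hX, secondMoment] using this
  set A := (D.C δ θ)⁻¹ with hA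
  have hexp : ∀ a b, D.expHess P X z γ δ θ (Sum.inl a) (Sum.inl b) =
      ∫ ω, (fun r => X ω r a) ⬝ᵥ A *ᵥ (fun r => X ω r b) ∂P := fun a b => by
    unfold expHess
    exact integral_congr_ae (ae_of_all _ fun ω =>
      partialDeriv_partialDeriv_negLogLikVec hδ hKp hU hθ hB hK a b)
  have hint2 : ∀ a b, Integrable (fun ω => (fun r => X ω r a) ⬝ᵥ A *ᵥ (fun r => X ω r b)) P :=
    fun a b => by
      simp only [dotProduct, Matrix.mulVec, Finset.mul_sum]
      refine integrable_finsetSum _ fun r _ => integrable_finsetSum _ fun s _ => ?_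
      refine ((hint r s a b).const_mul (A r s)).congr (ae_of_all _ fun ω => ?_)
      simp only; ring
  have hquad : ∀ ω, ∑ a, ∑ b, u a * u b * ((fun r => X ω r a) ⬝ᵥ A *ᵥ (fun r => X ω r b)) =
      (X ω *ᵥ u) ⬝ᵥ A *ᵥ (X ω *ᵥ u) := fun ω => by
    have e : X ω *ᵥ u = ∑ a, u a • fun r => X ω r a := by
      ext r; simp [Matrix.mulVec, dotProduct, mul_comm]
    rw [e, Matrix.mulVec_sum, sum_dotProduct]
    refine Finset.sum_congr rfl fun a _ => ?_
    rw [dotProduct_sum]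
    refine Finset.sum_congr rfl fun b _ => ?_
    rw [Matrix.mulVec_smul, dotProduct_smul, smul_dotProduct, smul_eq_mul, smul_eq_mul]
    ring
  have hsq : ∀ ω, vnorm (X ω *ᵥ u) ^ 2 = ∑ r, ∑ a, ∑ b, u a * u b * (X ω r a * X ω r b) := fun ω => by
    rw [vnorm_sq]
    simp only [dotProduct, Matrix.mulVec]
    simp_rw [Finset.sum_mul_sum]
    exact Finset.sum_congr rfl fun r _ => Finset.sum_congr rfl fun a _ =>
      Finset.sum_congr rfl fun b _ => by ring
  have hintsq : Integrable (fun ω => vnorm (X ω *ᵥ u) ^ 2) P := by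
    simp_rw [hsq]
    exact integrable_finsetSum _ fun r _ => integrable_finsetSum _ fun a _ =>
      integrable_finsetSum _ fun b _ => (hint r r a b).const_mul _
  have hEsq : ∫ ω, vnorm (X ω *ᵥ u) ^ 2 ∂P = D.N * (u ⬝ᵥ secondMoment ν *ᵥ u) := by
    simp_rw [hsq]
    rw [integral_finsetSum _ fun r _ => integrable_finsetSum _ fun a _ =>
      integrable_finsetSum _ fun b _ => (hint r r a b).const_mul _]
    have : ∀ r, ∫ ω, ∑ a, ∑ b, u a * u b * (X ω r a * X ω r b) ∂P =
        u ⬝ᵥ secondMoment ν *ᵥ u := fun r => by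
      rw [integral_finsetSum _ fun a _ =>
        integrable_finsetSum _ fun b _ => (hint r r a b).const_mul _]
      simp only [dotProduct, Matrix.mulVec, Finset.mul_sum]
      refine Finset.sum_congr rfl fun a _ => ?_
      rw [integral_finsetSum _ fun b _ => (hint r r a b).const_mul _]
      refine Finset.sum_congr rfl fun b _ => ?_
      rw [integral_const_mul, hmom]; ring
    simp only [this, Finset.sum_const, Finset.card_univ, card_obs, nsmul_eq_mul]
  have hEquad : ∑ a, ∑ b, u a * u b * D.expHess P X z γ δ θ (Sum.inl a) (Sum.inl b) =
      ∫ ω, (X ω *ᵥ u) ⬝ᵥ A *ᵥ (X ω *ᵥ u) ∂P := by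
    simp_rw [← hquad]
    rw [integral_finsetSum _ fun a _ => integrable_finsetSum _ fun b _ => (hint2 a b).const_mul _]
    refine Finset.sum_congr rfl fun a _ => ?_
    rw [integral_finsetSum _ fun b _ => (hint2 a b).const_mul _]
    refine Finset.sum_congr rfl fun b _ => ?_
    rw [integral_const_mul, hexp]
  have hintq : Integrable (fun ω => (X ω *ᵥ u) ⬝ᵥ A *ᵥ (X ω *ᵥ u)) P := by
    simp_rw [← hquad]
    exact integrable_finsetSum _ fun a _ => integrable_finsetSum _ fun b _ =>
      (hint2 a b).const_mul _
  -- Since ‖C⁻¹‖ ≤ δ, the Hessian form is at most δ times the mean of |Xu|², so a lower bound for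
  -- the former passes to the latter.
  have hle : ∫ ω, (X ω *ᵥ u) ⬝ᵥ A *ᵥ (X ω *ᵥ u) ∂P ≤ δ * (D.N * (u ⬝ᵥ secondMoment ν *ᵥ u)) := by
    rw [← hEsq, ← integral_const_mul]
    refine integral_mono hintq (hintsq.const_mul _) fun ω => ?_
    refine (le_abs_self _).trans ((abs_dotProduct_mulVec_le _ _ _).trans ?_)
    have h1 : ‖A‖ ≤ δ := norm_lowRankCov_inv_le _ hKp hδ
    have h2 := vnorm_nonneg (X ω *ᵥ u)
    calc _ ≤ δ * vnorm (X ω *ᵥ u) * vnorm (X ω *ᵥ u) := by gcongr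
      _ = _ := by ring
  -- The principal γγ submatrix inherits the eigenvalue bound.
  have hpos := hH.posSemidef.submatrix Sum.inl
  have hlow : lam * vnorm u ^ 2 ≤ 1 / (D.N : ℝ) *
      ∑ a, ∑ b, u a * u b * D.expHess P X z γ δ θ (Sum.inl a) (Sum.inl b) := by
    have h1 := dotProduct_mulVec_self_nonneg hpos u
    have h2 : (D.scaledHess P X z γ δ θ - lam • 1).submatrix Sum.inl Sum.inl =
        Matrix.of (fun a b => 1 / (D.N : ℝ) * D.expHess P X z γ δ θ (Sum.inl a) (Sum.inl b)) -
          lam • (1 : Matrix (Fin p) (Fin p) ℝ) := by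
      ext a b
      simp [scaledHess, Matrix.one_apply]
    rw [h2, Matrix.sub_mulVec, dotProduct_sub, Matrix.smul_mulVec, dotProduct_smul,
      Matrix.one_mulVec, ← vnorm_sq, smul_eq_mul, sub_nonneg] at h1
    refine h1.trans (le_of_eq ?_)
    simp only [dotProduct, Matrix.mulVec, Finset.mul_sum, Matrix.of_apply]
    exact Finset.sum_congr rfl fun a _ => Finset.sum_congr rfl fun b _ => by ring
  rw [hEquad] at hlow
  have h3 : lam * vnorm u ^ 2 ≤ δ * (u ⬝ᵥ secondMoment ν *ᵥ u) := by
    refine hlow.trans ((mul_le_mul_of_nonneg_left hle (by positivity)).trans (le_of_eq ?_))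
    field_simp
  rw [div_mul_eq_mul_div, div_le_iff₀ hδ, mul_comm _ δ]
  exact h3

end LowRankDesign

end Hessian

/-! ### Deterministic consequences of the three likelihood comparisons -/

section Optimality

open scoped Matrix.Norms.L2Operator

variable {ι κ : Type*} [Fintype ι] [DecidableEq ι] [Fintype κ] [DecidableEq κ]

/-- The optimality of the regression coefficients bounds the estimation error by the score. -/
lemma mulVec_sq_le_of_quadForm_le {p : ℕ} {C : Matrix ι ι ℝ} (hC : C.PosDef) {Λ s c : ℝ}
    (hΛ : ‖C‖ ≤ Λ) {X : Matrix ι (Fin p) ℝ} {e : ι → ℝ} {u : Fin p → ℝ} (hc : 0 < c)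
    (hX : c * vnorm u ^ 2 ≤ vnorm (X *ᵥ u) ^ 2) (hs0 : 0 ≤ s)
    (hs : ∀ a, |(fun r => X r a) ⬝ᵥ C⁻¹ *ᵥ e| ≤ s)
    (h : (e - X *ᵥ u) ⬝ᵥ C⁻¹ *ᵥ (e - X *ᵥ u) ≤ e ⬝ᵥ C⁻¹ *ᵥ e) :
    vnorm u ≤ 2 * Λ * p * s / c ∧ vnorm (X *ᵥ u) ^ 2 ≤ (2 * Λ * p * s) ^ 2 / c := by
  have hΛ0 : 0 ≤ Λ := (norm_nonneg _).trans hΛ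
  have hsym : (C⁻¹)ᵀ = C⁻¹ := transpose_eq_of_posSemidef hC.inv.posSemidef
  have h1 : e ⬝ᵥ C⁻¹ *ᵥ (X *ᵥ u) = (X *ᵥ u) ⬝ᵥ C⁻¹ *ᵥ e := by
    rw [Matrix.dotProduct_mulVec, ← Matrix.mulVec_transpose, hsym, dotProduct_comm]
  have h2 : (X *ᵥ u) ⬝ᵥ C⁻¹ *ᵥ (X *ᵥ u) ≤ 2 * ((X *ᵥ u) ⬝ᵥ C⁻¹ *ᵥ e) := by
    simp only [Matrix.mulVec_sub, dotProduct_sub, sub_dotProduct, h1] at h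
    linarith
  have h3 : (X *ᵥ u) ⬝ᵥ C⁻¹ *ᵥ e ≤ p * (vnorm u * s) := by
    have e1 : X *ᵥ u = ∑ a, u a • fun r => X r a := by
      ext r; simp [Matrix.mulVec, dotProduct, mul_comm]
    rw [e1, sum_dotProduct]
    calc _ ≤ ∑ _a : Fin p, vnorm u * s := Finset.sum_le_sum fun a _ => by
          rw [smul_dotProduct, smul_eq_mul]
          refine (le_abs_self _).trans ?_
          rw [abs_mul]
          exact mul_le_mul (abs_apply_le_vnorm u a) (hs a) (abs_nonneg _) (vnorm_nonneg _)
      _ = _ := by simp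
  have h4 := vnorm_sq_le_inv hC (X *ᵥ u)
  -- The bound is linear in |u| on the right and, by the Gram inequality, quadratic on the left.
  -- This bounds |u|, and reinserting it bounds |Xu|².
  have h5 : vnorm (X *ᵥ u) ^ 2 ≤ 2 * Λ * p * s * vnorm u := by
    have h6 : 0 ≤ (X *ᵥ u) ⬝ᵥ C⁻¹ *ᵥ (X *ᵥ u) :=
      dotProduct_mulVec_self_nonneg hC.inv.posSemidef _
    calc _ ≤ Λ * ((X *ᵥ u) ⬝ᵥ C⁻¹ *ᵥ (X *ᵥ u)) := h4.trans (by gcongr)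
      _ ≤ Λ * (2 * (p * (vnorm u * s))) := by gcongr; linarith
      _ = _ := by ring
  have hv := vnorm_nonneg u
  have h6 : vnorm u ≤ 2 * Λ * p * s / c := by
    rw [le_div_iff₀ hc]
    rcases hv.eq_or_lt with h0 | h0
    · rw [← h0, zero_mul]; positivity
    · have := hX.trans h5
      nlinarith
  refine ⟨h6, h5.trans ?_⟩
  calc _ ≤ 2 * Λ * p * s * (2 * Λ * p * s / c) := by gcongr
    _ = _ := by ring

variable {B B₀ : Matrix ι κ ℝ} {K K₀ : Matrix κ κ ℝ} {δ δ₀ a b M : ℝ}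

/-- Separates the two scales: an ordinary inner product in N dimensions with coefficient δ, and a
form in the m-dimensional projections. -/
lemma dotProduct_lowRankCov_inv (B : Matrix ι κ ℝ) (hK : K.PosSemidef) (hδ : 0 < δ) (u v : ι → ℝ) :
    u ⬝ᵥ (lowRankCov B K δ)⁻¹ *ᵥ v =
      δ * (u ⬝ᵥ v) - (Bᵀ *ᵥ u) ⬝ᵥ lowRankCore B K δ *ᵥ (Bᵀ *ᵥ v) := by
  rw [lowRankCov_inv B hK hδ, Matrix.sub_mulVec, dotProduct_sub, Matrix.smul_mulVec,
    Matrix.one_mulVec, dotProduct_smul, smul_eq_mul, ← Matrix.mulVec_mulVec, ← Matrix.mulVec_mulVec,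
    Matrix.dotProduct_mulVec u, ← Matrix.mulVec_transpose]

/-- The optimality of the nugget parameter. -/
lemma sub_one_sub_log_le_of_optimal (hKp : K.PosSemidef) (hB : ‖B‖ ≤ M) (hK : ‖K‖ ≤ M) (ha : 0 < a)
    (hδ : a ≤ δ) (hδb : δ ≤ b) (hδ₀ : a ≤ δ₀) (hδ₀b : δ₀ ≤ b) {r : ι → ℝ} {W ρ : ℝ}
    (hW : vnorm (Bᵀ *ᵥ r) ^ 2 ≤ W) (hr : |vnorm r ^ 2 - Fintype.card ι * δ₀⁻¹| ≤ ρ)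
    (hopt : Real.log (lowRankCov B K δ).det + r ⬝ᵥ (lowRankCov B K δ)⁻¹ *ᵥ r ≤
      Real.log (lowRankCov B K δ₀).det + r ⬝ᵥ (lowRankCov B K δ₀)⁻¹ *ᵥ r) :
    Fintype.card ι * (δ / δ₀ - 1 - Real.log (δ / δ₀)) ≤
      2 * (Fintype.card κ * (b * M ^ 3 + a⁻¹ * (coreBound b M * M ^ 2)) + coreBound b M * W) +
        ρ * b := by
  have hp := ha.trans_le hδ
  have hp₀ := ha.trans_le hδ₀
  have l1 := abs_le.1 (abs_log_det_add_le hKp hB hK ha hδ hδb)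
  have l2 := abs_le.1 (abs_log_det_add_le hKp hB hK ha hδ₀ hδ₀b)
  rw [dotProduct_lowRankCov_inv B hKp hp, dotProduct_lowRankCov_inv B hKp hp₀, ← vnorm_sq] at hopt
  have hF : ∀ δ, 0 < δ → δ ≤ b →
      |(Bᵀ *ᵥ r) ⬝ᵥ lowRankCore B K δ *ᵥ (Bᵀ *ᵥ r)| ≤ coreBound b M * W := fun δ h h' => by
    have hn := norm_lowRankCore_le hKp hB hK h h'
    have h0 := (norm_nonneg _).trans hn
    refine (abs_dotProduct_mulVec_le _ _ _).trans ?_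
    rw [mul_assoc, ← sq]
    gcongr
  have f1 := abs_le.1 (hF δ hp hδb)
  have f2 := abs_le.1 (hF δ₀ hp₀ hδ₀b)
  rw [Real.log_div hp.ne' hp₀.ne']
  -- Both values lie in (0, b]. This is the factor by which the error of |r|² around N/δ₀ enters.
  have h1 : |δ - δ₀| ≤ b := abs_le.2 ⟨by linarith, by linarith⟩
  have h2 : |(δ - δ₀) * (vnorm r ^ 2 - Fintype.card ι * δ₀⁻¹)| ≤ ρ * b := by
    rw [abs_mul, mul_comm]
    exact mul_le_mul hr h1 (abs_nonneg _) ((abs_nonneg _).trans hr)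
  have h3 := (abs_le.1 h2).1
  have h4 : (Fintype.card ι : ℝ) * (δ / δ₀ - 1) = (δ - δ₀) * (Fintype.card ι * δ₀⁻¹) := by
    field_simp
  nlinarith

/-- The optimality of the covariance parameter. -/
lemma frobSq_le_of_optimal (hKp : K.PosSemidef) (hKp₀ : K₀.PosSemidef) (hB : ‖B‖ ≤ M)
    (hK : ‖K‖ ≤ M) (hB₀ : ‖B₀‖ ≤ M) (hK₀ : ‖K₀‖ ≤ M) (ha : 0 < a)
    (hδ : a ≤ δ) (hδb : δ ≤ b) {r : ι → ℝ} {ρ : ℝ}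
    (hq : |(Bᵀ *ᵥ r) ⬝ᵥ lowRankCore B K δ *ᵥ (Bᵀ *ᵥ r) -
      (lowRankCore B K δ * (Bᵀ * lowRankCov B₀ K₀ δ * B)).trace| ≤ ρ)
    (hq₀ : |(B₀ᵀ *ᵥ r) ⬝ᵥ lowRankCore B₀ K₀ δ *ᵥ (B₀ᵀ *ᵥ r) -
      (lowRankCore B₀ K₀ δ * (B₀ᵀ * lowRankCov B₀ K₀ δ * B₀)).trace| ≤ ρ)
    (hopt : Real.log (lowRankCov B K δ).det + r ⬝ᵥ (lowRankCov B K δ)⁻¹ *ᵥ r ≤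
      Real.log (lowRankCov B₀ K₀ δ).det + r ⬝ᵥ (lowRankCov B₀ K₀ δ)⁻¹ *ᵥ r) :
    frobSq (B₀ * K₀ * B₀ᵀ - B * K * Bᵀ) ≤ (a⁻¹ + M * M * M) ^ 2 *
      (1 + √(b * (a⁻¹ + M * M * M))) ^ 2 * (2 * ρ) := by
  have hp := ha.trans_le hδ
  have hL := norm_lowRankCov_le hB hK ha hδ
  have hL₀ := norm_lowRankCov_le hB₀ hK₀ ha hδ
  have hkl := frobSq_sub_le_kl (lowRankCov_posDef B hKp hp) (lowRankCov_posDef B₀ hKp₀ hp)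
    ((norm_lowRankCov_inv_le B hKp hp).trans hδb) hL hL₀
  have hsub : lowRankCov B₀ K₀ δ - lowRankCov B K δ = B₀ * K₀ * B₀ᵀ - B * K * Bᵀ := by
    simp [lowRankCov]
  rw [hsub] at hkl
  refine hkl.trans (mul_le_mul_of_nonneg_left ?_ (by positivity))
  rw [dotProduct_lowRankCov_inv B hKp hp, dotProduct_lowRankCov_inv B₀ hKp₀ hp] at hopt
  set C₀ := lowRankCov B₀ K₀ δ with hC₀
  -- Both traces contain the same δ·tr C₀. With (B₀, K₀) the left side is N, so tr(C⁻¹C₀) - N is a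
  -- difference of two core traces. The hypotheses replace these by the forms in r at a cost of ρ
  -- each, and optimality bounds the divergence by 2ρ.
  have htr : ∀ (B' : Matrix ι κ ℝ) (K' : Matrix κ κ ℝ), K'.PosSemidef →
      ((lowRankCov B' K' δ)⁻¹ * C₀).trace =
        δ * C₀.trace - (lowRankCore B' K' δ * (B'ᵀ * C₀ * B')).trace := fun B' K' h' => by
    rw [lowRankCov_inv B' h' hp, Matrix.sub_mul, Matrix.trace_sub, Matrix.smul_mul, Matrix.one_mul,
      Matrix.trace_smul, smul_eq_mul, Matrix.mul_assoc, Matrix.mul_assoc, Matrix.trace_mul_comm B',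
      Matrix.mul_assoc, Matrix.mul_assoc]
  have t1 := htr B K hKp
  have t2 := htr B₀ K₀ hKp₀
  rw [← hC₀, Matrix.nonsing_inv_mul _ (lowRankCov_isUnit_det B₀ hKp₀ hp), Matrix.trace_one] at t2
  have q1 := abs_le.1 hq
  have q2 := abs_le.1 hq₀
  rw [t1]
  linarith

end Optimality

/-! ### Stochastic comparisons: coefficients, nugget, low-rank covariance -/

section Consistency

open scoped Matrix.Norms.L2Operator ENNReal

/-- Every final error bound is a continuous function of a small σ that vanishes at 0; this selects σ
in advance for the prescribed accuracy. -/
lemma exists_pos_apply_le {f : ℝ → ℝ} (hf : Continuous f) (h0 : f 0 = 0) {ε : ℝ} (hε : 0 < ε) :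
    ∃ ρ > 0, f ρ ≤ ε := by
  have h : ∀ᶠ ρ in 𝓝[>] (0 : ℝ), f ρ < ε := by
    have := (hf.tendsto 0).mono_left (nhdsWithin_le_nhds (s := Set.Ioi (0 : ℝ)))
    rw [h0] at this
    exact this.eventually_lt_const hε
  obtain ⟨ρ, hρ, hρ0⟩ := (h.and self_mem_nhdsWithin).exists
  exact ⟨ρ, hρ0, hρ.le⟩

variable {p q : ℕ} {Loc Ω : Type*} [MeasurableSpace Ω] {P : Measure Ω} [IsProbabilityMeasure P]
  {D : ℕ → LowRankDesign q Loc} {S : Set ℝ} {Θ : Set (EuclideanSpace ℝ (Fin q))}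
  {δ₀ a b M : ℝ} {θ₀ : EuclideanSpace ℝ (Fin q)} {e : ∀ k, Ω → EuclideanSpace ℝ (D k).Obs}
  {X : ∀ k, Ω → Matrix (D k).Obs (Fin p) ℝ}

/-- Twice the negative log-likelihood of the residual vector `r`, up to an additive constant. -/
def LowRankDesign.deviance (D : LowRankDesign q Loc) (δ : ℝ) (θ : EuclideanSpace ℝ (Fin q))
    (r : D.Obs → ℝ) : ℝ := Real.log (D.C δ θ).det + r ⬝ᵥ (D.C δ θ)⁻¹ *ᵥ r

/-- A sequence of low-rank models with errors `e` and covariates `X` that satisfies what the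
consistency proof needs: regular designs, Gaussian errors, independent covariates of bounded second
moments, and a nondegenerate Gram matrix. -/
structure IsRegularSequence (P : Measure Ω) (D : ℕ → LowRankDesign q Loc) (S : Set ℝ)
    (Θ : Set (EuclideanSpace ℝ (Fin q))) (δ₀ : ℝ) (θ₀ : EuclideanSpace ℝ (Fin q)) (a b M : ℝ)
    (e : ∀ k, Ω → EuclideanSpace ℝ (D k).Obs) (X : ∀ k, Ω → Matrix (D k).Obs (Fin p) ℝ) :
    Prop where
  compactS : IsCompact S
  compactΘ : IsCompact Θ
  pos : 0 < a
  le_of_mem : ∀ δ ∈ S, a ≤ δ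
  ge_of_mem : ∀ δ ∈ S, δ ≤ b
  one_le : 1 ≤ M
  memS : δ₀ ∈ S
  memΘ : θ₀ ∈ Θ
  posK : ∀ k, ∀ θ ∈ Θ, ((D k).K θ).PosSemidef
  reg : ∀ᶠ k in atTop, IsRegularOn (D k) Θ M
  tendsto_m : Tendsto (fun k => (D k).m) atTop atTop
  tendsto_N : Tendsto (fun k => (D k).N) atTop atTop
  isLittleO : (fun k => ((D k).m : ℝ)) =o[atTop] (fun k => ((D k).N : ℝ))
  law_e : ∀ k, HasLaw (e k) (multivariateGaussian 0 ((D k).C δ₀ θ₀)) P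
  meas_X : ∀ k i, AEMeasurable (fun ω r => X k ω r i) P
  indep : ∀ k i, IndepFun (fun ω r => X k ω r i) (e k) P
  moment : ∃ c : ℝ, ∀ i k r, ∫⁻ ω, ENNReal.ofReal (X k ω r i ^ 2) ∂P ≤ ENNReal.ofReal c
  column : ∃ Y : ℝ, 0 ≤ Y ∧ ∀ i, ∀ᶠ x in whp P, vnorm (fun r => X x.1 x.2 r i) ≤ Y * √(D x.1).N
  gram : ∃ c : ℝ, 0 < c ∧ ∀ᶠ x in whp P, ∀ u : Fin p → ℝ,
    c * (D x.1).N * vnorm u ^ 2 ≤ vnorm (X x.1 x.2 *ᵥ u) ^ 2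

namespace IsRegularSequence

lemma eventually_basic (h : IsRegularSequence P D S Θ δ₀ θ₀ a b M e X) {ρ : ℝ} (hρ : 0 < ρ) :
    ∀ᶠ x in whp P, IsRegularOn (D x.1) Θ M ∧ 0 < (D x.1).m ∧ 0 < (D x.1).N ∧
      ((D x.1).m : ℝ) ≤ ρ * (D x.1).N := by
  refine eventually_whp_of_eventually (p := fun k => IsRegularOn (D k) Θ M ∧ 0 < (D k).m ∧
    0 < (D k).N ∧ ((D k).m : ℝ) ≤ ρ * (D k).N) ?_
  filter_upwards [h.reg, h.tendsto_m.eventually_gt_atTop 0, h.tendsto_N.eventually_gt_atTop 0,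
    h.isLittleO.def hρ] with k h1 h2 h3 h4
  rw [Real.norm_of_nonneg (Nat.cast_nonneg _), Real.norm_of_nonneg (Nat.cast_nonneg _)] at h4
  exact ⟨h1, h2, h3, h4⟩

lemma pos₀ (h : IsRegularSequence P D S Θ δ₀ θ₀ a b M e X) : 0 < δ₀ :=
  h.pos.trans_le (h.le_of_mem _ h.memS)

lemma eventually_core (h : IsRegularSequence P D S Θ δ₀ θ₀ a b M e X) :
    ∀ᶠ k in atTop, ∀ t ∈ S ×ˢ Θ,
      (lowRankCore ((D k).B t.2) ((D k).K t.2) t.1)ᵀ =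
        lowRankCore ((D k).B t.2) ((D k).K t.2) t.1 ∧
      ‖lowRankCore ((D k).B t.2) ((D k).K t.2) t.1‖ ≤ coreBound b M ∧
      ∀ t' ∈ S ×ˢ Θ, ‖lowRankCore ((D k).B t.2) ((D k).K t.2) t.1 -
        lowRankCore ((D k).B t'.2) ((D k).K t'.2) t'.1‖ ≤ coreLip a b M * M * dist t t' :=
  LowRankDesign.isRegular_core h.posK h.pos h.le_of_mem h.ge_of_mem h.one_le h.reg

lemma b_pos (h : IsRegularSequence P D S Θ δ₀ θ₀ a b M e X) : 0 < b :=
  h.pos₀.trans_le (h.ge_of_mem _ h.memS)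

lemma coreBound_nonneg (h : IsRegularSequence P D S Θ δ₀ θ₀ a b M e X) : 0 ≤ coreBound b M := by
  have := h.b_pos
  have := h.one_le
  have : 0 ≤ M := by linarith
  unfold coreBound; positivity

lemma coreLip_nonneg (h : IsRegularSequence P D S Θ δ₀ θ₀ a b M e X) : 0 ≤ coreLip a b M * M := by
  have := h.b_pos
  have := h.pos
  have : 0 ≤ M := by linarith [h.one_le]
  unfold coreLip invLip; positivity

/-- The Woodbury identity splits the score into δ times the inner product of a column with e and a
core form in the projections; each takes half of the tolerance, with 1/b compensating δ ≤ b. -/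
lemma eventually_score (h : IsRegularSequence P D S Θ δ₀ θ₀ a b M e X) {ρ : ℝ} (hρ : 0 < ρ) :
    ∀ᶠ x in whp P, ∀ i, ∀ δ ∈ S, ∀ θ ∈ Θ,
      |(fun r => X x.1 x.2 r i) ⬝ᵥ ((D x.1).C δ θ)⁻¹ *ᵥ (e x.1 x.2).ofLp| ≤
        ρ * (√(D x.1).m * √(D x.1).N) := by
  obtain ⟨c, hcX⟩ := h.moment
  obtain ⟨Y, hY, hYX⟩ := h.column
  have hM : 0 ≤ M := by linarith [h.one_le]
  have hb := h.b_pos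
  have hK₀ : ∀ k, ((D k).K θ₀).PosSemidef := fun k => h.posK k _ h.memΘ
  rw [eventually_all]
  intro i
  have hρ1 : 0 < ρ / 2 / b := by positivity
  have e1 := eventually_whp_bilin (y := fun k ω r => X k ω r i) h.memΘ h.pos₀ h.reg hK₀
    h.tendsto_m h.tendsto_N h.law_e (fun k => h.meas_X k i) (fun k => h.indep k i)
    (fun k r => hcX i k r) (fun k => 1) (v := 1) (Eventually.of_forall fun k => norm_one_le) hρ1
  have e2 := eventually_whp_core_bilin (y := fun k ω r => X k ω r i) h.compactS h.compactΘ h.memΘ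
    h.pos₀ hM h.reg hK₀ h.tendsto_m h.tendsto_N h.law_e (fun k => h.meas_X k i)
    (fun k => h.indep k i) (fun k r => hcX i k r) hY (hYX i)
    (fun k t => lowRankCore ((D k).B t.2) ((D k).K t.2) t.1) h.coreBound_nonneg h.coreLip_nonneg
    h.eventually_core (half_pos hρ)
  filter_upwards [e1, e2, h.eventually_basic one_pos] with x h1 h2 h3 δ hδ θ hθ
  obtain ⟨-, hm, hN, -⟩ := h3
  have hpos : 0 < √((D x.1).m : ℝ) * √(D x.1).N :=
    mul_pos (Real.sqrt_pos.2 (Nat.cast_pos.2 hm)) (Real.sqrt_pos.2 (Nat.cast_pos.2 hN))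
  have h2' := h2 (δ, θ) ⟨hδ, hθ⟩
  rw [abs_div, abs_of_pos hpos, div_le_iff₀ hpos, Matrix.one_mulVec] at h1
  rw [abs_div, abs_of_pos hpos, div_le_iff₀ hpos] at h2'
  have hδ0 := h.pos.trans_le (h.le_of_mem _ hδ)
  rw [LowRankDesign.C_eq, dotProduct_lowRankCov_inv _ (h.posK _ _ hθ) hδ0]
  refine (abs_sub _ _).trans ?_
  rw [abs_mul, abs_of_pos hδ0]
  have h4 : δ * |(fun r => X x.1 x.2 r i) ⬝ᵥ (e x.1 x.2).ofLp| ≤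
      b * (ρ / 2 / b * (√(D x.1).m * √(D x.1).N)) :=
    mul_le_mul (h.ge_of_mem _ hδ) h1 (abs_nonneg _) hb.le
  have h5 : b * (ρ / 2 / b * (√(D x.1).m * √(D x.1).N)) =
      ρ / 2 * (√(D x.1).m * √(D x.1).N) := by field_simp
  have h6 : |((D x.1).B θ)ᵀ *ᵥ (fun r => X x.1 x.2 r i) ⬝ᵥ
      lowRankCore ((D x.1).B θ) ((D x.1).K θ) δ *ᵥ (((D x.1).B θ)ᵀ *ᵥ (e x.1 x.2).ofLp)| ≤
      ρ / 2 * (√(D x.1).m * √(D x.1).N) := h2'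
  linarith

/-- The uniform quadratic-form law with the identity as core: |B(θ)ᵀe|² is within m of its mean,
which is at most M²Λm. Unlike the chaining estimate, this yields one constant valid with probability
tending to one. -/
lemma exists_eventually_projErr (h : IsRegularSequence P D S Θ δ₀ θ₀ a b M e X) :
    ∃ A : ℝ, 0 ≤ A ∧ ∀ᶠ x in whp P, ∀ θ ∈ Θ,
      vnorm (projErr (D x.1) θ (e x.1 x.2)) ≤ A * √(D x.1).m := by
  have hM : 0 ≤ M := by linarith [h.one_le]
  have hδ₀ := h.pos₀
  set Λ := δ₀⁻¹ + M * M * M with hΛ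
  have hΛ0 : 0 ≤ Λ := by positivity
  have hK₀ : ∀ k, ((D k).K θ₀).PosSemidef := fun k => h.posK k _ h.memΘ
  have e1 := eventually_whp_quadForm (S := {δ₀}) isCompact_singleton h.compactΘ h.memΘ hδ₀ hM h.reg
    hK₀ h.tendsto_m h.law_e (fun k _ => 1) (MF := 1) (LF := 0) zero_le_one le_rfl
    (Eventually.of_forall fun k t _ => ⟨Matrix.transpose_one, norm_one_le, fun t' _ => by simp⟩)
    one_pos
  refine ⟨√(M ^ 2 * Λ + 1), Real.sqrt_nonneg _, ?_⟩
  filter_upwards [e1, h.eventually_basic one_pos] with x h1 h2 θ hθ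
  obtain ⟨hk, hm, hN, -⟩ := h2
  have h3 := (abs_le.1 (h1 (δ₀, θ) ⟨rfl, hθ⟩)).2
  rw [Matrix.one_mulVec, Matrix.one_mul, ← vnorm_sq, one_mul] at h3
  have hC : ‖(D x.1).C δ₀ θ₀‖ ≤ Λ :=
    norm_lowRankCov_le (hk.normB _ h.memΘ) (hk.normK _ h.memΘ) hδ₀ le_rfl
  have h4 := abs_trace_le (((D x.1).B θ)ᵀ * (D x.1).C δ₀ θ₀ * (D x.1).B θ)
  have h5 := norm_sandwich_le (hk.normB _ hθ) hC
  rw [Fintype.card_fin] at h4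
  have h6 : ((D x.1).m : ℝ) * ‖((D x.1).B θ)ᵀ * (D x.1).C δ₀ θ₀ * (D x.1).B θ‖ ≤
      (D x.1).m * (M ^ 2 * Λ) := by gcongr
  rw [← Real.sqrt_mul (by positivity)]
  refine Real.le_sqrt_of_sq_le ?_
  have h7 := (le_abs_self _).trans h4
  simp only at h3
  linarith

variable {u : ℕ → Ω → Fin p → ℝ} {δh : ℕ → Ω → ℝ} {θh : ℕ → Ω → EuclideanSpace ℝ (Fin q)}

/-- Consistency of the regression coefficients, with the rate of the fitted values. -/
lemma eventually_coef_le (h : IsRegularSequence P D S Θ δ₀ θ₀ a b M e X)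
    (hmem : ∀ᶠ x in whp P, δh x.1 x.2 ∈ S ∧ θh x.1 x.2 ∈ Θ)
    (hopt : ∀ᶠ x in whp P, (D x.1).deviance (δh x.1 x.2) (θh x.1 x.2)
      ((e x.1 x.2).ofLp - X x.1 x.2 *ᵥ u x.1 x.2) ≤
        (D x.1).deviance (δh x.1 x.2) (θh x.1 x.2) (e x.1 x.2).ofLp) {ρ : ℝ} (hρ : 0 < ρ) :
    ∀ᶠ x in whp P, vnorm (u x.1 x.2) ≤ ρ ∧
      vnorm (X x.1 x.2 *ᵥ u x.1 x.2) ≤ ρ * √(D x.1).m := by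
  obtain ⟨c, hc, hgram⟩ := h.gram
  set Λ := a⁻¹ + M * M * M with hΛ
  -- With score at most σ√m√N and Gram constant cN, the bounds become (2Λpσ/c)√(m/N) for |u| and
  -- (2Λpσ/√c)√m for |Xu|; σ makes both coefficients at most ρ.
  obtain ⟨σ, hσ0, hσ⟩ := exists_pos_apply_le (f := fun σ => |2 * Λ * p * σ / c| +
    |2 * Λ * p * σ / √c|) (by fun_prop) (by simp) hρ
  filter_upwards [hmem, hopt, hgram, h.eventually_score hσ0, h.eventually_basic one_pos]
    with x h1 h2 h3 h4 h5
  obtain ⟨hk, hm, hN, hmN⟩ := h5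
  have hm0 : (0 : ℝ) < (D x.1).m := Nat.cast_pos.2 hm
  have hN0 : (0 : ℝ) < (D x.1).N := Nat.cast_pos.2 hN
  have hδ := h.le_of_mem _ h1.1
  have hKp := h.posK x.1 _ h1.2
  have hL := norm_lowRankCov_le (hk.normB _ h1.2) (hk.normK _ h1.2) h.pos hδ
  have hsm : √((D x.1).m : ℝ) ≤ √(D x.1).N := Real.sqrt_le_sqrt (by linarith)
  have hsm0 := Real.sqrt_pos.2 hm0
  have hsN0 := Real.sqrt_pos.2 hN0
  have hsq := Real.sq_sqrt hm0.le
  have hsqN := Real.sq_sqrt hN0.le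
  obtain ⟨g1, g2⟩ := mulVec_sq_le_of_quadForm_le (lowRankCov_posDef _ hKp (h.pos.trans_le hδ)) hL
    (c := c * (D x.1).N) (by positivity) (h3 (u x.1 x.2))
    (s := σ * (√(D x.1).m * √(D x.1).N)) (by positivity) (fun i => h4 i _ h1.1 _ h1.2)
    (le_of_add_le_add_left h2)
  have a1 := le_abs_self (2 * Λ * p * σ / c)
  have a2 := le_abs_self (2 * Λ * p * σ / √c)
  have a1' := abs_nonneg (2 * Λ * p * σ / c)
  have a2' := abs_nonneg (2 * Λ * p * σ / √c)
  constructor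
  · refine g1.trans ?_
    have : 2 * Λ * p * (σ * (√(D x.1).m * √(D x.1).N)) / (c * (D x.1).N) =
        2 * Λ * p * σ / c * (√(D x.1).m / √(D x.1).N) := by
      rw [← hsqN]; field_simp; rw [Real.sqrt_sq hsN0.le]
    rw [this]
    have hr : √((D x.1).m : ℝ) / √(D x.1).N ≤ 1 := (div_le_one hsN0).2 hsm
    calc _ ≤ |2 * Λ * p * σ / c| * 1 := by gcongr
      _ ≤ ρ := by linarith
  · have g3 : vnorm (X x.1 x.2 *ᵥ u x.1 x.2) ^ 2 ≤ (ρ * √(D x.1).m) ^ 2 := by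
      refine g2.trans ?_
      have : (2 * Λ * p * (σ * (√(D x.1).m * √(D x.1).N))) ^ 2 / (c * (D x.1).N) =
          (2 * Λ * p * σ / √c) ^ 2 * (D x.1).m := by
        rw [div_pow, Real.sq_sqrt hc.le, mul_pow, mul_pow σ, mul_pow √_, hsq, hsqN]
        field_simp
      rw [this, mul_pow, hsq, ← sq_abs]
      gcongr
      linarith
    exact (pow_le_pow_iff_left₀ (vnorm_nonneg _) (by positivity) two_ne_zero).1 g3

/-- Consistency of the nugget parameter. -/
lemma eventually_nugget_le (h : IsRegularSequence P D S Θ δ₀ θ₀ a b M e X)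
    (hmem : ∀ᶠ x in whp P, δh x.1 x.2 ∈ S ∧ θh x.1 x.2 ∈ Θ)
    (hcoef : ∀ ρ > 0, ∀ᶠ x in whp P, vnorm (X x.1 x.2 *ᵥ u x.1 x.2) ≤ ρ * √(D x.1).m)
    (hopt : ∀ᶠ x in whp P, (D x.1).deviance (δh x.1 x.2) (θh x.1 x.2)
      ((e x.1 x.2).ofLp - X x.1 x.2 *ᵥ u x.1 x.2) ≤
        (D x.1).deviance δ₀ (θh x.1 x.2) ((e x.1 x.2).ofLp - X x.1 x.2 *ᵥ u x.1 x.2))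
    {ρ : ℝ} (hρ : 0 < ρ) : ∀ᶠ x in whp P, |δh x.1 x.2 - δ₀| ≤ ρ := by
  obtain ⟨A, hA, hproj⟩ := h.exists_eventually_projErr
  have hδ₀ := h.pos₀
  have hb := h.b_pos
  have hM : 0 ≤ M := by linarith [h.one_le]
  have hcb := h.coreBound_nonneg
  have ha := h.pos
  set κ := 2 * ((b * M ^ 3 + a⁻¹ * (coreBound b M * M ^ 2)) + coreBound b M * (A + M) ^ 2) with hκ
  have hκ0 : 0 ≤ κ := by positivity
  -- κσ comes from the log-determinant and core errors of order m ≤ σN. The other summand is b times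
  -- the error of |e - Xu|² around N/δ₀, obtained by expanding the square. The prefactors turn τ - 1
  -- - log τ into (δ̂ - δ₀)².
  obtain ⟨σ, hσ0, hσ⟩ := exists_pos_apply_le (f := fun σ => δ₀ ^ 2 * ((1 + √(b / δ₀)) ^ 2 *
    (κ * σ + (σ + 2 * √(δ₀⁻¹ + σ) * σ + σ ^ 2) * b))) (by fun_prop) (by simp) (pow_pos hρ 2)
  -- The minimum supplies two bounds at once: the 1 gives |Xu| ≤ √m and m ≤ N, for fixed constants;
  -- the σ gives smallness.
  filter_upwards [hmem, hopt, hproj, hcoef _ (lt_min hσ0 one_pos), h.eventually_basic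
    (lt_min hσ0 one_pos), eventually_whp_errNorm h.memΘ hδ₀ hM h.reg
    (fun k => h.posK k _ h.memΘ) h.tendsto_N h.isLittleO h.law_e hσ0] with x h1 h2 h3 h4 h5 h6
  obtain ⟨hk, hm, hN, hmN⟩ := h5
  have hm0 : (0 : ℝ) < (D x.1).m := Nat.cast_pos.2 hm
  have hN0 : (0 : ℝ) < (D x.1).N := Nat.cast_pos.2 hN
  have hmN1 : ((D x.1).m : ℝ) ≤ (D x.1).N :=
    hmN.trans ((mul_le_mul_of_nonneg_right (min_le_right _ _) hN0.le).trans (one_mul _).le)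
  have hmNσ : ((D x.1).m : ℝ) ≤ σ * (D x.1).N :=
    hmN.trans (mul_le_mul_of_nonneg_right (min_le_left _ _) hN0.le)
  have h4σ := h4.trans (mul_le_mul_of_nonneg_right (min_le_left _ _) (Real.sqrt_nonneg _))
  have h41 := h4.trans (mul_le_mul_of_nonneg_right (min_le_right _ _) (Real.sqrt_nonneg _))
  have hsq := Real.sq_sqrt hm0.le
  have hsqN := Real.sq_sqrt hN0.le
  have hsm : √((D x.1).m : ℝ) ≤ √(D x.1).N := Real.sqrt_le_sqrt hmN1
  set v := X x.1 x.2 *ᵥ u x.1 x.2 with hv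
  set E := (e x.1 x.2).ofLp with hE
  have hv0 := vnorm_nonneg v
  have hE0 := vnorm_nonneg E
  have hW : vnorm (((D x.1).B (θh x.1 x.2))ᵀ *ᵥ (E - v)) ^ 2 ≤ (A + M) ^ 2 * (D x.1).m := by
    have w1 : vnorm (((D x.1).B (θh x.1 x.2))ᵀ *ᵥ E) ≤ A * √(D x.1).m := h3 _ h1.2
    have w2 : vnorm (((D x.1).B (θh x.1 x.2))ᵀ *ᵥ v) ≤ M * √(D x.1).m := by
      refine (vnorm_mulVec_le _ _).trans ?_
      rw [norm_transpose]
      exact mul_le_mul (hk.normB _ h1.2) (h41.trans_eq (one_mul _)) hv0 hM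
    have w3 : vnorm (((D x.1).B (θh x.1 x.2))ᵀ *ᵥ (E - v)) ≤ (A + M) * √(D x.1).m := by
      rw [Matrix.mulVec_sub]
      refine (vnorm_sub_le _ _).trans ?_
      linarith
    calc _ ≤ ((A + M) * √(D x.1).m) ^ 2 := pow_le_pow_left₀ (vnorm_nonneg _) w3 2
      _ = _ := by rw [mul_pow, hsq]
  have hEn : vnorm E ≤ √(δ₀⁻¹ + σ) * √(D x.1).N := by
    rw [← Real.sqrt_mul (by positivity)]
    refine Real.le_sqrt_of_sq_le ?_
    have := (abs_le.1 h6).2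
    linarith
  have hvn : vnorm v ≤ σ * √(D x.1).N := h4σ.trans (by gcongr)
  have hr : |vnorm (E - v) ^ 2 - Fintype.card (D x.1).Obs * δ₀⁻¹| ≤
      (σ + 2 * √(δ₀⁻¹ + σ) * σ + σ ^ 2) * (D x.1).N := by
    have r1 : vnorm (E - v) ^ 2 = vnorm E ^ 2 - 2 * (E ⬝ᵥ v) + vnorm v ^ 2 := by
      rw [vnorm_sq, vnorm_sq, vnorm_sq, sub_dotProduct, dotProduct_sub, dotProduct_sub,
        dotProduct_comm v E]
      ring
    have r2 : |E ⬝ᵥ v| ≤ √(δ₀⁻¹ + σ) * σ * (D x.1).N := by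
      refine (abs_dotProduct_le _ _).trans ?_
      calc _ ≤ (√(δ₀⁻¹ + σ) * √(D x.1).N) * (σ * √(D x.1).N) := by gcongr
        _ = √(δ₀⁻¹ + σ) * σ * √(D x.1).N ^ 2 := by ring
        _ = _ := by rw [hsqN]
    have r3 : vnorm v ^ 2 ≤ σ ^ 2 * (D x.1).N := by
      calc _ ≤ (σ * √(D x.1).N) ^ 2 := pow_le_pow_left₀ hv0 hvn 2
        _ = _ := by rw [mul_pow, hsqN]
    have r4 := abs_le.1 r2
    have r5 := abs_le.1 h6
    have r6 := sq_nonneg (vnorm v)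
    rw [r1, LowRankDesign.card_obs, abs_le]
    constructor <;> linarith
  have hδl := h.le_of_mem _ h1.1
  have hδb := h.ge_of_mem _ h1.1
  have hmain := sub_one_sub_log_le_of_optimal (h.posK x.1 _ h1.2) (hk.normB _ h1.2) (hk.normK _ h1.2)
    ha hδl hδb (h.le_of_mem _ h.memS) (h.ge_of_mem _ h.memS) hW
    hr h2
  rw [LowRankDesign.card_obs, Fintype.card_fin] at hmain
  have hδ := ha.trans_le hδl
  set τ := δh x.1 x.2 / δ₀ with hτ
  have hτ0 : 0 < τ := div_pos hδ hδ₀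
  have hmain2 : τ - 1 - Real.log τ ≤ κ * σ + (σ + 2 * √(δ₀⁻¹ + σ) * σ + σ ^ 2) * b := by
    refine le_of_mul_le_mul_left ?_ hN0
    refine hmain.trans ?_
    calc _ = κ * (D x.1).m + (σ + 2 * √(δ₀⁻¹ + σ) * σ + σ ^ 2) * (D x.1).N * b := by rw [hκ]; ring
      _ ≤ κ * (σ * (D x.1).N) + (σ + 2 * √(δ₀⁻¹ + σ) * σ + σ ^ 2) * (D x.1).N * b := by gcongr
      _ = _ := by ring
  have hsq1 := sq_sub_one_le (L := b / δ₀) hτ0 (by rw [hτ]; gcongr)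
  have hfin : (δh x.1 x.2 - δ₀) ^ 2 ≤ ρ ^ 2 := by
    have : δh x.1 x.2 - δ₀ = δ₀ * (τ - 1) := by rw [hτ]; field_simp
    rw [this, mul_pow]
    refine le_trans ?_ hσ
    gcongr
    exact hsq1.trans (by gcongr)
  exact abs_le_of_sq_le_sq hfin hρ.le

/-- Consistency of the low-rank covariance matrix in Frobenius norm. -/
lemma eventually_frobSq_le (h : IsRegularSequence P D S Θ δ₀ θ₀ a b M e X)
    (hmem : ∀ᶠ x in whp P, δh x.1 x.2 ∈ S ∧ θh x.1 x.2 ∈ Θ)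
    (hcoef : ∀ ρ > 0, ∀ᶠ x in whp P, vnorm (X x.1 x.2 *ᵥ u x.1 x.2) ≤ ρ * √(D x.1).m)
    (hnug : ∀ ρ > 0, ∀ᶠ x in whp P, |δh x.1 x.2 - δ₀| ≤ ρ)
    (hopt : ∀ᶠ x in whp P, (D x.1).deviance (δh x.1 x.2) (θh x.1 x.2)
      ((e x.1 x.2).ofLp - X x.1 x.2 *ᵥ u x.1 x.2) ≤
        (D x.1).deviance (δh x.1 x.2) θ₀ ((e x.1 x.2).ofLp - X x.1 x.2 *ᵥ u x.1 x.2))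
    {ρ : ℝ} (hρ : 0 < ρ) :
    ∀ᶠ x in whp P, frobSq ((D x.1).BKB θ₀ - (D x.1).BKB (θh x.1 x.2)) ≤ ρ * (D x.1).m := by
  obtain ⟨A, hA, hproj⟩ := h.exists_eventually_projErr
  have hδ₀ := h.pos₀
  have hb := h.b_pos
  have hM : 0 ≤ M := by linarith [h.one_le]
  have hcb := h.coreBound_nonneg
  have ha := h.pos
  set G := coreBound b M with hG
  -- Three errors, all relative to m: the uniform law for the forms in e, the replacement of e by e
  -- - Xu in those forms, and the replacement of δ₀ by the estimate inside the centring trace.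
  obtain ⟨σ, hσ0, hσ⟩ := exists_pos_apply_le (f := fun σ => (a⁻¹ + M * M * M) ^ 2 *
    (1 + √(b * (a⁻¹ + M * M * M))) ^ 2 * (2 * (σ + G * ((M * σ) * (A + M * σ) + A * (M * σ)) +
      G * (M * (a⁻¹ * σ * a⁻¹) * M)))) (by fun_prop) (by simp) hρ
  filter_upwards [hmem, hopt, hproj, hcoef σ hσ0, hnug σ hσ0, h.eventually_basic one_pos,
    eventually_whp_quadForm h.compactS h.compactΘ h.memΘ hδ₀ hM h.reg
      (fun k => h.posK k _ h.memΘ) h.tendsto_m h.law_e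
      (fun k t => lowRankCore ((D k).B t.2) ((D k).K t.2) t.1) hcb h.coreLip_nonneg
      h.eventually_core hσ0] with x h1 h2 h3 h4 h5 h6 h7
  obtain ⟨hk, hm, hN, -⟩ := h6
  have hm0 : (0 : ℝ) < (D x.1).m := Nat.cast_pos.2 hm
  have hsq := Real.sq_sqrt hm0.le
  set v := X x.1 x.2 *ᵥ u x.1 x.2 with hv
  set E := (e x.1 x.2).ofLp with hE
  set δ := δh x.1 x.2 with hδd
  have hδl := h.le_of_mem _ h1.1
  have hδb := h.ge_of_mem _ h1.1
  have hδ := ha.trans_le hδl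
  have hq : ∀ θ ∈ Θ, |(((D x.1).B θ)ᵀ *ᵥ (E - v)) ⬝ᵥ lowRankCore ((D x.1).B θ) ((D x.1).K θ) δ *ᵥ
      (((D x.1).B θ)ᵀ *ᵥ (E - v)) - (lowRankCore ((D x.1).B θ) ((D x.1).K θ) δ *
        (((D x.1).B θ)ᵀ * lowRankCov ((D x.1).B θ₀) ((D x.1).K θ₀) δ * (D x.1).B θ)).trace| ≤
      (σ + G * ((M * σ) * (A + M * σ) + A * (M * σ)) + G * (M * (a⁻¹ * σ * a⁻¹) * M)) *
        (D x.1).m := fun θ hθ => by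
    set F := lowRankCore ((D x.1).B θ) ((D x.1).K θ) δ with hF
    set B := (D x.1).B θ with hB
    have hFn : ‖F‖ ≤ G :=
      norm_lowRankCore_le (h.posK x.1 _ hθ) (hk.normB _ hθ) (hk.normK _ hθ) hδ hδb
    have q1 : |(Bᵀ *ᵥ E) ⬝ᵥ F *ᵥ (Bᵀ *ᵥ E) -
        (F * (Bᵀ * (D x.1).C δ₀ θ₀ * B)).trace| ≤ σ * (D x.1).m := h7 (δ, θ) ⟨h1.1, hθ⟩
    have w1 : vnorm (Bᵀ *ᵥ E) ≤ A * √(D x.1).m := h3 _ hθ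
    have w2 : vnorm (Bᵀ *ᵥ v) ≤ M * σ * √(D x.1).m := by
      refine (vnorm_mulVec_le _ _).trans ?_
      rw [norm_transpose, mul_assoc]
      exact mul_le_mul (hk.normB _ hθ) h4 (vnorm_nonneg _) hM
    have w3 : vnorm (Bᵀ *ᵥ (E - v)) ≤ (A + M * σ) * √(D x.1).m := by
      rw [Matrix.mulVec_sub]
      refine (vnorm_sub_le _ _).trans ?_
      linarith
    have w4 : vnorm (Bᵀ *ᵥ (E - v) - Bᵀ *ᵥ E) ≤ M * σ * √(D x.1).m := by
      rw [← Matrix.mulVec_sub, sub_sub_cancel_left, Matrix.mulVec_neg]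
      refine le_trans (le_of_eq ?_) w2
      rw [← zero_sub, ← pow_left_inj₀ (vnorm_nonneg _) (vnorm_nonneg _) two_ne_zero, vnorm_sq,
        vnorm_sq]
      simp
    have q2 : |(Bᵀ *ᵥ (E - v)) ⬝ᵥ F *ᵥ (Bᵀ *ᵥ (E - v)) - (Bᵀ *ᵥ E) ⬝ᵥ F *ᵥ (Bᵀ *ᵥ E)| ≤
        G * ((M * σ) * (A + M * σ) + A * (M * σ)) * (D x.1).m := by
      refine (abs_bilin_sub_le F F _ _ _ _).trans ?_
      rw [sub_self, norm_zero, zero_mul, zero_mul, zero_add]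
      have n1 := vnorm_nonneg (Bᵀ *ᵥ (E - v) - Bᵀ *ᵥ E)
      have n2 := vnorm_nonneg (Bᵀ *ᵥ (E - v))
      have n3 := vnorm_nonneg (Bᵀ *ᵥ E)
      calc _ ≤ G * ((M * σ * √(D x.1).m) * ((A + M * σ) * √(D x.1).m) +
            (A * √(D x.1).m) * (M * σ * √(D x.1).m)) := by gcongr
        _ = G * ((M * σ) * (A + M * σ) + A * (M * σ)) * √(D x.1).m ^ 2 := by ring
        _ = _ := by rw [hsq]
    have q3 : |(F * (Bᵀ * (D x.1).C δ₀ θ₀ * B)).trace -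
        (F * (Bᵀ * lowRankCov ((D x.1).B θ₀) ((D x.1).K θ₀) δ * B)).trace| ≤
        G * (M * (a⁻¹ * σ * a⁻¹) * M) * (D x.1).m := by
      have d1 : (D x.1).C δ₀ θ₀ - lowRankCov ((D x.1).B θ₀) ((D x.1).K θ₀) δ =
          (δ₀⁻¹ - δ⁻¹) • (1 : Matrix (D x.1).Obs (D x.1).Obs ℝ) := by
        rw [LowRankDesign.C_eq, lowRankCov, lowRankCov, sub_smul]; abel
      have d2 : |δ₀⁻¹ - δ⁻¹| ≤ a⁻¹ * σ * a⁻¹ := by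
        have : δ₀⁻¹ - δ⁻¹ = δ₀⁻¹ * (δ - δ₀) * δ⁻¹ := by field_simp
        rw [this, abs_mul, abs_mul, abs_of_pos (inv_pos.2 hδ₀), abs_of_pos (inv_pos.2 hδ)]
        have := h.le_of_mem _ h.memS
        gcongr
      rw [← Matrix.trace_sub, ← Matrix.mul_sub, ← Matrix.sub_mul, ← Matrix.mul_sub, d1]
      refine (abs_trace_le _).trans ?_
      rw [Fintype.card_fin, mul_comm]
      refine mul_le_mul_of_nonneg_right ?_ hm0.le
      exact l2norm_mul_le_of_le hFn (l2norm_mul_le_of_le (l2norm_mul_le_of_le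
        ((norm_transpose _).trans_le (hk.normB _ hθ)) ((norm_smul_one_le _).trans d2))
        (hk.normB _ hθ))
    have b1 := abs_le.1 q1
    have b2 := abs_le.1 q2
    have b3 := abs_le.1 q3
    rw [abs_le]
    constructor <;> linarith
  have hmain := frobSq_le_of_optimal (h.posK x.1 _ h1.2) (h.posK x.1 _ h.memΘ) (hk.normB _ h1.2)
    (hk.normK _ h1.2) (hk.normB _ h.memΘ) (hk.normK _ h.memΘ) ha hδl hδb (hq _ h1.2)
    (hq _ h.memΘ) h2
  refine hmain.trans ?_
  calc _ = (a⁻¹ + M * M * M) ^ 2 * (1 + √(b * (a⁻¹ + M * M * M))) ^ 2 *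
        (2 * (σ + G * ((M * σ) * (A + M * σ) + A * (M * σ)) + G * (M * (a⁻¹ * σ * a⁻¹) * M))) *
          (D x.1).m := by ring
    _ ≤ _ := by gcongr

end IsRegularSequence

end Consistency

/-! ### From the statistical model to a regular sequence -/

section Model

open scoped Matrix.Norms.L2Operator ENNReal

variable {p q : ℕ} {Loc Ω : Type*} [MeasurableSpace Ω] {P : Measure Ω} [IsProbabilityMeasure P]

lemma frobSq_sub_comm {ι κ : Type*} [Fintype ι] [Fintype κ] (A B : Matrix ι κ ℝ) :
    frobSq (A - B) = frobSq (B - A) := by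
  simp only [frobSq, Matrix.sub_apply]
  exact Finset.sum_congr rfl fun i _ => Finset.sum_congr rfl fun j _ => sub_sq_comm _ _

lemma tendstoInMeasure_of_eventually_whp {E : Type*} [PseudoMetricSpace E] {f : ℕ → Ω → E} {c : E}
    (h : ∀ ρ > 0, ∀ᶠ x in whp P, dist (f x.1 x.2) c ≤ ρ) :
    TendstoInMeasure P f atTop (fun _ => c) := by
  rw [tendstoInMeasure_iff_dist]
  intro ε hε
  -- Half of ε, because the event to be excluded is the non-strict ε ≤ dist.
  have h1 := eventually_whp.1 (h (ε / 2) (half_pos hε))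
  refine tendsto_of_tendsto_of_tendsto_of_le_of_le tendsto_const_nhds h1 (fun _ => zero_le)
    fun k => measure_mono fun ω hω => ?_
  simp only [Set.mem_ofPred_eq, not_le] at hω ⊢
  linarith

namespace LowRankDesign

variable {D : LowRankDesign q Loc} {ν : Measure (EuclideanSpace ℝ (Fin p))} {δ₀ : ℝ}
  {θ₀ : EuclideanSpace ℝ (Fin q)} {x : D.Obs → Ω → EuclideanSpace ℝ (Fin p)}
  {η : Ω → EuclideanSpace ℝ (Fin D.m)} {ε : D.Obs → Ω → ℝ}

/-- The total error `B(θ) η + ε`. -/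
def totalErr (D : LowRankDesign q Loc) (θ : EuclideanSpace ℝ (Fin q))
    (η : Ω → EuclideanSpace ℝ (Fin D.m)) (ε : D.Obs → Ω → ℝ) (ω : Ω) : EuclideanSpace ℝ D.Obs :=
  WithLp.toLp 2 (D.B θ *ᵥ (η ω).ofLp + fun r => ε r ω)

lemma IsModel.hasLaw_totalErr (h : D.IsModel P ν δ₀ θ₀ x η ε) (hδ₀ : 0 < δ₀)
    (hK : (D.K θ₀).PosSemidef) :
    HasLaw (D.totalErr θ₀ η ε) (multivariateGaussian 0 (D.C δ₀ θ₀)) P :=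
  hasLaw_error hδ₀ hK h.law_η h.law_ε h.indep_ε h.indep_η_ε

lemma IsModel.indepFun_totalErr (h : D.IsModel P ν δ₀ θ₀ x η ε) (i : Fin p) :
    IndepFun (fun ω r => x r ω i) (D.totalErr θ₀ η ε) P := by
  have hf : Measurable fun y : D.Obs → EuclideanSpace ℝ (Fin p) => fun r => y r i :=
    Continuous.measurable (by fun_prop)
  have hg : Measurable fun y : EuclideanSpace ℝ (Fin D.m) × (D.Obs → ℝ) =>
      (WithLp.toLp 2 (D.B θ₀ *ᵥ y.1.ofLp + y.2) : EuclideanSpace ℝ D.Obs) :=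
    Continuous.measurable (by fun_prop)
  exact h.indep_x_ηε.comp hf hg

lemma negLogLik_le_iff {X : Matrix D.Obs (Fin p) ℝ} {z : D.Obs → ℝ}
    {γ γ' : EuclideanSpace ℝ (Fin p)} {δ δ' : ℝ} {θ θ' : EuclideanSpace ℝ (Fin q)} :
    D.negLogLik X z γ δ θ ≤ D.negLogLik X z γ' δ' θ' ↔
      D.deviance δ θ (z - X *ᵥ γ.ofLp) ≤ D.deviance δ' θ' (z - X *ᵥ γ'.ofLp) := by
  unfold negLogLik deviance
  constructor <;> intro h <;> linarith

lemma obs_sub_mulVec {X : Matrix D.Obs (Fin p) ℝ} {γ γ₀ : EuclideanSpace ℝ (Fin p)} {ω : Ω} :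
    D.obs γ₀ θ₀ X (fun i => η ω i) (fun r => ε r ω) - X *ᵥ γ.ofLp =
      (D.totalErr θ₀ η ε ω).ofLp - X *ᵥ (γ - γ₀).ofLp := by
  simp only [obs, totalErr, WithLp.ofLp_sub, Matrix.mulVec_sub]
  abel

end LowRankDesign

section Rows

variable {ν : Measure (EuclideanSpace ℝ (Fin p))} {D : ℕ → LowRankDesign q Loc}
  {x : ∀ k, (D k).Obs → Ω → EuclideanSpace ℝ (Fin p)}

lemma eventually_whp_gram_sub [IsFiniteMeasure ν] (hν : IsSubGaussianLaw ν)
    (hN : Tendsto (fun k => (D k).N) atTop atTop) (hx : ∀ k r, HasLaw (x k r) ν P)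
    (hind : ∀ k, iIndepFun (x k) P) {ρ : ℝ} (hρ : 0 < ρ) :
    ∀ᶠ y in whp P, ∀ i j, |∑ r, x y.1 r y.2 i * x y.1 r y.2 j -
      (D y.1).N * secondMoment ν i j| ≤ ρ * (D y.1).N := by
  rw [eventually_all]; intro i
  rw [eventually_all]; intro j
  have h := eventually_whp_sum_sub (ι := fun k => (D k).Obs)
    (by simpa only [LowRankDesign.card_obs] using hN) hx hind
    (f := fun y : EuclideanSpace ℝ (Fin p) => y i * y j)
    (Continuous.measurable (by fun_prop)) (hν.memLp_mul_coord i j) hρ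
  simpa only [LowRankDesign.card_obs, secondMoment, Matrix.of_apply] using h

lemma lintegral_coord_sq_le [IsFiniteMeasure ν] (hν : IsSubGaussianLaw ν) {Y : Ω → EuclideanSpace ℝ (Fin p)}
    (hY : HasLaw Y ν P) (i : Fin p) :
    ∫⁻ ω, ENNReal.ofReal (Y ω i ^ 2) ∂P ≤ ENNReal.ofReal (∑ j, secondMoment ν j j) := by
  have h1 := hY.lintegral_comp (f := fun y : EuclideanSpace ℝ (Fin p) => ENNReal.ofReal (y i ^ 2))
    (Measurable.aemeasurable (ENNReal.measurable_ofReal.comp (Continuous.measurable (by fun_prop))))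
  have hsq : ∀ j, ∫ y, y j ^ 2 ∂ν = secondMoment ν j j := fun j => by
    simp only [secondMoment, Matrix.of_apply, sq]
  have h2 : Integrable (fun y : EuclideanSpace ℝ (Fin p) => y i ^ 2) ν := by
    simpa only [sq] using (hν.memLp_mul_coord i i).integrable (by norm_num)
  refine (le_of_eq h1).trans ?_
  rw [← ofReal_integral_eq_lintegral_ofReal h2 (ae_of_all _ fun _ => sq_nonneg _), hsq]
  refine ENNReal.ofReal_le_ofReal (Finset.single_le_sum (f := fun j => secondMoment ν j j)
    (fun j _ => ?_) (Finset.mem_univ i))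
  simp only [← hsq]
  exact integral_nonneg fun _ => sq_nonneg _

/-- The hypotheses of the consistency theorem provide a regular sequence of models. -/
lemma exists_isRegularSequence {S : Set ℝ} {Θ : Set (EuclideanSpace ℝ (Fin q))} {δ₀ : ℝ}
    {θ₀ : EuclideanSpace ℝ (Fin q)} {γ₀ : EuclideanSpace ℝ (Fin p)}
    (hN : Tendsto (fun k => (D k).N) atTop atTop)
    (hm : Tendsto (fun k => (D k).m) atTop atTop)
    (hmN : (fun k => ((D k).m : ℝ)) =o[atTop] (fun k => ((D k).N : ℝ)))
    (hS : IsCompact S) (hΘ : IsCompact Θ) (hSpos : ∃ a : ℝ, 0 < a ∧ S ⊆ Set.Ici a)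
    (hδ₀ : δ₀ ∈ S) (hθ₀ : θ₀ ∈ Θ) (hK : ∀ k, ∀ θ ∈ Θ, ((D k).K θ).PosDef)
    (hBsmooth : SmoothBounded (convexHull ℝ Θ) fun k => (D k).B)
    (hKsmooth : SmoothBounded (convexHull ℝ Θ) fun k => (D k).K)
    (hν : IsSubGaussianLaw ν) {η : ∀ k, Ω → EuclideanSpace ℝ (Fin (D k).m)}
    {ε : ∀ k, (D k).Obs → Ω → ℝ} (hmodel : ∀ k, (D k).IsModel P ν δ₀ θ₀ (x k) (η k) (ε k))
    {X : ∀ k, Ω → Matrix (D k).Obs (Fin p) ℝ} {z : ∀ k, Ω → (D k).Obs → ℝ}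
    (hX : ∀ k ω, X k ω = Matrix.of fun r a => x k r ω a)
    (hHess : ∃ lam : ℝ, 0 < lam ∧ ∀ᶠ k in atTop,
      ((D k).scaledHess P (X k) (z k) γ₀ δ₀ θ₀ - lam • 1).PosDef) :
    ∃ a b M : ℝ, IsRegularSequence P D S Θ δ₀ θ₀ a b M
      (fun k => (D k).totalErr θ₀ (η k) (ε k)) X := by
  obtain ⟨a, ha, hSa⟩ := hSpos
  obtain ⟨b, hb⟩ := hS.isBounded.bddAbove
  obtain ⟨M, hM, hreg⟩ := exists_isRegularOn hBsmooth hKsmooth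
  obtain ⟨lam, hlam, hH⟩ := hHess
  have hδpos : 0 < δ₀ := ha.trans_le (hSa hδ₀)
  -- The law ν does not depend on k, so a single model with observations and a nondegenerate Hessian
  -- bounds its second moments for the entire sequence. That model's first row also shows that ν is
  -- a probability measure.
  obtain ⟨k, hNk, hHk⟩ := ((hN.eventually_gt_atTop 0).and hH).exists
  have hne : Nonempty (D k).Obs := by
    rw [← Fintype.card_pos_iff, LowRankDesign.card_obs]; exact hNk
  have hprob : IsProbabilityMeasure ν := by
    rw [← ((hmodel k).law_x hne.some).map_eq]
    exact Measure.isProbabilityMeasure_map ((hmodel k).law_x hne.some).aemeasurable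
  have hXr : ∀ k i, (fun ω r => X k ω r i) = fun ω r => x k r ω i := fun k i => by
    funext ω r; rw [hX]; rfl
  obtain ⟨U, hU, hΘU, hBU⟩ := hBsmooth.1 k
  obtain ⟨U', hU', hΘU', hKU⟩ := hKsmooth.1 k
  have hθ₀c : θ₀ ∈ convexHull ℝ Θ := subset_convexHull ℝ Θ hθ₀
  have hsecond := LowRankDesign.secondMoment_ge hν (hmodel k).law_x (hX k) hδpos
    (hK k _ hθ₀).posSemidef (hU.inter hU') ⟨hΘU hθ₀c, hΘU' hθ₀c⟩
    (fun r i => (hBU r i).1.mono Set.inter_subset_left)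
    (fun i j => (hKU i j).1.mono Set.inter_subset_right) hNk hHk
  have hgram := fun ρ hρ => eventually_whp_gram_sub (ρ := ρ) hν hN (fun k => (hmodel k).law_x)
    (fun k => (hmodel k).indep_x) hρ
  have hdiag : ∀ j, 0 ≤ secondMoment ν j j := fun j =>
    integral_nonneg fun y => mul_self_nonneg _
  refine ⟨a, b, M, ?_⟩
  constructor
  case compactS => exact hS
  case compactΘ => exact hΘ
  case pos => exact ha
  case le_of_mem => exact fun δ hδ => hSa hδ
  case ge_of_mem => exact fun δ hδ => hb hδ
  case one_le => exact hM
  case memS => exact hδ₀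
  case memΘ => exact hθ₀
  case posK => exact fun k θ hθ => (hK k θ hθ).posSemidef
  case reg => exact hreg
  case tendsto_m => exact hm
  case tendsto_N => exact hN
  case isLittleO => exact hmN
  case law_e => exact fun k => (hmodel k).hasLaw_totalErr hδpos (hK k _ hθ₀).posSemidef
  case meas_X =>
    intro k i
    rw [hXr]
    refine aemeasurable_pi_lambda _ fun r => ?_
    exact (Continuous.measurable (f := fun y : EuclideanSpace ℝ (Fin p) => y i)
      (by fun_prop)).comp_aemeasurable ((hmodel k).law_x r).aemeasurable
  case indep =>
    intro k i
    rw [hXr]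
    exact (hmodel k).indepFun_totalErr i
  case moment =>
    refine ⟨∑ j, secondMoment ν j j, fun i k r => ?_⟩
    simp only [hX, Matrix.of_apply]
    exact lintegral_coord_sq_le hν ((hmodel k).law_x r) i
  case column =>
    -- The trace of the second moment matrix dominates every diagonal entry, and the 1 is the
    -- tolerance of the law of large numbers.
    refine ⟨√(∑ j, secondMoment ν j j + 1), Real.sqrt_nonneg _, fun i => ?_⟩
    filter_upwards [hgram 1 one_pos] with y hy
    have h1 := (abs_le.1 (hy i i)).2
    rw [← Real.sqrt_mul (add_nonneg (Finset.sum_nonneg fun j _ => hdiag j) zero_le_one)]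
    refine Real.le_sqrt_of_sq_le ?_
    rw [vnorm_sq]
    simp only [dotProduct, hX, Matrix.of_apply]
    have h2 : secondMoment ν i i ≤ ∑ j, secondMoment ν j j :=
      Finset.single_le_sum (f := fun j => secondMoment ν j j) (fun j _ => hdiag j)
        (Finset.mem_univ i)
    have h3 := mul_le_mul_of_nonneg_left h2 (Nat.cast_nonneg (α := ℝ) (D y.1).N)
    linarith
  case gram =>
    have hc : 0 < lam / δ₀ := div_pos hlam hδpos
    -- The entrywise tolerance makes the total error over p² entries at most half of the limiting
    -- constant; the +1 covers p = 0.
    refine ⟨lam / δ₀ / 2, half_pos hc, ?_⟩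
    filter_upwards [hgram (lam / δ₀ / 2 / (p ^ 2 + 1)) (by positivity)] with y hy u
    refine le_trans ?_ (vnorm_mulVec_sq_ge (Nat.cast_nonneg _) hsecond
      (fun i j => by simpa only [hX, Matrix.of_apply] using hy i j) u)
    have h1 : (p : ℝ) ^ 2 * (lam / δ₀ / 2 / (p ^ 2 + 1)) ≤ lam / δ₀ / 2 := by
      rw [mul_div_assoc', div_le_iff₀ (by positivity)]
      nlinarith
    have h2 : lam / δ₀ / 2 ≤ lam / δ₀ - p ^ 2 * (lam / δ₀ / 2 / (p ^ 2 + 1)) := by linarith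
    have := (Nat.cast_nonneg (D y.1).N : (0 : ℝ) ≤ _)
    gcongr

end Rows

end Model

end

/-! ### The consistency theorem -/

theorem theorem2 {p q : ℕ} {Loc Ω : Type*} [MeasurableSpace Ω]
    (P : Measure Ω) [IsProbabilityMeasure P]
    -- the sequence of models, with `N → ∞`, `m → ∞` and `m = o(N)`
    (D : ℕ → LowRankDesign q Loc)
    (hN : Tendsto (fun k => (D k).N) atTop atTop)
    (hm : Tendsto (fun k => (D k).m) atTop atTop)
    (hmN : (fun k => ((D k).m : ℝ)) =o[atTop] (fun k => ((D k).N : ℝ)))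
    -- parameter spaces and true parameters
    (Γ : Set (EuclideanSpace ℝ (Fin p))) (S : Set ℝ) (Θ : Set (EuclideanSpace ℝ (Fin q)))
    (hΓ : IsCompact Γ) (hS : IsCompact S) (hΘ : IsCompact Θ)
    (hSpos : ∃ a : ℝ, 0 < a ∧ S ⊆ Set.Ici a)
    (γ₀ : EuclideanSpace ℝ (Fin p)) (δ₀ : ℝ) (θ₀ : EuclideanSpace ℝ (Fin q))
    (hγ₀ : γ₀ ∈ Γ) (hδ₀ : δ₀ ∈ S) (hθ₀ : θ₀ ∈ Θ)
    -- `K(θ)` is a nonsingular covariance matrix with bounded inverse; `B` and `K` are smooth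
    (hK : ∀ k, ∀ θ ∈ Θ, ((D k).K θ).PosDef)
    (hKinv : ∀ θ ∈ Θ, ∃ M : ℝ, ∀ᶠ k in atTop, opNorm ((D k).K θ)⁻¹ ≤ M)
    (hBsmooth : SmoothBounded (convexHull ℝ Θ) fun k => (D k).B)
    (hKsmooth : SmoothBounded (convexHull ℝ Θ) fun k => (D k).K)
    -- the data: i.i.d. sub-Gaussian covariates, Gaussian coefficients and noise
    (ν : Measure (EuclideanSpace ℝ (Fin p))) (hν : IsSubGaussianLaw ν)
    (x : ∀ k, (D k).Obs → Ω → EuclideanSpace ℝ (Fin p))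
    (η : ∀ k, Ω → EuclideanSpace ℝ (Fin (D k).m))
    (ε : ∀ k, (D k).Obs → Ω → ℝ)
    (hmodel : ∀ k, (D k).IsModel P ν δ₀ θ₀ (x k) (η k) (ε k))
    (X : ∀ k, Ω → Matrix (D k).Obs (Fin p) ℝ)
    (hX : ∀ k ω, X k ω = Matrix.of fun r a => x k r ω a)
    (z : ∀ k, Ω → (D k).Obs → ℝ)
    (hz : ∀ k ω, z k ω = (D k).obs γ₀ θ₀ (X k ω) (fun i => η k ω i) (fun r => ε k r ω))
    -- the smallest eigenvalue of the scaled expected Hessian at the truth is bounded below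
    (hHess : ∃ lam : ℝ, 0 < lam ∧ ∀ᶠ k in atTop,
      ((D k).scaledHess P (X k) (z k) γ₀ δ₀ θ₀ - lam • 1).PosDef)
    -- identifiability of `θ`
    (hident : ∀ ξ : ℝ, 0 < ξ → ∃ c : ℝ, 0 < c ∧ ∀ᶠ k in atTop, ∀ θ ∈ Θ, ξ < ‖θ - θ₀‖ →
      c < 1 / ((D k).m : ℝ) * frobSq ((D k).BKB θ - (D k).BKB θ₀))
    -- maximum-likelihood estimators
    (γhat : ℕ → Ω → EuclideanSpace ℝ (Fin p)) (δhat : ℕ → Ω → ℝ)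
    (θhat : ℕ → Ω → EuclideanSpace ℝ (Fin q))
    (hMLE : ∀ k, ∀ᵐ ω ∂P,
      (D k).IsMLE Γ S Θ (X k ω) (z k ω) (γhat k ω) (δhat k ω) (θhat k ω)) :
    TendstoInMeasure P γhat atTop (fun _ => γ₀) ∧
    TendstoInMeasure P δhat atTop (fun _ => δ₀) ∧
    TendstoInMeasure P θhat atTop (fun _ => θ₀) := by
  obtain ⟨a, b, M, h⟩ := exists_isRegularSequence hN hm hmN hS hΘ hSpos hδ₀ hθ₀ hK hBsmooth
    hKsmooth hν hmodel hX hHess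
  have hopt : ∀ᶠ y in whp P, (D y.1).IsMLE Γ S Θ (X y.1 y.2) (z y.1 y.2) (γhat y.1 y.2)
      (δhat y.1 y.2) (θhat y.1 y.2) :=
    eventually_whp_of_ae (p := fun k ω => (D k).IsMLE Γ S Θ (X k ω) (z k ω) (γhat k ω)
      (δhat k ω) (θhat k ω)) (Eventually.of_forall hMLE)
  have hmem : ∀ᶠ y in whp P, δhat y.1 y.2 ∈ S ∧ θhat y.1 y.2 ∈ Θ :=
    hopt.mono fun y hy => ⟨hy.2.1, hy.2.2.1⟩
  have hdev : ∀ᶠ y in whp P, ∀ γ ∈ Γ, ∀ δ ∈ S, ∀ θ ∈ Θ,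
      (D y.1).deviance (δhat y.1 y.2) (θhat y.1 y.2) (((D y.1).totalErr θ₀ (η y.1) (ε y.1) y.2).ofLp -
        X y.1 y.2 *ᵥ (γhat y.1 y.2 - γ₀).ofLp) ≤
      (D y.1).deviance δ θ (((D y.1).totalErr θ₀ (η y.1) (ε y.1) y.2).ofLp -
        X y.1 y.2 *ᵥ (γ - γ₀).ofLp) := by
    filter_upwards [hopt] with y hy γ hγ δ hδ θ hθ
    have := LowRankDesign.negLogLik_le_iff.1 (hy.2.2.2 γ hγ δ hδ θ hθ)
    rwa [hz, LowRankDesign.obs_sub_mulVec, LowRankDesign.obs_sub_mulVec] at this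
  have hγmem : ∀ᶠ y in whp P, γhat y.1 y.2 ∈ Γ := hopt.mono fun y hy => hy.1
  -- First competitor: γ₀ with the estimated δ and θ, for which the residual is the pure error e.
  have hcoef := fun ρ (hρ : 0 < ρ) => h.eventually_coef_le
    (u := fun k ω => (γhat k ω - γ₀).ofLp) hmem (by
      filter_upwards [hdev, hmem] with y h1 h2
      simpa using h1 γ₀ hγ₀ _ h2.1 _ h2.2) hρ
  have hfit : ∀ ρ > 0, ∀ᶠ y in whp P, vnorm (X y.1 y.2 *ᵥ (γhat y.1 y.2 - γ₀).ofLp) ≤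
      ρ * √(D y.1).m := fun ρ hρ => (hcoef ρ hρ).mono fun y hy => hy.2
  -- Second competitor: δ₀ with the estimated γ and θ. This works before θ is known to converge,
  -- since θ affects the likelihood only at order m = o(N).
  have hnug : ∀ ρ > 0, ∀ᶠ y in whp P, |δhat y.1 y.2 - δ₀| ≤ ρ := fun ρ hρ =>
    h.eventually_nugget_le (u := fun k ω => (γhat k ω - γ₀).ofLp) hmem hfit (by
      filter_upwards [hdev, hmem, hγmem] with y h1 h2 h3
      exact h1 _ h3 _ hδ₀ _ h2.2) hρ
  refine ⟨tendstoInMeasure_of_eventually_whp fun ρ hρ => ?_,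
    tendstoInMeasure_of_eventually_whp fun ρ hρ => ?_,
    tendstoInMeasure_of_eventually_whp fun ξ hξ => ?_⟩
  · filter_upwards [hcoef ρ hρ] with y hy
    rw [dist_eq_norm]
    exact hy.1
  · exact hnug ρ hρ
  · obtain ⟨c, hc, hcθ⟩ := hident ξ hξ
    -- Third competitor: θ₀ with the estimated γ and δ. The Frobenius bound is taken at exactly the
    -- identifiability constant c, so a distance above ξ is contradictory.
    filter_upwards [h.eventually_frobSq_le (u := fun k ω => (γhat k ω - γ₀).ofLp) hmem hfit hnug (by
      filter_upwards [hdev, hmem, hγmem] with y h1 h2 h3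
      exact h1 _ h3 _ h2.1 _ hθ₀) hc, hmem, h.eventually_basic one_pos,
      eventually_whp_of_eventually (P := P) hcθ] with y h1 h2 h3 h4
    by_contra hcon
    rw [not_le, dist_eq_norm] at hcon
    have h5 := h4 _ h2.2 hcon
    rw [frobSq_sub_comm, one_div, lt_inv_mul_iff₀ (Nat.cast_pos.2 h3.2.1)] at h5
    linarith
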